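/- Let $\mathbb{K}$ be an algebraically closed field of characteristic $0$ and $V$ a $\mathbb{K}$-vector space with a countably infinite basis $E$. Let $\mathbf{G}(E)=GL(\infty)$ be the group of all linear automorphisms $g$ of $V$ with $g(e)=e$ for all but finitely many $e\in E$. If $V$ carries a nondegenerate symmetric or skew-symmetric bilinear form $\omega$ and $E$ is $\omega$-isotropic, i.e. equipped with an involution $i_E:E\to E$ with at most one fixed point such that $\omega(e,e')=0$ unless $e'=i_E(e)$, let $\mathbf{G}^\omega(E)$ be the group of all $g\in\mathbf{G}(E)$ preserving $\omega$; it is $Sp(\infty)$ for $\omega$ skew-symmetric and $O(\infty)$ for $\omega$ symmetric, and in the symmetric case we assume that $i_E$ has a fixed point. Let $\mathbf{G}$ be $\mathbf{G}(E)$ or $\mathbf{G}^\omega(E)$, and let $\mathbf{H}\subset\mathbf{G}$ be the splitting Cartan subgroup of the elements that are diagonal in $E$. For a finite set $I\subset E$ let $G_I$ be the algebraic group of those $g\in\mathbf{G}$ that preserve the span $\langle I\rangle$ and fix every $e\in E\setminus I$; for $\mathbf{G}=\mathbf{G}^\omega(E)$ only sets $I$ that are $i_E$-stable and contain the fixed point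 of $i_E$ (if any) are used. A subgroup $Q\subset\mathbf{G}$ is a closed ind-subgroup if every $Q\cap G_I$ is Zariski closed in $G_I$. A splitting Borel subgroup is a closed ind-subgroup $\mathbf{B}\supset\mathbf{H}$ which is maximal among the closed ind-subgroups $Q\supset\mathbf{H}$ that are locally solvable (every algebraic subgroup of $Q$ is solvable) and for which every $Q\cap G_I$ is generated by its identity component and $\mathbf{H}\cap G_I$ (equivalently: $Q\cap G_I$ is connected, respectively, for $O(\infty)$, its intersection with the special orthogonal group is connected). A splitting parabolic subgroup is a closed ind-subgroup containing a splitting Borel subgroup. Let $\mathbf{W}$ be the group of permutations $w$ of $E$ that fix all but finitely many elements and, if $\mathbf{G}=\mathbf{G}^\omega(E)$, commute with $i_E$. A lift of $w\in\mathbf{W}$ is an element $\hat w\in\mathbf{G}$ such that $\hat w(e)=\lambda_e w(e)$ for all $e\in E$, with scalars $\lambda_e\in\mathbb{K}^*$. For a surjection $\sigma:E\to A$ onto a totally ordered set $(A,\preceq)$, let $\mathcal{F}_\sigma=\{F'_\alpha,F''_\alpha:\alpha\in A\}$ be the generalized flag with $F'_\alpha=\langle e\in E:\sigma(e)\prec\alpha\rangle$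 and $F''_\alpha=\langle e\in E:\sigma(e)\preceq\alpha\rangle$. If $\mathbf{G}=\mathbf{G}^\omega(E)$, call $\sigma$ admissible if $\sigma\circ i_E=i_A\circ\sigma$ for some order-reversing involution $i_A$ of $A$; if $\mathbf{G}=\mathbf{G}(E)$, every $\sigma$ is admissible. **Statement.** Let $\mathbf{P}$ be a splitting parabolic subgroup and $\mathbf{B}$ a splitting Borel subgroup of $\mathbf{G}$ (both containing $\mathbf{H}$; $\mathbf{B}$ is not assumed to be conjugate to a subgroup of $\mathbf{P}$). Then $\mathbf{P}$ is the stabilizer in $\mathbf{G}$ of $\mathcal{F}_{\sigma_0}$ for some admissible $\sigma_0$, and every $w\in\mathbf{W}$ has a lift $\hat w$. For every such $\sigma_0$, with $\mathbf{W}_\mathbf{P}=\{w\in\mathbf{W}:\sigma_0\circ w^{-1}=\sigma_0\}$, the double coset $\mathbf{B}\hat w\mathbf{P}$ depends only on the class of $w$ in $\mathbf{W}/\mathbf{W}_\mathbf{P}$, and $$\mathbf{G}=\bigsqcup_{w\in\mathbf{W}/\mathbf{W}_\mathbf{P}}\mathbf{B}\hat w\mathbf{P}\qquad\text{(disjoint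 union)}.$$ -/

import Mathlib

universe u v w

namespace ClassicalIndGroup

open Module

/-- `b` is an `ω`-isotropic basis with involution `inv` (on the index set), where `ω` is a
nondegenerate form which is either alternating, or symmetric; in the symmetric case the basis
is of type B, that is, the involution has a fixed point. -/
structure IsIsotropicBasis {K : Type u} {V : Type v} {ι : Type w} [Field K] [AddCommGroup V]
    [Module K V] (b : Basis ι K V) (ω : LinearMap.BilinForm K V) (inv : ι → ι) : Prop where
  nondegenerate : ω.Nondegenerate
  form_type : ω.IsAlt ∨ (ω.IsSymm ∧ ∃ i, inv i = i)
  involutive : Function.Involutive inv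
  fixed_unique : ∀ i j, inv i = i → inv j = j → i = j
  isotropic : ∀ i j, j ≠ inv i → ω (b i) (b j) = 0

/-- The two kinds of data defining a classical ind-group from a basis `E` (here `b`) of `V`:
no form (`GL(∞)`), or a form `ω` for which `E` is isotropic (`Sp(∞)` or `O(∞)`). -/
inductive Datum {K : Type u} {V : Type v} {ι : Type w} [Field K] [AddCommGroup V]
    [Module K V] (b : Basis ι K V) : Type (max u v w)
  | gl : Datum b
  | form (ω : LinearMap.BilinForm K V) (inv : ι → ι) (h : IsIsotropicBasis b ω inv) : Datum b

section

variable {K : Type u} {V : Type v} {ι : Type w} [Field K] [AddCommGroup V] [Module K V]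

/-- The group of linear automorphisms of `V` fixing all but finitely many basis vectors. -/
def finitaryGroup (b : Basis ι K V) : Subgroup (V ≃ₗ[K] V) where
  carrier := {g | {i | g (b i) ≠ b i}.Finite}
  one_mem' := by simp
  mul_mem' := by
    intro g h hg hh
    refine (hg.union hh).subset ?_
    intro i hi
    by_contra hcon
    simp only [Set.mem_union, Set.mem_ofPred_eq, not_or, not_not] at hcon
    apply hi
    rw [LinearEquiv.mul_apply, hcon.2, hcon.1]
  inv_mem' := by
    intro g hg
    refine hg.subset ?_
    intro i hi hcon
    apply hi
    have : g⁻¹ (g (b i)) = b i := g.symm_apply_apply (b i)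
    rwa [hcon] at this

/-- The group of linear automorphisms of `V` preserving the bilinear form `ω`. -/
def isometryGroup (ω : LinearMap.BilinForm K V) : Subgroup (V ≃ₗ[K] V) where
  carrier := {g | ∀ x y, ω (g x) (g y) = ω x y}
  one_mem' := fun _ _ => rfl
  mul_mem' := by
    intro g h hg hh x y
    rw [LinearEquiv.mul_apply, LinearEquiv.mul_apply, hg, hh]
  inv_mem' := by
    intro g hg x y
    rw [← hg (g⁻¹ x) (g⁻¹ y)]
    have h1 : ∀ z, g (g⁻¹ z) = z := fun z => g.apply_symm_apply z
    rw [h1, h1]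

/-- The automorphisms which are diagonal in the basis `b`. -/
def diagonalGroup (b : Basis ι K V) : Subgroup (V ≃ₗ[K] V) where
  carrier := {g | ∀ i, ∃ c : K, g (b i) = c • b i}
  one_mem' := fun i => ⟨1, by simp⟩
  mul_mem' := by
    intro g h hg hh i
    obtain ⟨c, hc⟩ := hg i
    obtain ⟨d, hd⟩ := hh i
    refine ⟨d * c, ?_⟩
    rw [LinearEquiv.mul_apply, hd, map_smul, hc, smul_smul]
  inv_mem' := by
    intro g hg i
    obtain ⟨c, hc⟩ := hg i
    have hc0 : c ≠ 0 := by
      rintro rfl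
      rw [zero_smul] at hc
      exact b.ne_zero i (g.map_eq_zero_iff.mp hc)
    refine ⟨c⁻¹, ?_⟩
    apply g.injective
    have h1 : g (g⁻¹ (b i)) = b i := g.apply_symm_apply (b i)
    rw [h1, map_smul, hc, smul_smul, inv_mul_cancel₀ hc0, one_smul]

/-- `GL(⟨I⟩)` for a set `I` of basis vectors, extended by the identity on the others. -/
def levelGroup (b : Basis ι K V) (I : Finset ι) : Subgroup (V ≃ₗ[K] V) where
  carrier := {g | (∀ i, i ∉ I → g (b i) = b i) ∧
    ∀ x, g x ∈ Submodule.span K (b '' (I : Set ι)) ↔ x ∈ Submodule.span K (b '' (I : Set ι))}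
  one_mem' := ⟨fun _ _ => rfl, fun _ => Iff.rfl⟩
  mul_mem' := by
    intro g h hg hh
    refine ⟨fun i hi => ?_, fun x => ?_⟩
    · rw [LinearEquiv.mul_apply, hh.1 i hi, hg.1 i hi]
    · rw [LinearEquiv.mul_apply, hg.2, hh.2]
  inv_mem' := by
    intro g hg
    have h1 : ∀ z, g (g⁻¹ z) = z := fun z => g.apply_symm_apply z
    refine ⟨fun i hi => ?_, fun x => ?_⟩
    · apply g.injective
      rw [h1, hg.1 i hi]
    · rw [← hg.2, h1]

/-- The ind-group `𝐆`: either `𝐆(E)` or `𝐆^ω(E)`. -/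
def indGroup {b : Basis ι K V} : Datum b → Subgroup (V ≃ₗ[K] V)
  | .gl => finitaryGroup b
  | .form ω _ _ => finitaryGroup b ⊓ isometryGroup ω

/-- The splitting Cartan subgroup `𝐇` of `𝐆`: the elements of `𝐆` diagonal in `E`. -/
def cartan {b : Basis ι K V} (d : Datum b) : Subgroup (V ≃ₗ[K] V) :=
  indGroup d ⊓ diagonalGroup b

/-- The finite subsets of the basis which are used to exhaust `𝐆`: all finite subsets for
`𝐆(E)`; for `𝐆^ω(E)` the finite subsets stable under the involution and containing its fixed
point if there is one. -/
def Admissible {b : Basis ι K V} : Datum b → Finset ι → Prop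
  | .gl, _ => True
  | .form _ inv _, I => (∀ i ∈ I, inv i ∈ I) ∧ ∀ i, inv i = i → i ∈ I

/-- The trace of `X` on `GL(⟨I⟩)` is Zariski closed: it is cut out by polynomials in the matrix
coefficients. -/
def IsZariskiClosedAt (b : Basis ι K V) (I : Finset ι) (X : Set (V ≃ₗ[K] V)) : Prop :=
  ∃ S : Set (MvPolynomial (I × I) K), ∀ g ∈ levelGroup b I,
    g ∈ X ↔ ∀ p ∈ S, MvPolynomial.eval (fun ij => b.repr (g (b ij.2)) ij.1) p = 0

/-- Closed ind-subgroups of `𝐆`. -/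
def IsClosedIndSubgroup {b : Basis ι K V} (d : Datum b) (Q : Subgroup (V ≃ₗ[K] V)) : Prop :=
  Q ≤ indGroup d ∧ ∀ I, Admissible d I → IsZariskiClosedAt b I (Q : Set (V ≃ₗ[K] V))

/-- Every algebraic subgroup of `Q` is solvable. -/
def IsLocallySolvable {b : Basis ι K V} (d : Datum b) (Q : Subgroup (V ≃ₗ[K] V)) : Prop :=
  ∀ I, Admissible d I → ∀ M : Subgroup (V ≃ₗ[K] V), M ≤ Q ⊓ levelGroup b I →
    IsZariskiClosedAt b I (M : Set (V ≃ₗ[K] V)) → Group.IsSolvable M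

/-- Each `Qₙ = Q ∩ Gₙ` has no proper closed subgroup of finite index containing `Hₙ = 𝐇 ∩ Gₙ`;
in other words, `Qₙ` is generated by `Hₙ` and its identity component. Since `Hₙ` is connected
for `GL` and `Sp`, this says in these cases that `Qₙ` is connected. For `O`, it
says that `Qₙ ∩ SO` is connected. -/
def IsConnectedModCartan {b : Basis ι K V} (d : Datum b) (Q : Subgroup (V ≃ₗ[K] V)) : Prop :=
  ∀ I, Admissible d I → ∀ M : Subgroup (V ≃ₗ[K] V), M ≤ Q ⊓ levelGroup b I →
    IsZariskiClosedAt b I (M : Set (V ≃ₗ[K] V)) → cartan d ⊓ levelGroup b I ≤ M →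
    M.relIndex (Q ⊓ levelGroup b I) ≠ 0 → M = Q ⊓ levelGroup b I

/-- Splitting Borel subgroups of `𝐆` (containing the fixed Cartan subgroup `𝐇`). -/
def IsSplittingBorel {b : Basis ι K V} (d : Datum b) (B : Subgroup (V ≃ₗ[K] V)) : Prop :=
  Maximal (fun Q => IsClosedIndSubgroup d Q ∧ cartan d ≤ Q ∧ IsConnectedModCartan d Q ∧
    IsLocallySolvable d Q) B

/-- Splitting parabolic subgroups of `𝐆` (containing the fixed Cartan subgroup `𝐇`). -/
def IsSplittingParabolic {b : Basis ι K V} (d : Datum b) (P : Subgroup (V ≃ₗ[K] V)) : Prop :=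
  IsClosedIndSubgroup d P ∧ ∃ B, IsSplittingBorel d B ∧ B ≤ P

/-- The generalized flag `𝓕_σ = {F'_α, F''_α : α ∈ A}` attached to `σ : E → A`, with
`F'_α = ⟨e : σ e < α⟩` and `F''_α = ⟨e : σ e ≤ α⟩`. -/
def genFlag (b : Basis ι K V) {A : Type*} [LinearOrder A] (σ : ι → A) : Set (Submodule K V) :=
  {F | ∃ α, F = Submodule.span K (b '' {e | σ e < α}) ∨
    F = Submodule.span K (b '' {e | σ e ≤ α})}

/-- The surjections `σ : E → A` onto a totally ordered set which define the `E`-compatible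
generalized flags (for `𝐆(E)`), respectively the `E`-compatible `ω`-isotropic generalized
flags (for `𝐆^ω(E)`). -/
def IsFlagMap {b : Basis ι K V} {A : Type*} [LinearOrder A] : Datum b → (ι → A) → Prop
  | .gl, σ => Function.Surjective σ
  | .form _ inv _, σ => Function.Surjective σ ∧
      ∃ iA : A → A, Function.Involutive iA ∧ StrictAnti iA ∧ ∀ e, σ (inv e) = iA (σ e)

/-- `P` is the subgroup of all elements of `𝐆` preserving the generalized flag `𝓕_σ`. -/
def IsFlagStabilizer {b : Basis ι K V} (d : Datum b) (P : Subgroup (V ≃ₗ[K] V))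
    {A : Type*} [LinearOrder A] (σ : ι → A) : Prop :=
  ∀ g : V ≃ₗ[K] V, g ∈ P ↔ g ∈ indGroup d ∧
    (fun F => F.map (g : V →ₗ[K] V)) '' genFlag b σ = genFlag b σ

/-- The permutations moving only finitely many elements. -/
def finitaryPerm (ι : Type w) : Subgroup (Equiv.Perm ι) where
  carrier := {w | {i | w i ≠ i}.Finite}
  one_mem' := by simp
  mul_mem' := by
    intro g h hg hh
    refine (hg.union hh).subset ?_
    intro i hi
    by_contra hcon
    simp only [Set.mem_union, Set.mem_ofPred_eq, not_or, not_not] at hcon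
    apply hi
    rw [Equiv.Perm.mul_apply, hcon.2, hcon.1]
  inv_mem' := by
    intro g hg
    refine hg.subset ?_
    intro i hi hcon
    apply hi
    rw [Equiv.Perm.inv_eq_iff_eq, hcon]

/-- The permutations commuting with a self-map. -/
def commutingPerm (inv : ι → ι) : Subgroup (Equiv.Perm ι) where
  carrier := {w | ∀ i, w (inv i) = inv (w i)}
  one_mem' := fun _ => rfl
  mul_mem' := by
    intro g h hg hh i
    rw [Equiv.Perm.mul_apply, Equiv.Perm.mul_apply, hh, hg]
  inv_mem' := by
    intro g hg i
    have h1 : g (g⁻¹ i) = i := g.apply_symm_apply i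
    rw [Equiv.Perm.inv_eq_iff_eq, hg, h1]

/-- The Weyl group `𝐖`: either `𝐖(E)` or `𝐖^ω(E)`. -/
def weylGroup {b : Basis ι K V} : Datum b → Subgroup (Equiv.Perm ι)
  | .gl => finitaryPerm ι
  | .form _ inv _ => finitaryPerm ι ⊓ commutingPerm inv

/-- The subgroup `𝐖_𝐏` of `𝐖` for `𝐏` the stabilizer of `𝓕_σ`: the `w` with
`σ ∘ w⁻¹ = σ`. -/
def weylStabilizer {b : Basis ι K V} (d : Datum b) {A : Type*} (σ : ι → A) :
    Subgroup (weylGroup d) where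
  carrier := {w | ∀ e, σ ((w : Equiv.Perm ι)⁻¹ e) = σ e}
  one_mem' := fun _ => rfl
  mul_mem' := by
    intro g h hg hh e
    rw [Subgroup.coe_mul, mul_inv_rev, Equiv.Perm.mul_apply, hh, hg]
  inv_mem' := by
    intro g hg e
    have h1 : (g : Equiv.Perm ι)⁻¹ ((g : Equiv.Perm ι) e) = e :=
      Equiv.symm_apply_apply (g : Equiv.Perm ι) e
    rw [Subgroup.coe_inv, inv_inv, ← hg, h1]

/-- `g` is a lift `ŵ` of `w`: an element of `𝐆` with `g e = λ_e w(e)` for nonzero scalars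
`λ_e`. -/
def IsLift {b : Basis ι K V} (d : Datum b) (w : Equiv.Perm ι) (g : V ≃ₗ[K] V) : Prop :=
  g ∈ indGroup d ∧ ∀ e, ∃ c : K, c ≠ 0 ∧ g (b e) = c • b (w e)

end

end ClassicalIndGroup

open ClassicalIndGroup

namespace ClassicalIndGroup

open Module

/-! ### Coordinate subspaces, finite levels and flag groups -/

section Basic

variable {K : Type u} {V : Type v} {ι : Type w} [Field K] [AddCommGroup V] [Module K V]

/-! Everything happens in the coordinates `E`: an element of `𝐆` lies in a finite level, and a
generalized flag `𝓕_σ` is a way of calling matrices upper triangular. Three facts carry the theorem.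

Bruhat elimination (`exists_bruhat`). For two full flags, given by unrelated injective maps `σ` and
`σ'`, Gaussian elimination inside one level turns any `g` into a monomial matrix by multiplying on
the left with elements triangular for `σ` and on the right with elements triangular for `σ'`. For a
form, the row and column operations are Siegel transformations, and two dual columns are cleared at
once. The two orders need no relation to each other, so no conjugacy of `𝐁` into `𝐏` is needed.
Disjointness is a comparison of coordinate subspaces: triangular elements for a full flag have
nonzero diagonal, hence map a coordinate subspace to another one only if the two agree
(`apply_inv_eq_of_mul_eq`).

Borel subgroups are stabilizers of full flags (`IsSplittingBorel.exists_flagMap`). Call `i` linked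
to `j` if some element of `𝐁` has a nonzero `(i, j)` coefficient. A cycle of links through two
indices would give a block on which a finite level of `𝐁` acts irreducibly, even up to finite index.
A Lie-Kolchin argument makes this solvable group scalar on the block, while a regular cocharacter of
`𝐇` has distinct eigenvalues there (`linked_level_antisymm`). So the links generate a partial order;
a linear extension, self-dual in the presence of a form, gives a full flag stabilized by `𝐁`, and
maximality gives equality because the stabilizer of a full flag itself satisfies the Borel
conditions. Connectedness enters only through finite-index subgroups: `Kˣ` is divisible, and so are
the elementary unipotents used here, in characteristic zero; such elements lie in every subgroup of
finite index.

A group `𝐏` containing the stabilizer of a full flag `σ` is a flag stabilizer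
(`exists_eq_flagGroup`). Let `X` be the group of Weyl elements with a lift in `𝐏`. If an element of
`X` reverses a pair `i`, `j`, then `𝐏` contains opposite root elements and hence, by the `SL₂`
product `x y x` (or its analogue for `SO₃`), a lift of the reflection in that pair. Therefore `σ i ≤
σ j` or `s_{ij} ∈ X` is a total preorder; its quotient is `σ₀`. The group `X` consists of the Weyl
elements preserving the classes of this preorder, and Bruhat elimination for `σ` on both sides
transfers this equality from `X` to `𝐏`.

The decomposition then follows by elimination between the flag of `𝐁` and the flag of a Borel
subgroup contained in `𝐏`. -/

theorem mem_coordSpan {b : Basis ι K V} {S : Set ι} {x : V} :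
    x ∈ Submodule.span K (b '' S) ↔ ∀ i, b.repr x i ≠ 0 → i ∈ S := by
  rw [Basis.mem_span_image]
  exact ⟨fun h i hi => h (Finsupp.mem_support_iff.2 hi),
    fun h i hi => h i (Finsupp.mem_support_iff.1 hi)⟩

theorem basis_mem_coordSpan {b : Basis ι K V} {S : Set ι} {i : ι} :
    b i ∈ Submodule.span K (b '' S) ↔ i ∈ S := by
  constructor
  · intro h
    exact mem_coordSpan.1 h i (by simp)
  · exact fun h => Submodule.subset_span ⟨i, h, rfl⟩

theorem coordSpan_le_iff {b : Basis ι K V} {S T : Set ι} :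
    Submodule.span K (b '' S) ≤ Submodule.span K (b '' T) ↔ S ⊆ T :=
  ⟨fun h _ hi => basis_mem_coordSpan.1 (h (basis_mem_coordSpan.2 hi)),
    fun h => Submodule.span_mono (Set.image_mono h)⟩

theorem map_coordSpan_le_iff {b : Basis ι K V} {S : Set ι} {F : Submodule K V} {g : V ≃ₗ[K] V} :
    (Submodule.span K (b '' S)).map (g : V →ₗ[K] V) ≤ F ↔ ∀ j ∈ S, g (b j) ∈ F := by
  rw [Submodule.map_span_le]
  simp

theorem inv_apply_apply (g : V ≃ₗ[K] V) (x : V) : g⁻¹ (g x) = x := g.symm_apply_apply x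

theorem apply_inv_apply (g : V ≃ₗ[K] V) (x : V) : g (g⁻¹ x) = x := g.apply_symm_apply x

/-- A finitary automorphism mapping a coordinate subspace into itself maps it onto itself. -/
theorem map_coordSpan_eq {b : Basis ι K V} {S : Set ι} {g : V ≃ₗ[K] V}
    (hg : g ∈ finitaryGroup b)
    (h : (Submodule.span K (b '' S)).map (g : V →ₗ[K] V) ≤ Submodule.span K (b '' S)) :
    (Submodule.span K (b '' S)).map (g : V →ₗ[K] V) = Submodule.span K (b '' S) := by
  classical
  have hfin : {i | g (b i) ≠ b i}.Finite := hg
  set I := hfin.toFinset with hI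
  have hmemI : ∀ i, i ∈ I ↔ g (b i) ≠ b i := fun i => by simp [hI]
  -- A finite part of `S` that spans a `g`-stable space and contains every vector of `S` moved by
  -- `g`; there injectivity of `g` gives surjectivity.
  set D : Set ι := S ∩ ((I : Set ι) ∪ ⋃ i ∈ I, ((b.repr (g (b i))).support : Set ι)) with hD
  have hDfin : D.Finite := by
    refine Set.Finite.inter_of_right (Set.Finite.union I.finite_toSet ?_) _
    exact Set.Finite.biUnion I.finite_toSet fun i _ => Finset.finite_toSet _
  rw [map_coordSpan_le_iff] at h
  have hstab : (Submodule.span K (b '' D)).map (g : V →ₗ[K] V) ≤ Submodule.span K (b '' D) := by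
    rw [map_coordSpan_le_iff]
    intro j hj
    by_cases hjI : j ∈ I
    · rw [mem_coordSpan]
      intro i hi
      refine ⟨mem_coordSpan.1 (h j hj.1) i hi, Or.inr ?_⟩
      simp only [Set.mem_iUnion]
      exact ⟨j, hjI, Finsupp.mem_support_iff.2 hi⟩
    · rw [hmemI, not_not] at hjI
      rw [hjI]
      exact basis_mem_coordSpan.2 hj
  have : FiniteDimensional K (Submodule.span K (b '' D)) :=
    FiniteDimensional.span_of_finite K (hDfin.image b)
  have heq := Submodule.eq_of_le_of_finrank_eq hstab
    (LinearEquiv.finrank_map_eq g (Submodule.span K (b '' D)))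
  refine le_antisymm (map_coordSpan_le_iff.2 h) (Submodule.span_le.2 ?_)
  rintro _ ⟨j, hj, rfl⟩
  by_cases hjI : j ∈ I
  · have h1 : b j ∈ Submodule.span K (b '' D) := basis_mem_coordSpan.2 ⟨hj, Or.inl hjI⟩
    rw [← heq] at h1
    exact Submodule.map_mono (coordSpan_le_iff.2 Set.inter_subset_left) h1
  · rw [hmemI, not_not] at hjI
    exact ⟨b j, basis_mem_coordSpan.2 hj, hjI⟩

theorem inv_apply_mem_coordSpan {b : Basis ι K V} {S : Set ι} {g : V ≃ₗ[K] V}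
    (hg : g ∈ finitaryGroup b) (h : ∀ j ∈ S, g (b j) ∈ Submodule.span K (b '' S)) {x : V}
    (hx : x ∈ Submodule.span K (b '' S)) : g⁻¹ x ∈ Submodule.span K (b '' S) := by
  have h1 := map_coordSpan_eq hg (map_coordSpan_le_iff.2 h)
  rw [← h1] at hx
  obtain ⟨y, hy, rfl⟩ := hx
  change g⁻¹ (g y) ∈ _
  rwa [inv_apply_apply]

theorem indGroup_le_finitaryGroup {b : Basis ι K V} (d : Datum b) :
    indGroup d ≤ finitaryGroup b := by
  cases d with
  | gl => exact le_rfl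
  | form ω inv h => exact inf_le_left

theorem levelGroup_le_finitaryGroup (b : Basis ι K V) (I : Finset ι) :
    levelGroup b I ≤ finitaryGroup b := fun g hg =>
  I.finite_toSet.subset fun i hi => by
    by_contra hn
    exact hi (hg.1 i (by simpa using hn))

theorem mem_levelGroup_iff {b : Basis ι K V} {I : Finset ι} {g : V ≃ₗ[K] V} :
    g ∈ levelGroup b I ↔ (∀ i, i ∉ I → g (b i) = b i) ∧
      ∀ i ∈ I, g (b i) ∈ Submodule.span K (b '' (I : Set ι)) := by
  constructor
  · intro h
    exact ⟨h.1, fun i hi => (h.2 _).2 (basis_mem_coordSpan.2 hi)⟩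
  · rintro ⟨h1, h2⟩
    have hfin : g ∈ finitaryGroup b := I.finite_toSet.subset fun i hi => by
      by_contra hn
      exact hi (h1 i (by simpa using hn))
    refine ⟨h1, fun x => ⟨fun hx => ?_, fun hx => ?_⟩⟩
    · have := inv_apply_mem_coordSpan hfin (S := (I : Set ι)) (fun j hj => h2 j hj) hx
      rwa [inv_apply_apply] at this
    · exact map_coordSpan_le_iff.2 (fun j hj => h2 j hj) ⟨x, hx, rfl⟩

theorem exists_levelGroup {b : Basis ι K V} {g : V ≃ₗ[K] V} (hg : g ∈ finitaryGroup b) :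
    ∃ F : Finset ι, ∀ I : Finset ι, F ⊆ I → g ∈ levelGroup b I := by
  classical
  have hfin : {i | g (b i) ≠ b i}.Finite := hg
  refine ⟨hfin.toFinset ∪ hfin.toFinset.biUnion fun i => (b.repr (g (b i))).support,
    fun I hI => mem_levelGroup_iff.2 ⟨fun i hi => ?_, fun i hi => ?_⟩⟩
  · by_contra hn
    exact hi (hI (Finset.mem_union_left _ (by simpa using hn)))
  · by_cases hn : g (b i) = b i
    · rw [hn]
      exact basis_mem_coordSpan.2 hi
    · rw [mem_coordSpan]
      intro k hk
      refine hI (Finset.mem_union_right _ (Finset.mem_biUnion.2 ⟨i, by simpa using hn, ?_⟩))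
      exact Finsupp.mem_support_iff.2 hk

theorem exists_admissible_superset {b : Basis ι K V} (d : Datum b) (F : Finset ι) :
    ∃ I, Admissible d I ∧ F ⊆ I := by
  classical
  cases d with
  | gl => exact ⟨F, trivial, le_rfl⟩
  | form ω inv h =>
    have hfix : {i | inv i = i}.Finite :=
      Set.Subsingleton.finite fun i hi j hj => h.fixed_unique i j hi hj
    refine ⟨F ∪ F.image inv ∪ hfix.toFinset, ⟨?_, ?_⟩, ?_⟩
    · intro i hi
      simp only [Finset.mem_union, Finset.mem_image, Set.Finite.mem_toFinset,
        Set.mem_ofPred_eq] at hi ⊢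
      rcases hi with (hi | ⟨j, hj, rfl⟩) | hi
      · exact Or.inl (Or.inr ⟨i, hi, rfl⟩)
      · rw [h.involutive j]
        exact Or.inl (Or.inl hj)
      · rw [hi]
        exact Or.inr hi
    · intro i hi
      exact Finset.mem_union_right _ (by simpa using hi)
    · intro i hi
      exact Finset.mem_union_left _ (Finset.mem_union_left _ hi)

theorem exists_admissible_levelGroup {b : Basis ι K V} (d : Datum b) (F : Finset ι)
    {g : V ≃ₗ[K] V} (hg : g ∈ indGroup d) :
    ∃ I, Admissible d I ∧ F ⊆ I ∧ g ∈ levelGroup b I := by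
  classical
  obtain ⟨F', hF'⟩ := exists_levelGroup (indGroup_le_finitaryGroup d hg)
  obtain ⟨I, hI, hFI⟩ := exists_admissible_superset d (F ∪ F')
  exact ⟨I, hI, Finset.union_subset_left hFI, hF' I (Finset.union_subset_right hFI)⟩

/-- The subgroup of `𝐆` of all elements which are block upper triangular with respect to `σ`. -/
def flagGroup {b : Basis ι K V} (d : Datum b) {A : Type*} [LinearOrder A] (σ : ι → A) :
    Subgroup (V ≃ₗ[K] V) where
  carrier := {g | g ∈ indGroup d ∧ ∀ j, g (b j) ∈ Submodule.span K (b '' {i | σ i ≤ σ j})}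
  one_mem' := ⟨one_mem _, fun j => basis_mem_coordSpan.2 le_rfl⟩
  mul_mem' := by
    rintro g h ⟨hg, hg'⟩ ⟨hh, hh'⟩
    refine ⟨mul_mem hg hh, fun j => ?_⟩
    have : (Submodule.span K (b '' {i | σ i ≤ σ j})).map (g : V →ₗ[K] V) ≤
        Submodule.span K (b '' {i | σ i ≤ σ j}) :=
      map_coordSpan_le_iff.2 fun k (hk : σ k ≤ σ j) =>
        coordSpan_le_iff.2 (fun i (hi : σ i ≤ σ k) => hi.trans hk) (hg' k)
    exact this ⟨_, hh' j, rfl⟩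
  inv_mem' := by
    rintro g ⟨hg, hg'⟩
    refine ⟨inv_mem hg, fun j => ?_⟩
    exact inv_apply_mem_coordSpan (indGroup_le_finitaryGroup d hg)
      (fun k (hk : σ k ≤ σ j) => coordSpan_le_iff.2 (fun i (hi : σ i ≤ σ k) => hi.trans hk) (hg' k))
      (basis_mem_coordSpan.2 le_rfl)

theorem mem_flagGroup {b : Basis ι K V} {d : Datum b} {A : Type*} [LinearOrder A] {σ : ι → A}
    {g : V ≃ₗ[K] V} : g ∈ flagGroup d σ ↔
      g ∈ indGroup d ∧ ∀ j, g (b j) ∈ Submodule.span K (b '' {i | σ i ≤ σ j}) := Iff.rfl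

theorem flagGroup_le_indGroup {b : Basis ι K V} (d : Datum b) {A : Type*} [LinearOrder A]
    (σ : ι → A) : flagGroup d σ ≤ indGroup d := fun _ h => h.1

/-- Elements of the flag group preserve all spans of `σ`-lower sets. -/
theorem map_eq_of_mem_flagGroup {b : Basis ι K V} {d : Datum b} {A : Type*} [LinearOrder A]
    {σ : ι → A} {g : V ≃ₗ[K] V} (hg : g ∈ flagGroup d σ) {S : Set ι}
    (hS : ∀ j ∈ S, ∀ i, σ i ≤ σ j → i ∈ S) :
    (Submodule.span K (b '' S)).map (g : V →ₗ[K] V) = Submodule.span K (b '' S) :=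
  map_coordSpan_eq (indGroup_le_finitaryGroup d hg.1) <| map_coordSpan_le_iff.2 fun j hj =>
    coordSpan_le_iff.2 (fun i hi => hS j hj i hi) (hg.2 j)

/-- Members of the flag are spans of `σ`-lower sets, hence form a chain, so `F` and `g F` are
comparable. A finitary automorphism cannot carry a coordinate subspace properly into or over itself,
so permuting the flag already means fixing each member. -/
theorem map_eq_of_image_genFlag {b : Basis ι K V} {A : Type*} [LinearOrder A] {σ : ι → A}
    {g : V ≃ₗ[K] V} (hg : g ∈ finitaryGroup b)
    (h : (fun F => F.map (g : V →ₗ[K] V)) '' genFlag b σ = genFlag b σ) {F : Submodule K V}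
    (hF : F ∈ genFlag b σ) : F.map (g : V →ₗ[K] V) = F := by
  have hlower : ∀ F ∈ genFlag b σ, ∃ S : Set ι, (∀ j ∈ S, ∀ i, σ i ≤ σ j → i ∈ S) ∧
      F = Submodule.span K (b '' S) := by
    rintro F ⟨α, rfl | rfl⟩
    · exact ⟨_, fun j (hj : σ j < α) i hi => lt_of_le_of_lt hi hj, rfl⟩
    · exact ⟨_, fun j (hj : σ j ≤ α) i hi => le_trans hi hj, rfl⟩
  have hgF : F.map (g : V →ₗ[K] V) ∈ genFlag b σ := h ▸ ⟨F, hF, rfl⟩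
  obtain ⟨S, hS, rfl⟩ := hlower F hF
  obtain ⟨T, hT, hgT⟩ := hlower _ hgF
  have hcomp : S ⊆ T ∨ T ⊆ S := by
    by_contra! hn
    obtain ⟨⟨x, hxS, hxT⟩, y, hyT, hyS⟩ := And.intro (Set.not_subset.1 hn.1) (Set.not_subset.1 hn.2)
    rcases le_total (σ x) (σ y) with hxy | hxy
    · exact hxT (hT y hyT x hxy)
    · exact hyS (hS x hxS y hxy)
  rcases hcomp with hST | hTS
  · have h1 : (Submodule.span K (b '' S)).map ((g⁻¹ : V ≃ₗ[K] V) : V →ₗ[K] V) ≤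
        Submodule.span K (b '' S) := by
      rw [map_coordSpan_le_iff]
      intro j hj
      have : b j ∈ Submodule.map (g : V →ₗ[K] V) (Submodule.span K (b '' S)) := by
        rw [hgT]
        exact basis_mem_coordSpan.2 (hST hj)
      obtain ⟨y, hy, hyj⟩ := this
      rw [← hyj]
      change g⁻¹ (g y) ∈ _
      rwa [inv_apply_apply]
    have h2 := map_coordSpan_eq (inv_mem hg) h1
    conv_lhs => rw [← h2]
    ext x
    constructor
    · rintro ⟨_, ⟨y, hy, rfl⟩, rfl⟩
      change g (g⁻¹ y) ∈ _
      rwa [apply_inv_apply]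
    · intro hx
      exact ⟨_, ⟨x, hx, rfl⟩, apply_inv_apply g x⟩
  · exact map_coordSpan_eq hg (hgT ▸ coordSpan_le_iff.2 hTS)

/-- Replaces the setwise stabilizer by block triangularity, the form used everywhere below. -/
theorem isFlagStabilizer_iff {b : Basis ι K V} {d : Datum b} {P : Subgroup (V ≃ₗ[K] V)}
    {A : Type*} [LinearOrder A] {σ : ι → A} :
    IsFlagStabilizer d P σ ↔ P = flagGroup d σ := by
  have key : ∀ g : V ≃ₗ[K] V, g ∈ flagGroup d σ ↔ g ∈ indGroup d ∧
      (fun F => F.map (g : V →ₗ[K] V)) '' genFlag b σ = genFlag b σ := by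
    intro g
    constructor
    · intro hg
      refine ⟨hg.1, ?_⟩
      have : ∀ F ∈ genFlag b σ, F.map (g : V →ₗ[K] V) = F := by
        rintro F ⟨α, rfl | rfl⟩
        · exact map_eq_of_mem_flagGroup hg fun j (hj : σ j < α) i hi => lt_of_le_of_lt hi hj
        · exact map_eq_of_mem_flagGroup hg fun j (hj : σ j ≤ α) i hi => le_trans hi hj
      rw [Set.image_congr this, Set.image_id']
    · rintro ⟨hg, him⟩
      refine ⟨hg, fun j => ?_⟩
      rw [← map_eq_of_image_genFlag (indGroup_le_finitaryGroup d hg) him ⟨σ j, Or.inr rfl⟩]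
      exact ⟨b j, basis_mem_coordSpan.2 le_rfl, rfl⟩
  constructor
  · intro h
    ext g
    rw [h g, key g]
  · rintro rfl g
    exact key g

end Basic

/-! ### Isotropic bases and their forms -/

section Form

variable {K : Type u} {V : Type v} {ι : Type w} [Field K] [AddCommGroup V] [Module K V]
  {b : Basis ι K V} {ω : LinearMap.BilinForm K V} {inv : ι → ι}

namespace IsIsotropicBasis

theorem form_basis_eq_zero (h : IsIsotropicBasis b ω inv) {i j : ι} (hij : i ≠ inv j) :
    ω (b i) (b j) = 0 :=
  h.isotropic i j fun hj => hij (by rw [hj, h.involutive i])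

theorem form_apply_basis (h : IsIsotropicBasis b ω inv) (x : V) (i : ι) :
    ω x (b i) = b.repr x (inv i) * ω (b (inv i)) (b i) := by
  conv_lhs => rw [← b.linearCombination_repr x, Finsupp.linearCombination_apply, Finsupp.sum]
  simp only [map_sum, map_smul, LinearMap.sum_apply, LinearMap.smul_apply, smul_eq_mul]
  rw [Finset.sum_eq_single (inv i)]
  · intro j _ hj
    rw [h.form_basis_eq_zero hj, mul_zero]
  · intro hi
    rw [Finsupp.notMem_support_iff.1 hi, zero_mul]

theorem form_inv_ne_zero (h : IsIsotropicBasis b ω inv) (i : ι) : ω (b (inv i)) (b i) ≠ 0 := by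
  intro h0
  refine b.ne_zero i (h.nondegenerate.2 (b i) fun x => ?_)
  rw [h.form_apply_basis, h0, mul_zero]

theorem form_ne_zero (h : IsIsotropicBasis b ω inv) (i : ι) : ω (b i) (b (inv i)) ≠ 0 := by
  have := h.form_inv_ne_zero (inv i)
  rwa [h.involutive i] at this

/-- The sign `ε` lets the symplectic and orthogonal cases share one computation. -/
theorem exists_sign (h : IsIsotropicBasis b ω inv) :
    ∃ ε : K, (ε = 1 ∨ ε = -1) ∧ ∀ x y, ω x y = ε * ω y x := by
  rcases h.form_type with ha | ⟨hs, -⟩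
  · refine ⟨-1, Or.inr rfl, fun x y => ?_⟩
    rw [neg_one_mul, LinearMap.IsAlt.neg ha]
  · refine ⟨1, Or.inl rfl, fun x y => ?_⟩
    rw [one_mul]
    exact hs.eq x y

theorem form_eq_zero_comm (h : IsIsotropicBasis b ω inv) {x y : V} :
    ω x y = 0 ↔ ω y x = 0 := by
  obtain ⟨ε, hε, hs⟩ := h.exists_sign
  have : ε ≠ 0 := by rcases hε with rfl | rfl <;> simp
  rw [hs x y, mul_eq_zero, or_iff_right this]

theorem repr_eq_zero_iff (h : IsIsotropicBasis b ω inv) {x : V} {i : ι} :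
    b.repr x (inv i) = 0 ↔ ω x (b i) = 0 := by
  rw [h.form_apply_basis, mul_eq_zero, or_iff_left (h.form_inv_ne_zero i)]

theorem form_basis_self (h : IsIsotropicBasis b ω inv) {i : ι} (hi : inv i ≠ i) :
    ω (b i) (b i) = 0 := h.form_basis_eq_zero hi.symm

theorem mem_isometryGroup {b : Basis ι K V} {g : V ≃ₗ[K] V}
    (hg : ∀ i j, ω (g (b i)) (g (b j)) = ω (b i) (b j)) : g ∈ isometryGroup ω := by
  have : ω.compl₁₂ (g : V →ₗ[K] V) (g : V →ₗ[K] V) = ω :=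
    LinearMap.ext_basis b b fun i j => by simpa using hg i j
  intro x y
  conv_rhs => rw [← this]
  rfl

theorem inv_injective (h : IsIsotropicBasis b ω inv) : Function.Injective inv :=
  h.involutive.injective

end IsIsotropicBasis

end Form

/-! ### Monomial automorphisms and lifts of Weyl group elements -/

section Lift

variable {K : Type u} {V : Type v} {ι : Type w} [Field K] [AddCommGroup V] [Module K V]
  {b : Basis ι K V}

/-- The automorphism `e ↦ c_e w(e)`. -/
noncomputable def monomialEquiv (b : Basis ι K V) (w : Equiv.Perm ι) (c : ι → Kˣ) : V ≃ₗ[K] V :=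
  b.equiv ((b.reindex w.symm).unitsSMul c) (Equiv.refl ι)

theorem monomialEquiv_apply (w : Equiv.Perm ι) (c : ι → Kˣ) (i : ι) :
    monomialEquiv b w c (b i) = (c i : K) • b (w i) := by
  simp [monomialEquiv, Basis.unitsSMul_apply, Units.smul_def]

theorem monomialEquiv_mem_finitaryGroup {w : Equiv.Perm ι} {c : ι → Kˣ}
    (hw : w ∈ finitaryPerm ι) (hc : ∀ i, w i = i → c i = 1) :
    monomialEquiv b w c ∈ finitaryGroup b := by
  refine Set.Finite.subset hw fun i hi hwi => hi ?_
  rw [monomialEquiv_apply, hwi, hc i hwi, Units.val_one, one_smul]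

theorem exists_isLift [IsAlgClosed K] (d : Datum b) (w : weylGroup d) :
    ∃ g, IsLift d (w : Equiv.Perm ι) g := by
  obtain ⟨w, hw⟩ := w
  cases d with
  | gl =>
    refine ⟨monomialEquiv b w 1, monomialEquiv_mem_finitaryGroup hw fun _ _ => rfl, fun e => ?_⟩
    exact ⟨1, one_ne_zero, by simp [monomialEquiv_apply]⟩
  | form ω inv h =>
    obtain ⟨hw1, hw2⟩ := hw
    -- The square root of `1` is taken to be `1`, so that the lift fixes the basis vectors not moved
    -- by `w`, except finitely many.
    have hsq : ∀ x : Kˣ, ∃ y : Kˣ, y * y = x ∧ (x = 1 → y = 1) := by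
      intro x
      by_cases hx : x = 1
      · exact ⟨1, by simp [hx], fun _ => rfl⟩
      · obtain ⟨z, hz⟩ := IsAlgClosed.exists_pow_nat_eq (x : K) (n := 2) (by norm_num)
        have hz0 : z ≠ 0 := by
          rintro rfl
          exact x.ne_zero (by rw [← hz]; simp)
        refine ⟨Units.mk0 z hz0, ?_, fun h => absurd h hx⟩
        ext
        simp [← hz, sq]
    choose s hs hs1 using hsq
    -- The scalars at `i` and `inv i` must multiply to this ratio. It takes the same value at both
    -- indices, as the sign `ε` cancels, so a square root of it serves at each.
    let r : ι → Kˣ := fun i => Units.mk0 _ (h.form_ne_zero i) / Units.mk0 _ (h.form_ne_zero (w i))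
    have hr : ∀ i, r (inv i) = r i := by
      intro i
      obtain ⟨ε, hε, hsgn⟩ := h.exists_sign
      have hε0 : ε ≠ 0 := by rcases hε with rfl | rfl <;> simp
      ext
      simp only [r, Units.val_div_eq_div_val, Units.val_mk0]
      rw [hw2 i, h.involutive, h.involutive, hsgn (b (inv i)), hsgn (b (inv (w i)))]
      exact mul_div_mul_left _ _ hε0
    refine ⟨monomialEquiv b w fun i => s (r i), ⟨monomialEquiv_mem_finitaryGroup hw1 ?_, ?_⟩, ?_⟩
    · intro i hi
      refine hs1 _ ?_
      simp [r, hi]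
    · refine IsIsotropicBasis.mem_isometryGroup (b := b) fun i j => ?_
      rw [monomialEquiv_apply, monomialEquiv_apply]
      simp only [map_smul, LinearMap.smul_apply, smul_eq_mul]
      by_cases hij : j = inv i
      · subst hij
        rw [hr, hw2 i]
        have := congrArg Units.val (hs (r i))
        rw [← mul_assoc, ← Units.val_mul, this]
        simp only [r, Units.val_div_eq_div_val, Units.val_mk0]
        exact div_mul_cancel₀ _ (h.form_ne_zero _)
      · rw [h.isotropic i j hij, h.isotropic (w i) (w j), mul_zero, mul_zero]
        intro hji
        rw [← hw2 i] at hji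
        exact hij (w.injective hji)
    · exact fun e => ⟨_, Units.ne_zero _, monomialEquiv_apply w _ e⟩

/-- By injectivity the finite set of moved points is mapped into itself, hence onto itself. -/
theorem bijective_of_injective_of_finite {f : ι → ι} (hf : Function.Injective f)
    (hfin : {i | f i ≠ i}.Finite) : Function.Bijective f := by
  refine ⟨hf, fun y => ?_⟩
  by_cases hy : f y = y
  · exact ⟨y, hy⟩
  · have hmaps : Set.MapsTo f {i | f i ≠ i} {i | f i ≠ i} := fun i hi h => hi (hf h)
    have := hfin.to_subtype
    obtain ⟨x, hx⟩ := Finite.surjective_of_injective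
      ((Set.MapsTo.restrict_inj hmaps).2 hf.injOn) ⟨y, hy⟩
    exact ⟨x, congrArg Subtype.val hx⟩

/-- A monomial element of `𝐆` is a lift of an element of the Weyl group. -/
theorem exists_weyl_of_monomial {d : Datum b} {g : V ≃ₗ[K] V} (hg : g ∈ indGroup d)
    (hmon : ∀ e, ∃ k, ∃ c : K, g (b e) = c • b k) :
    ∃ w : weylGroup d, IsLift d (w : Equiv.Perm ι) g := by
  choose f c hfc using hmon
  have hc : ∀ e, c e ≠ 0 := by
    intro e h0
    have := hfc e
    rw [h0, zero_smul] at this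
    exact b.ne_zero e (g.map_eq_zero_iff.1 this)
  have hinj : Function.Injective f := by
    intro e e' hee
    have h1 : g (c e' • b e) = g (c e • b e') := by
      rw [map_smul, map_smul, hfc, hfc, hee, smul_comm]
    have h2 := congrArg (fun x => b.repr x e) (g.injective h1)
    by_contra hne
    simp [Ne.symm hne, hc] at h2
  have hfix : ∀ e, g (b e) = b e → f e = e := by
    intro e he
    have h2 := congrArg (fun x => b.repr x (f e)) (he.symm.trans (hfc e))
    by_contra hne
    simp [Ne.symm hne] at h2
    exact hc e h2.symm
  have hfin : {i | f i ≠ i}.Finite :=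
    Set.Finite.subset (indGroup_le_finitaryGroup d hg) fun e he h => he (hfix e h)
  let w : Equiv.Perm ι := Equiv.ofBijective f (bijective_of_injective_of_finite hinj hfin)
  have hw : w ∈ weylGroup d := by
    cases d with
    | gl => exact hfin
    | form ω inv h =>
      refine ⟨hfin, fun i => ?_⟩
      change f (inv i) = inv (f i)
      by_contra hne
      have h1 := hg.2 (b i) (b (inv i))
      rw [hfc, hfc] at h1
      simp only [map_smul, LinearMap.smul_apply, h.isotropic _ _ hne, smul_zero] at h1
      exact h.form_ne_zero i h1.symm
  exact ⟨⟨w, hw⟩, hg, fun e => ⟨c e, hc e, hfc e⟩⟩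

end Lift

/-! ### Divisible unipotents: shears and Siegel transformations -/

section Elementary

variable {K : Type u} {V : Type v} {ι : Type w} [Field K] [AddCommGroup V] [Module K V]
  {b : Basis ι K V}

/-- The elements of a subgroup which have roots of all orders in it. -/
def divisibleElements {G : Type*} [Group G] (H : Subgroup G) : Set G :=
  {u | u ∈ H ∧ ∀ m : ℕ, 0 < m → ∃ x ∈ H, x ^ m = u}

/-- `x ↦ x + x_i w` for a vector `w` with `w_i = 0`. -/
noncomputable def shear (b : Basis ι K V) (i : ι) (w : V) (hw : b.repr w i = 0) : V ≃ₗ[K] V :=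
  LinearEquiv.ofLinearMap (LinearMap.id + (b.coord i).smulRight w)
    (LinearMap.id - (b.coord i).smulRight w)
    (by ext x; simp [hw]) (by ext x; simp [hw])

theorem shear_apply (i : ι) (w : V) (hw : b.repr w i = 0) (x : V) :
    shear b i w hw x = x + b.repr x i • w := rfl

theorem shear_pow_apply (i : ι) (w : V) (hw : b.repr w i = 0) (m : ℕ) (x : V) :
    (shear b i w hw ^ m) x = x + ((m : K) * b.repr x i) • w := by
  induction m with
  | zero => simp
  | succ m ih =>
    rw [pow_succ', LinearEquiv.mul_apply, ih, shear_apply]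
    simp only [map_add, map_smul, Finsupp.add_apply, Finsupp.smul_apply, hw, smul_eq_mul, mul_zero,
      add_zero, add_assoc, ← add_smul]
    push_cast
    ring_nf

theorem shear_mem {A : Type*} [LinearOrder A] {σ : ι → A} {I : Finset ι} {i : ι} (hi : i ∈ I)
    {w : V} (hw : b.repr w i = 0)
    (hwm : w ∈ Submodule.span K (b '' {k | k ∈ I ∧ σ k ≤ σ i})) :
    shear b i w hw ∈ flagGroup (Datum.gl : Datum b) σ ⊓ levelGroup b I := by
  have hfix : ∀ k, k ≠ i → shear b i w hw (b k) = b k := by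
    intro k hk
    rw [shear_apply]
    simp [hk]
  have hself : shear b i w hw (b i) = b i + w := by
    rw [shear_apply]
    simp
  have hlev : shear b i w hw ∈ levelGroup b I := by
    refine mem_levelGroup_iff.2 ⟨fun k hk => hfix k fun h => hk (h ▸ hi), fun k hk => ?_⟩
    by_cases hki : k = i
    · subst hki
      rw [hself]
      exact add_mem (basis_mem_coordSpan.2 hk) (coordSpan_le_iff.2 (fun l hl => hl.1) hwm)
    · rw [hfix k hki]
      exact basis_mem_coordSpan.2 hk
  refine ⟨⟨levelGroup_le_finitaryGroup b I hlev, fun k => ?_⟩, hlev⟩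
  by_cases hki : k = i
  · subst hki
    rw [hself]
    exact add_mem (basis_mem_coordSpan.2 le_rfl) (coordSpan_le_iff.2 (fun l hl => hl.2) hwm)
  · rw [hfix k hki]
    exact basis_mem_coordSpan.2 le_rfl

/-- The shear along `v - e_i` works, and its `m`-th root is the shear along `(v - e_i) / m`. -/
theorem exists_divisible_apply_eq_gl [CharZero K] {A : Type*} [LinearOrder A] {σ : ι → A}
    {I : Finset ι} {i : ι} (hi : i ∈ I) {v : V} (hvi : b.repr v i = 1)
    (hv : ∀ k, b.repr v k ≠ 0 → k ∈ I ∧ σ k ≤ σ i) :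
    ∃ u ∈ divisibleElements (flagGroup (Datum.gl : Datum b) σ ⊓ levelGroup b I),
      u (b i) = v ∧ ∀ k, k ≠ i → u (b k) = b k := by
  have hvm : v ∈ Submodule.span K (b '' {k | k ∈ I ∧ σ k ≤ σ i}) := mem_coordSpan.2 hv
  have hwm : v - b i ∈ Submodule.span K (b '' {k | k ∈ I ∧ σ k ≤ σ i}) :=
    sub_mem hvm (basis_mem_coordSpan.2 ⟨hi, le_rfl⟩)
  have hw : b.repr (v - b i) i = 0 := by simp [hvi]
  refine ⟨shear b i (v - b i) hw, ⟨shear_mem hi hw hwm, fun m hm => ?_⟩, ?_, fun k hk => ?_⟩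
  · have hw1 : b.repr ((m : K)⁻¹ • (v - b i)) i = 0 := by
      rw [map_smul, Finsupp.smul_apply, hw, smul_zero]
    refine ⟨shear b i _ hw1, shear_mem hi hw1 (Submodule.smul_mem _ _ hwm), ?_⟩
    ext x
    rw [shear_pow_apply, shear_apply, smul_smul, mul_right_comm,
      mul_inv_cancel₀ (Nat.cast_ne_zero.2 hm.ne'), one_mul]
  · rw [shear_apply]
    simp
  · rw [shear_apply]
    simp [hk]

/-- `x ↦ x + ω(x, e)(w + a e) - ε ω(x, w) e`. -/
noncomputable def siegelMap (ω : LinearMap.BilinForm K V) (ε : K) (e w : V) (a : K) : V →ₗ[K] V :=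
  LinearMap.id + (ω.flip e).smulRight (w + a • e) - ε • (ω.flip w).smulRight e

theorem siegelMap_apply (ω : LinearMap.BilinForm K V) (ε : K) (e w : V) (a : K) (x : V) :
    siegelMap ω ε e w a x = x + ω x e • (w + a • e) - ε • ω x w • e := rfl

/-- The parameters `(w, a)` compose as in a Heisenberg group: `w` adds, while `a` picks up the
cocycle `-ε ω(w', w)`. This yields inverses, powers and roots. -/
theorem siegelMap_comp {ω : LinearMap.BilinForm K V} {ε : K} {e w w' : V} (a a' : K)
    (he : ω e e = 0) (hwe' : ω w' e = 0) (hew : ω e w = 0) (x : V) :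
    siegelMap ω ε e w a (siegelMap ω ε e w' a' x) =
      siegelMap ω ε e (w + w') (a + a' - ε * ω w' w) x := by
  simp only [siegelMap_apply, map_add, map_sub, map_smul, he, hwe', hew]
  module

/-- The condition `ha` reads `a = -ω(w, w) / 2` for `ε = 1`; for `ε = -1` it only says `ω(w, w) = 0`
and leaves `a` free. -/
theorem siegelMap_isometry {ω : LinearMap.BilinForm K V} {ε : K} {e w : V} {a : K}
    (hε : ε = 1 ∨ ε = -1) (hω : ∀ x y, ω x y = ε * ω y x)
    (he : ω e e = 0) (hwe : ω w e = 0) (hew : ω e w = 0) (ha : (1 + ε) * a + ω w w = 0) (x y : V) :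
    ω (siegelMap ω ε e w a x) (siegelMap ω ε e w a y) = ω x y := by
  simp only [siegelMap_apply, map_add, map_sub, map_smul, LinearMap.add_apply, LinearMap.sub_apply,
    LinearMap.smul_apply, he, hwe, hew, smul_eq_mul, mul_zero, add_zero, sub_zero]
  rw [hω w y, hω e y]
  have h2 : ω w w = -((1 + ε) * a) := by linear_combination ha
  rw [h2]
  rcases hε with rfl | rfl <;> ring

/-- The automorphism given by `siegelMap`. -/
noncomputable def siegel (ω : LinearMap.BilinForm K V) (ε : K) (e w : V) (a : K)
    (he : ω e e = 0) (hwe : ω w e = 0) (hew : ω e w = 0) : V ≃ₗ[K] V :=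
  LinearEquiv.ofLinearMap (siegelMap ω ε e w a) (siegelMap ω ε e (-w) (-a - ε * ω w w))
    (by
      ext x
      rw [LinearMap.comp_apply, siegelMap_comp _ _ he (by simp [hwe]) hew]
      simp only [siegelMap_apply, LinearMap.id_apply, LinearMap.neg_apply, map_neg, add_neg_cancel,
        map_zero]
      module)
    (by
      ext x
      rw [LinearMap.comp_apply, siegelMap_comp _ _ he hwe (by simp [hew])]
      simp only [siegelMap_apply, LinearMap.id_apply, map_neg, neg_add_cancel, map_zero]
      module)

theorem siegel_apply {ω : LinearMap.BilinForm K V} {ε : K} {e w : V} {a : K}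
    (he : ω e e = 0) (hwe : ω w e = 0) (hew : ω e w = 0) (x : V) :
    siegel ω ε e w a he hwe hew x = siegelMap ω ε e w a x := rfl

theorem siegel_pow_apply [CharZero K] {ω : LinearMap.BilinForm K V} {ε : K} {e w : V} {a : K}
    (he : ω e e = 0) (hwe : ω w e = 0) (hew : ω e w = 0) (m : ℕ) (x : V) :
    (siegel ω ε e w a he hwe hew ^ m) x =
      siegelMap ω ε e ((m : K) • w) (m * a - ε * (m * (m - 1) / 2) * ω w w) x := by
  induction m with
  | zero => simp [siegelMap_apply]
  | succ m ih =>
    rw [pow_succ', LinearEquiv.mul_apply, ih, siegel_apply, siegelMap_comp _ _ he _ hew]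
    · congr 1
      · push_cast
        congr 1
        · module
        · simp only [map_smul, LinearMap.smul_apply, smul_eq_mul]
          ring
    · simp [hwe]

/-- Besides `e_i`, the transformation changes an `e_k` only by a multiple of `e_{inv i}`, and only
if `inv k` lies in the support of `w`. Then `σ (inv k) ≤ σ i`, and reversing by `hσ` gives `σ (inv
i) ≤ σ k`, which is triangularity. -/
theorem siegel_mem {ω : LinearMap.BilinForm K V} {inv : ι → ι} (h : IsIsotropicBasis b ω inv)
    {ε : K} (hε : ε = 1 ∨ ε = -1) (hω : ∀ x y, ω x y = ε * ω y x)
    {A : Type*} [LinearOrder A] {σ : ι → A} (hσ : ∀ k l, σ k ≤ σ l → σ (inv l) ≤ σ (inv k))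
    {I : Finset ι} (hI : ∀ k ∈ I, inv k ∈ I) {i : ι} (hi : i ∈ I) {w : V} {a : K}
    (he : ω (b (inv i)) (b (inv i)) = 0) (hwe : ω w (b (inv i)) = 0) (hew : ω (b (inv i)) w = 0)
    (ha : (1 + ε) * a + ω w w = 0)
    (hwm : w ∈ Submodule.span K (b '' {k | k ∈ I ∧ σ k ≤ σ i}))
    (ham : a • b (inv i) ∈ Submodule.span K (b '' {k | k ∈ I ∧ σ k ≤ σ i})) :
    siegel ω ε (b (inv i)) w a he hwe hew ∈
      flagGroup (Datum.form ω inv h) σ ⊓ levelGroup b I := by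
  have hform : ∀ k, ω (b k) w ≠ 0 → inv k ∈ I ∧ σ (inv k) ≤ σ i := by
    intro k hk
    refine mem_coordSpan.1 hwm (inv k) fun h0 => hk ?_
    exact h.form_eq_zero_comm.1 (h.repr_eq_zero_iff.1 h0)
  have hfix : ∀ k, k ≠ i → siegel ω ε (b (inv i)) w a he hwe hew (b k) =
      b k - ε • ω (b k) w • b (inv i) := by
    intro k hk
    rw [siegel_apply, siegelMap_apply, h.isotropic k (inv i) fun hki => hk (h.inv_injective hki).symm]
    simp
  have hself : siegel ω ε (b (inv i)) w a he hwe hew (b i) =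
      b i + ω (b i) (b (inv i)) • (w + a • b (inv i)) - ε • ω (b i) w • b (inv i) := rfl
  have hself_mem : siegel ω ε (b (inv i)) w a he hwe hew (b i) ∈
      Submodule.span K (b '' {k | k ∈ I ∧ σ k ≤ σ i}) := by
    rw [hself]
    refine sub_mem (add_mem (basis_mem_coordSpan.2 ⟨hi, le_rfl⟩)
      (Submodule.smul_mem _ _ (add_mem hwm ham))) (Submodule.smul_mem _ _ ?_)
    by_cases h0 : ω (b i) w = 0
    · rw [h0, zero_smul]
      exact zero_mem _
    · exact Submodule.smul_mem _ _ (basis_mem_coordSpan.2 (hform i h0))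
  have hlev : siegel ω ε (b (inv i)) w a he hwe hew ∈ levelGroup b I := by
    refine mem_levelGroup_iff.2 ⟨fun k hk => ?_, fun k hk => ?_⟩
    · rw [hfix k fun hki => hk (hki ▸ hi)]
      by_cases h0 : ω (b k) w = 0
      · simp [h0]
      · refine absurd ?_ hk
        rw [← h.involutive k]
        exact hI _ (hform k h0).1
    · by_cases hki : k = i
      · subst hki
        exact coordSpan_le_iff.2 (fun l hl => hl.1) hself_mem
      · rw [hfix k hki]
        exact sub_mem (basis_mem_coordSpan.2 hk) (Submodule.smul_mem _ _
          (Submodule.smul_mem _ _ (basis_mem_coordSpan.2 (hI i hi))))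
  refine ⟨⟨⟨levelGroup_le_finitaryGroup b I hlev, ?_⟩, fun k => ?_⟩, hlev⟩
  · exact siegelMap_isometry hε hω he hwe hew ha
  · by_cases hki : k = i
    · subst hki
      exact coordSpan_le_iff.2 (fun l hl => hl.2) hself_mem
    · rw [hfix k hki]
      refine sub_mem (basis_mem_coordSpan.2 le_rfl) (Submodule.smul_mem _ _ ?_)
      by_cases h0 : ω (b k) w = 0
      · rw [h0, zero_smul]
        exact zero_mem _
      · refine Submodule.smul_mem _ _ (basis_mem_coordSpan.2 ?_)
        have := hσ _ _ (hform k h0).2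
        rwa [h.involutive k] at this

/-- Write `v = e_i + c (w + a e)` with `e = e_{inv i}`, `c = ω(e_i, e)` and `w` orthogonal to `e_i`
and `e`. Isotropy of `v` is then exactly the isometry condition on `(w, a)`, so the Siegel
transformation with these parameters sends `e_i` to `v`. -/
theorem exists_divisible_apply_eq_form [CharZero K] {ω : LinearMap.BilinForm K V} {inv : ι → ι}
    (h : IsIsotropicBasis b ω inv) {A : Type*} [LinearOrder A] {σ : ι → A}
    (hσ : ∀ k l, σ k ≤ σ l → σ (inv l) ≤ σ (inv k))
    {I : Finset ι} (hI : ∀ k ∈ I, inv k ∈ I) {i : ι} (hi : i ∈ I) (hii : inv i ≠ i) {v : V}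
    (hvi : b.repr v i = 1) (hv : ∀ k, b.repr v k ≠ 0 → k ∈ I ∧ σ k ≤ σ i) (hvv : ω v v = 0) :
    ∃ u ∈ divisibleElements (flagGroup (Datum.form ω inv h) σ ⊓ levelGroup b I),
      u (b i) = v ∧ u (b (inv i)) = b (inv i) ∧
        (∀ k, k ≠ i → b.repr v (inv k) = 0 → u (b k) = b k) ∧
        ∀ k, k ≠ i → ∃ s : K, u (b k) = b k + s • b (inv i) := by
  obtain ⟨ε, hε, hω⟩ := h.exists_sign
  set e := b (inv i) with he_def
  set c := ω (b i) e with hc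
  have hc0 : c ≠ 0 := h.form_ne_zero i
  set w := c⁻¹ • (v - b i - b.repr v (inv i) • e) with hw
  set a := c⁻¹ * b.repr v (inv i) with ha
  have hiii : inv (inv i) ≠ inv i := fun h' => hii (h.inv_injective h')
  have he : ω e e = 0 := h.form_basis_self hiii
  have hbb : ω (b i) (b i) = 0 := h.form_basis_self hii
  have hw1 : b.repr w i = 0 := by simp [w, hvi, e, hii]
  have hw2 : b.repr w (inv i) = 0 := by simp [w, e, hii.symm]
  have hwe : ω w e = 0 := by
    refine h.repr_eq_zero_iff.1 ?_
    rwa [h.involutive]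
  have hew : ω e w = 0 := h.form_eq_zero_comm.1 hwe
  have hwi : ω w (b i) = 0 := h.repr_eq_zero_iff.1 hw2
  have hiw : ω (b i) w = 0 := h.form_eq_zero_comm.1 hwi
  have hv_eq : v = b i + c • (w + a • e) := by
    simp only [w, a, smul_add, smul_smul, ← mul_assoc, mul_inv_cancel₀ hc0, one_smul, one_mul]
    module
  have hcond : (1 + ε) * a + ω w w = 0 := by
    have h1 := hvv
    rw [hv_eq] at h1
    simp only [map_add, map_smul, LinearMap.add_apply, LinearMap.smul_apply, smul_eq_mul, he, hbb,
      hwe, hew, hwi, hiw, mul_zero, add_zero, zero_add, hω e (b i), ← hc] at h1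
    have h2 : c * c * ((1 + ε) * a + ω w w) = 0 := by linear_combination h1
    exact (mul_eq_zero.1 h2).resolve_left (mul_ne_zero hc0 hc0)
  have hvm : v ∈ Submodule.span K (b '' {k | k ∈ I ∧ σ k ≤ σ i}) := mem_coordSpan.2 hv
  have hcoef : b.repr v (inv i) • e ∈ Submodule.span K (b '' {k | k ∈ I ∧ σ k ≤ σ i}) := by
    by_cases h0 : b.repr v (inv i) = 0
    · rw [h0, zero_smul]
      exact zero_mem _
    · exact Submodule.smul_mem _ _ (basis_mem_coordSpan.2 (hv _ h0))
  have hwm : w ∈ Submodule.span K (b '' {k | k ∈ I ∧ σ k ≤ σ i}) :=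
    Submodule.smul_mem _ _ (sub_mem (sub_mem hvm (basis_mem_coordSpan.2 ⟨hi, le_rfl⟩)) hcoef)
  have ham : a • e ∈ Submodule.span K (b '' {k | k ∈ I ∧ σ k ≤ σ i}) := by
    rw [ha, mul_smul]
    exact Submodule.smul_mem _ _ hcoef
  refine ⟨siegel ω ε e w a he hwe hew,
    ⟨siegel_mem h hε hω hσ hI hi he hwe hew hcond hwm ham, fun m hm => ?_⟩, ?_, ?_, ?_, ?_⟩
  · have hm0 : (m : K) ≠ 0 := Nat.cast_ne_zero.2 hm.ne'
    set w' := (m : K)⁻¹ • w with hw'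
    -- Solves `m a' - ε (m (m - 1) / 2) ω(w', w') = a`, so that the `m`-th power has parameters `(w,
    -- a)`.
    set a' := (m : K)⁻¹ * (a + ε * ((m - 1) / (2 * m)) * ω w w) with ha'
    have hwe' : ω w' e = 0 := by simp [w', hwe]
    have hew' : ω e w' = 0 := by simp [w', hew]
    have hww : ω w' w' = ((m : K)⁻¹ * (m : K)⁻¹) * ω w w := by simp [w', mul_assoc]
    have hww2 : ω w w = -((1 + ε) * a) := by linear_combination hcond
    have hcond' : (1 + ε) * a' + ω w' w' = 0 := by
      rw [hww, ha', hww2]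
      rcases hε with rfl | rfl
      · field_simp
        ring
      · ring
    refine ⟨siegel ω ε e w' a' he hwe' hew',
      siegel_mem h hε hω hσ hI hi he hwe' hew' hcond' (Submodule.smul_mem _ _ hwm) ?_, ?_⟩
    -- Since `ω(w, w)` is a multiple of `a`, so is `a'`; hence `a' e` stays in the span even when
    -- `inv i` is not below `i`.
    · have : a' • e = ((m : K)⁻¹ * (1 - ε * ((m - 1) / (2 * m)) * (1 + ε))) • a • e := by
        rw [smul_smul, ha', hww2]
        congr 1
        ring
      rw [← he_def, this]
      exact Submodule.smul_mem _ _ ham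
    · ext x
      rw [siegel_pow_apply, siegel_apply, hw', smul_smul, mul_inv_cancel₀ hm0, one_smul]
      congr 2
      rw [← hw', hww, ha']
      field_simp
      ring
  · rw [siegel_apply, siegelMap_apply, hiw, zero_smul, smul_zero, sub_zero, ← hc]
    exact hv_eq.symm
  · rw [siegel_apply, siegelMap_apply, hew, he]
    simp
  · intro k hki hk
    have hkw : ω (b k) w = 0 := by
      refine h.form_eq_zero_comm.1 (h.repr_eq_zero_iff.1 ?_)
      have h1 : inv k ≠ i := fun h' => by
        rw [h', hvi] at hk
        exact one_ne_zero hk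
      have h2 : inv k ≠ inv i := fun h' => hki (h.inv_injective h')
      simp [w, e, hk, h1.symm, h2.symm]
    have hke : ω (b k) e = 0 := h.isotropic k (inv i) fun h' => hki (h.inv_injective h').symm
    rw [siegel_apply, siegelMap_apply, hkw, hke]
    simp
  · intro k hki
    have hke : ω (b k) e = 0 := h.isotropic k (inv i) fun h' => hki (h.inv_injective h').symm
    refine ⟨-(ε * ω (b k) w), ?_⟩
    rw [siegel_apply, siegelMap_apply, hke, zero_smul, add_zero, smul_smul, neg_smul, sub_eq_add_neg]

end Elementary

/-! ### Bruhat elimination at a finite level -/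

section Bruhat

variable {K : Type u} {V : Type v} {ι : Type w} [Field K] [AddCommGroup V] [Module K V]
  {b : Basis ι K V}

/-- The automorphisms mapping each basis vector to a multiple of a basis vector. -/
def IsMonomial (b : Basis ι K V) (g : V ≃ₗ[K] V) : Prop :=
  ∀ e, ∃ k, ∃ c : K, g (b e) = c • b k

theorem isMonomial_of_forall_mem {I : Finset ι} {g : V ≃ₗ[K] V} (hg : g ∈ levelGroup b I)
    (h : ∀ e ∈ I, ∃ k, ∃ c : K, g (b e) = c • b k) : IsMonomial b g := by
  intro e
  by_cases he : e ∈ I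
  · exact h e he
  · exact ⟨e, 1, by rw [hg.1 e he, one_smul]⟩

theorem coeff_ne_zero {g : V ≃ₗ[K] V} {e k : ι} {c : K} (h : g (b e) = c • b k) : c ≠ 0 := by
  rintro rfl
  rw [zero_smul] at h
  exact b.ne_zero e (g.map_eq_zero_iff.1 h)

theorem inv_apply_of_apply_eq {g : V ≃ₗ[K] V} {e k : ι} {c : K} (h : g (b e) = c • b k) :
    g⁻¹ (b k) = c⁻¹ • b e := by
  have hc := coeff_ne_zero h
  apply g.injective
  rw [apply_inv_apply, map_smul, h, smul_smul, inv_mul_cancel₀ hc, one_smul]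

theorem index_injective {g : V ≃ₗ[K] V} {e e' k : ι} {c c' : K} (h : g (b e) = c • b k)
    (h' : g (b e') = c' • b k) : e = e' := by
  have h1 := (inv_apply_of_apply_eq h).symm.trans (inv_apply_of_apply_eq h')
  by_contra hne
  have h2 := congrArg (fun x => b.repr x e) h1
  simp [hne, coeff_ne_zero h] at h2

theorem apply_mem_levelSpan {I : Finset ι} {g : V ≃ₗ[K] V} (hg : g ∈ levelGroup b I) {e : ι}
    (he : e ∈ I) {k : ι} (hk : b.repr (g (b e)) k ≠ 0) : k ∈ I :=
  mem_coordSpan.1 ((mem_levelGroup_iff.1 hg).2 e he) k hk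

/-- The subgroup of `𝐆` generated by the divisible elements of a level of a flag group. -/
def unipotentGroup {b : Basis ι K V} (d : Datum b) (I : Finset ι) {A : Type*} [LinearOrder A]
    (σ : ι → A) : Subgroup (V ≃ₗ[K] V) :=
  Subgroup.closure (divisibleElements (flagGroup d σ ⊓ levelGroup b I))

theorem unipotentGroup_le {d : Datum b} {I : Finset ι} {A : Type*} [LinearOrder A]
    {σ : ι → A} : unipotentGroup d I σ ≤ flagGroup d σ ⊓ levelGroup b I :=
  (Subgroup.closure_le _).2 fun _ h => h.1

/-- Gaussian elimination, column by column in the order `σ'`. The set `D` of columns already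
monomial is a `σ'`-lower set, so the next column may be modified by all of them; rows are then
cleared from the `σ`-highest remaining entry. -/
theorem exists_bruhat_gl [DecidableEq ι] [CharZero K] {A A' : Type*} [LinearOrder A] [LinearOrder A']
    {σ : ι → A} {σ' : ι → A'} (hσ' : Function.Injective σ') {I : Finset ι} (n : ℕ) :
    ∀ (g : V ≃ₗ[K] V) (D : Finset ι), g ∈ levelGroup b I → D ⊆ I →
      (∀ e ∈ D, ∀ k ∈ I, σ' k ≤ σ' e → k ∈ D) → (∀ e ∈ D, ∃ k, ∃ c : K, g (b e) = c • b k) →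
      (I \ D).card ≤ n →
      ∃ u ∈ unipotentGroup (Datum.gl : Datum b) I σ, ∃ u' ∈ unipotentGroup (Datum.gl : Datum b) I σ',
        IsMonomial b (u * g * u') := by
  induction n with
  | zero =>
    intro g D hg hDI _ hmon hcard
    have hID : I ⊆ D := Finset.sdiff_eq_empty_iff_subset.1 (Finset.card_eq_zero.1 (by omega))
    refine ⟨1, one_mem _, 1, one_mem _, ?_⟩
    rw [one_mul, mul_one]
    exact isMonomial_of_forall_mem hg fun e he => hmon e (hID he)
  | succ n ih =>
    intro g D hg hDI hD hmon hcard
    rcases (I \ D).eq_empty_or_nonempty with hemp | hne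
    · exact ih g D hg hDI hD hmon (by simp [hemp])
    obtain ⟨j, hj, hjmin⟩ := Finset.exists_min_image (I \ D) σ' hne
    rw [Finset.mem_sdiff] at hj
    choose! π c hπ using hmon
    set v : V := b.repr.symm ((b.repr (g (b j))).filter fun k => k ∉ D.image π) with hv
    have hvk : ∀ k, b.repr v k ≠ 0 → k ∉ D.image π ∧ b.repr (g (b j)) k ≠ 0 := by
      intro k hk
      rw [hv, LinearEquiv.apply_symm_apply] at hk
      by_cases h1 : k ∈ D.image π
      · exact absurd (Finsupp.filter_apply_neg (fun k => k ∉ D.image π) _ (not_not.2 h1)) hk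
      · rw [Finsupp.filter_apply_pos (fun k => k ∉ D.image π) _ h1] at hk
        exact ⟨h1, hk⟩
    -- Deleting the old pivot rows from column `j` is a column operation: `y` equals `e_j` modulo
    -- the span of `D`, and `D` lies below `j`.
    set y : V := g⁻¹ v with hy
    have hsub : b j - y ∈ Submodule.span K (b '' (D : Set ι)) := by
      have h1 : g (b j) - v ∈ Submodule.span K (b '' (D.image π : Set ι)) := by
        refine mem_coordSpan.2 fun k hk => ?_
        by_contra hkD
        refine hk ?_
        rw [map_sub, hv, LinearEquiv.apply_symm_apply, Finsupp.sub_apply,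
          Finsupp.filter_apply_pos _ _ (by exact_mod_cast hkD), sub_self]
      have h2 : b j - y = g⁻¹ (g (b j) - v) := by rw [map_sub, inv_apply_apply]
      have h3 : (Submodule.span K (b '' (D.image π : Set ι))).map
          ((g⁻¹ : V ≃ₗ[K] V) : V →ₗ[K] V) ≤ Submodule.span K (b '' (D : Set ι)) := by
        rw [map_coordSpan_le_iff]
        intro k hk
        obtain ⟨e, he, rfl⟩ := Finset.mem_image.1 (Finset.mem_coe.1 hk)
        rw [inv_apply_of_apply_eq (hπ e he)]
        exact Submodule.smul_mem _ _ (basis_mem_coordSpan.2 he)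
      rw [h2]
      exact h3 ⟨_, h1, rfl⟩
    have hyj : b.repr y j = 1 := by
      by_contra hn
      refine hj.2 (mem_coordSpan.1 hsub j fun h0 => hn ?_)
      simp only [map_sub, Finsupp.sub_apply, Basis.repr_self, Finsupp.single_eq_same] at h0
      exact (sub_eq_zero.1 h0).symm
    have hysupp : ∀ k, b.repr y k ≠ 0 → k ∈ I ∧ σ' k ≤ σ' j := by
      intro k hk
      by_cases hkj : k = j
      · subst hkj
        exact ⟨hj.1, le_rfl⟩
      · have hkD : k ∈ D := mem_coordSpan.1 hsub k (by simpa [Ne.symm hkj] using hk)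
        refine ⟨hDI hkD, le_of_not_ge fun hle => hj.2 (hD k hkD j hj.1 hle)⟩
    obtain ⟨p, hp, hpj, hpk⟩ := exists_divisible_apply_eq_gl hj.1 hyj hysupp
    have hv0 : v ≠ 0 := by
      intro h0
      have : y = 0 := by rw [hy, h0, map_zero]
      rw [this] at hyj
      simp at hyj
    have hsupp_ne : (b.repr v).support.Nonempty := by
      rw [Finsupp.support_nonempty_iff]
      exact fun h => hv0 (b.repr.map_eq_zero_iff.1 h)
    -- The new pivot is the `σ`-highest entry of `v`, so a `σ`-triangular `u` sends `e_i` to `v /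
    -- a`. It fixes the old pivots, as they differ from `i`.
    obtain ⟨i, hi, himax⟩ := Finset.exists_max_image (b.repr v).support σ hsupp_ne
    rw [Finsupp.mem_support_iff] at hi
    set a := b.repr v i with ha
    obtain ⟨u, hu, hui, huk⟩ := exists_divisible_apply_eq_gl (b := b) (σ := σ) (I := I) (i := i)
      (v := a⁻¹ • v) (apply_mem_levelSpan hg hj.1 (hvk i hi).2)
      (by rw [map_smul, Finsupp.smul_apply, ← ha, smul_eq_mul, inv_mul_cancel₀ hi])
      (by
        intro k hk
        have hk' : b.repr v k ≠ 0 := fun h0 => hk (by simp [h0])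
        exact ⟨apply_mem_levelSpan hg hj.1 (hvk k hk').2, himax k (Finsupp.mem_support_iff.2 hk')⟩)
    have huv : u⁻¹ v = a • b i := by
      apply u.injective
      rw [apply_inv_apply, map_smul, hui, smul_smul, mul_inv_cancel₀ hi, one_smul]
    have hnew : ∀ e ∈ insert j D, ∃ k, ∃ c : K, (u⁻¹ * g * p) (b e) = c • b k := by
      intro e he
      rcases Finset.mem_insert.1 he with rfl | heD
      · refine ⟨i, a, ?_⟩
        rw [LinearEquiv.mul_apply, hpj, LinearEquiv.mul_apply, hy, apply_inv_apply, huv]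
      · refine ⟨π e, c e, ?_⟩
        have hne : π e ≠ i := fun h' => (hvk i hi).1 (h' ▸ Finset.mem_image_of_mem π heD)
        rw [LinearEquiv.mul_apply, hpk e fun h' => hj.2 (h' ▸ heD), LinearEquiv.mul_apply, hπ e heD,
          map_smul]
        congr 1
        apply u.injective
        rw [apply_inv_apply, huk _ hne]
    obtain ⟨u₁, hu₁, u₁', hu₁', hm⟩ := ih (u⁻¹ * g * p) (insert j D)
      (mul_mem (mul_mem (inv_mem hu.1.2) hg) hp.1.2) (Finset.insert_subset hj.1 hDI)
      (by
        intro e he k hk hke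
        by_contra hkD
        rw [Finset.mem_insert, not_or] at hkD
        rcases Finset.mem_insert.1 he with rfl | heD
        · exact hkD.1 (hσ' (le_antisymm hke (hjmin k (Finset.mem_sdiff.2 ⟨hk, hkD.2⟩))))
        · exact hkD.2 (hD e heD k hk hke)) hnew
      (by
        have hlt : (I \ insert j D).card < (I \ D).card := by
          refine Finset.card_lt_card ⟨fun k hk => ?_, fun hsub => ?_⟩
          · simp only [Finset.mem_sdiff, Finset.mem_insert, not_or] at hk ⊢
            exact ⟨hk.1, hk.2.2⟩
          · have := hsub (Finset.mem_sdiff.2 hj)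
            simp at this
        omega)
    refine ⟨u₁ * u⁻¹, mul_mem hu₁ (inv_mem (Subgroup.subset_closure hu)), p * u₁',
      mul_mem (Subgroup.subset_closure hp) hu₁', ?_⟩
    have : u₁ * u⁻¹ * g * (p * u₁') = u₁ * (u⁻¹ * g * p) * u₁' := by group
    rwa [this]

theorem IsIsotropicBasis.form_self_eq_zero {ω : LinearMap.BilinForm K V} {inv : ι → ι}
    (h : IsIsotropicBasis b ω inv) {x : V} (hx : ∀ k, b.repr x k ≠ 0 → b.repr x (inv k) = 0) :
    ω x x = 0 := by
  have hmem : x ∈ Submodule.span K (b '' {k | b.repr x k ≠ 0}) := mem_coordSpan.2 fun _ hi => hi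
  have hle : Submodule.span K (b '' {k | b.repr x k ≠ 0}) ≤ LinearMap.ker (ω x) := by
    rw [Submodule.span_le]
    rintro _ ⟨k, hk, rfl⟩
    exact h.repr_eq_zero_iff.1 (hx k hk)
  exact hle hmem

/-- Here `D` is stable under `inv`, and the columns `j` and `inv j` are treated together.
Orthogonality to the finished columns makes column `j` vanish at the old pivots, so no lower-set
condition on `D` is needed. -/
theorem exists_bruhat_form [DecidableEq ι] [CharZero K] {ω : LinearMap.BilinForm K V} {inv : ι → ι}
    (h : IsIsotropicBasis b ω inv) {A A' : Type*} [LinearOrder A] [LinearOrder A']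
    {σ : ι → A} {σ' : ι → A'} (hσi : Function.Injective σ) (hσi' : Function.Injective σ')
    (hσ : ∀ k l, σ k ≤ σ l → σ (inv l) ≤ σ (inv k))
    (hσ' : ∀ k l, σ' k ≤ σ' l → σ' (inv l) ≤ σ' (inv k))
    {I : Finset ι} (hI : ∀ k ∈ I, inv k ∈ I) (n : ℕ) :
    ∀ (g : V ≃ₗ[K] V) (D : Finset ι), g ∈ levelGroup b I → g ∈ isometryGroup ω → D ⊆ I →
      (∀ e ∈ D, inv e ∈ D) → (∀ e ∈ D, ∃ k, ∃ c : K, g (b e) = c • b k) →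
      (I \ D).card ≤ n →
      ∃ u ∈ unipotentGroup (Datum.form ω inv h) I σ, ∃ u' ∈ unipotentGroup (Datum.form ω inv h) I σ',
        IsMonomial b (u * g * u') := by
  induction n with
  | zero =>
    intro g D hg _ hDI _ hmon hcard
    have hID : I ⊆ D := Finset.sdiff_eq_empty_iff_subset.1 (Finset.card_eq_zero.1 (by omega))
    refine ⟨1, one_mem _, 1, one_mem _, ?_⟩
    rw [one_mul, mul_one]
    exact isMonomial_of_forall_mem hg fun e he => hmon e (hID he)
  | succ n ih =>
    intro g D hg hgω hDI hD hmon hcard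
    rcases (I \ D).eq_empty_or_nonempty with hemp | hne
    · exact ih g D hg hgω hDI hD hmon (by simp [hemp])
    obtain ⟨j, hj, hjmin⟩ := Finset.exists_min_image (I \ D) σ' hne
    rw [Finset.mem_sdiff] at hj
    have hinvD : ∀ k, k ∈ I \ D → inv k ∈ I \ D := by
      intro k hk
      rw [Finset.mem_sdiff] at hk ⊢
      refine ⟨hI k hk.1, fun h' => hk.2 ?_⟩
      rw [← h.involutive k]
      exact hD _ h'
    choose! π c hπ using hmon
    have hc : ∀ e ∈ D, c e ≠ 0 := fun e he => coeff_ne_zero (hπ e he)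
    have hcomm : ∀ e ∈ D, π (inv e) = inv (π e) := by
      intro e he
      by_contra hne
      have h1 := hgω (b e) (b (inv e))
      rw [hπ e he, hπ _ (hD e he)] at h1
      simp only [map_smul, LinearMap.smul_apply, h.isotropic _ _ hne, smul_zero] at h1
      exact h.form_ne_zero e h1.symm
    -- If the minimal remaining index is fixed by `inv`, antitonicity makes it also maximal, hence
    -- the only one left. The old pivots are then all of `I` except `j`, and orthogonality leaves
    -- column `j` with its diagonal entry alone.
    by_cases hjj : inv j = j
    · have hID : ∀ k ∈ I, k ≠ j → k ∈ D := by
        intro k hk hkj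
        by_contra hkD
        have h1 := hjmin k (Finset.mem_sdiff.2 ⟨hk, hkD⟩)
        have h2 := hσ' _ _ (hjmin _ (hinvD k (Finset.mem_sdiff.2 ⟨hk, hkD⟩)))
        rw [hjj, h.involutive] at h2
        exact hkj (hσi' (le_antisymm h2 h1))
      have hjne : ∀ e ∈ D, π e ≠ j := by
        intro e he hej
        have hee : inv e ≠ e := fun h' => hj.2 (h.fixed_unique e j h' hjj ▸ he)
        have h1 := hgω (b e) (b e)
        rw [hπ e he, hej, h.form_basis_self hee] at h1
        simp only [map_smul, LinearMap.smul_apply, smul_eq_mul, mul_eq_zero, hc e he,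
          false_or] at h1
        have h2 := h.form_ne_zero j
        rw [hjj] at h2
        exact h2 h1
      have hcardD : (I.erase j).card ≤ (D.image π).card := by
        rw [Finset.card_image_of_injOn fun e he e' he' hee =>
          index_injective (hπ e he) (hee ▸ hπ e' he')]
        refine Finset.card_le_card fun k hk => ?_
        rw [Finset.mem_erase] at hk
        exact hID k hk.2 hk.1
      have himg : D.image π = I.erase j := by
        refine Finset.eq_of_subset_of_card_le ?_ hcardD
        intro k hk
        obtain ⟨e, he, rfl⟩ := Finset.mem_image.1 hk
        refine Finset.mem_erase.2 ⟨hjne e he, apply_mem_levelSpan hg (hDI he) ?_⟩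
        simp [hπ e he, hc e he]
      refine ⟨1, one_mem _, 1, one_mem _, ?_⟩
      rw [one_mul, mul_one]
      refine isMonomial_of_forall_mem hg fun e he => ?_
      by_cases hej : e = j
      · subst hej
        refine ⟨e, b.repr (g (b e)) e, ?_⟩
        apply b.repr.injective
        ext k
        by_cases hke : k = e
        · subst hke
          simp
        · simp only [map_smul, Basis.repr_self, Finsupp.smul_apply, Finsupp.single_apply,
            Ne.symm hke, if_false, smul_zero]
          by_contra hk
          have hkI := apply_mem_levelSpan hg he hk
          have : k ∈ D.image π := himg ▸ Finset.mem_erase.2 ⟨hke, hkI⟩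
          obtain ⟨l, hl, rfl⟩ := Finset.mem_image.1 this
          refine hk ?_
          rw [← h.involutive (π l), h.repr_eq_zero_iff, ← hcomm l hl]
          have h1 := hgω (b e) (b (inv l))
          rw [hπ _ (hD l hl), h.isotropic e (inv l) fun h' => hj.2 (h.inv_injective h' ▸ hl),
            map_smul, smul_eq_mul, mul_eq_zero, or_iff_right (hc _ (hD l hl))] at h1
          exact h1
      · exact ⟨_, _, hπ e (hID e he hej)⟩
    · set v := g (b j) with hv
      have hvv : ω v v = 0 := by rw [hv, hgω, h.form_basis_self hjj]
      have hvI : ∀ k, b.repr v k ≠ 0 → k ∈ I := fun k hk => apply_mem_levelSpan hg hj.1 hk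
      have hvD : ∀ e ∈ D, b.repr v (π e) = 0 := by
        intro e he
        rw [← h.involutive (π e), h.repr_eq_zero_iff, ← hcomm e he]
        have h1 := hgω (b j) (b (inv e))
        rw [hπ _ (hD e he), h.isotropic j (inv e) fun h' => hj.2 (h.inv_injective h' ▸ he),
          map_smul, smul_eq_mul, mul_eq_zero, or_iff_right (hc _ (hD e he))] at h1
        exact h1
      have hv0 : v ≠ 0 := fun h0 => b.ne_zero j (g.map_eq_zero_iff.1 h0)
      have hsupp_ne : (b.repr v).support.Nonempty := by
        rw [Finsupp.support_nonempty_iff]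
        exact fun h => hv0 (b.repr.map_eq_zero_iff.1 h)
      obtain ⟨i, hi, himax⟩ := Finset.exists_max_image (b.repr v).support σ hsupp_ne
      rw [Finsupp.mem_support_iff] at hi
      set a := b.repr v i with ha
      -- If the highest entry sat at the fixed point, the support would meet each dual pair at most
      -- once, and `ω(v, v) = a² ω(e_i, e_i) ≠ 0` would contradict isotropy of `v`.
      have hii : inv i ≠ i := by
        intro hii
        set x := v - a • b i with hx
        have hxi : b.repr x i = 0 := by simp [x, a]
        have hxk : ∀ k, k ≠ i → b.repr x k = b.repr v k := by
          intro k hk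
          simp [x, hk.symm]
        have hxx : ω x x = 0 := by
          refine h.form_self_eq_zero fun k hk => ?_
          have hki : k ≠ i := fun h' => hk (h' ▸ hxi)
          have hki' : inv k ≠ i := fun h' => hki (by rw [← h.involutive k, h', hii])
          rw [hxk _ hki']
          by_contra hk'
          rw [hxk k hki] at hk
          have h1 := himax k (Finsupp.mem_support_iff.2 hk)
          have h2 := hσ _ _ (himax _ (Finsupp.mem_support_iff.2 hk'))
          rw [hii, h.involutive] at h2
          exact hki (hσi (le_antisymm h1 h2))
        have hxi' : ω x (b i) = 0 := by
          refine h.repr_eq_zero_iff.1 ?_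
          rw [hii, hxi]
        have hix : ω (b i) x = 0 := h.form_eq_zero_comm.1 hxi'
        have hvx : v = x + a • b i := by simp [x]
        rw [hvx] at hvv
        simp only [map_add, map_smul, LinearMap.add_apply, LinearMap.smul_apply, hxx, hxi', hix,
          zero_add, smul_eq_mul, mul_zero] at hvv
        have h2 := h.form_ne_zero i
        rw [hii] at h2
        exact mul_ne_zero hi (mul_ne_zero hi h2) hvv
      obtain ⟨u, hu, hui, -, huk, -⟩ := exists_divisible_apply_eq_form h hσ hI (hvI i hi) hii
        (v := a⁻¹ • v) (by rw [map_smul, Finsupp.smul_apply, ← ha, smul_eq_mul, inv_mul_cancel₀ hi])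
        (by
          intro k hk
          have hk' : b.repr v k ≠ 0 := fun h0 => hk (by simp [h0])
          exact ⟨hvI k hk', himax k (Finsupp.mem_support_iff.2 hk')⟩)
        (by simp [hvv])
      have huv : u⁻¹ v = a • b i := by
        apply u.injective
        rw [apply_inv_apply, map_smul, hui, smul_smul, mul_inv_cancel₀ hi, one_smul]
      have hπi : ∀ e ∈ D, π e ≠ i := fun e he h' => hi (by rw [ha, ← h', hvD e he])
      set g₁ := u⁻¹ * g with hg₁
      have hg₁I : g₁ ∈ levelGroup b I := mul_mem (inv_mem hu.1.2) hg
      have hg₁ω : g₁ ∈ isometryGroup ω := mul_mem (inv_mem hu.1.1.1.2) hgω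
      have hg₁j : g₁ (b j) = a • b i := by rw [hg₁, LinearEquiv.mul_apply, ← hv, huv]
      have hg₁D : ∀ e ∈ D, g₁ (b e) = c e • b (π e) := by
        intro e he
        rw [hg₁, LinearEquiv.mul_apply, hπ e he, map_smul]
        congr 1
        apply u.injective
        rw [apply_inv_apply, huk _ (hπi e he)]
        rw [← hcomm e he, map_smul, Finsupp.smul_apply, hvD _ (hD e he), smul_zero]
      have hiii : inv (inv i) ≠ inv i := fun h' => hii (h.inv_injective h')
      have hjjj : inv (inv j) ≠ inv j := fun h' => hjj (h.inv_injective h')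
      -- The vector that must replace column `inv j`. It pairs nontrivially with `e_j`, so its `inv
      -- j` coordinate is nonzero. It is supported off `D`, where `inv j` is `σ'`-maximal because
      -- `j` is minimal, so a triangular Siegel transformation produces it while fixing `e_j`.
      set z := g₁⁻¹ (b (inv i)) with hz
      have hg₁z : g₁ z = b (inv i) := apply_inv_apply _ _
      have hzj : b.repr z (inv j) ≠ 0 := by
        intro h0
        rw [h.repr_eq_zero_iff, ← hg₁ω, hg₁z, hg₁j, map_smul, smul_eq_mul, mul_eq_zero,
          or_iff_right hi] at h0
        exact h.form_inv_ne_zero i h0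
      have hzI : ∀ k, b.repr z k ≠ 0 → k ∈ I := fun k hk =>
        apply_mem_levelSpan (inv_mem hg₁I) (hI i (hvI i hi)) hk
      have hzD : ∀ e ∈ D, b.repr z e = 0 := by
        intro e he
        rw [← h.involutive e, h.repr_eq_zero_iff, ← hg₁ω, hg₁z, hg₁D _ (hD e he), map_smul,
          h.isotropic _ _ (by rw [h.involutive]; exact hπi _ (hD e he)), smul_zero]
      obtain ⟨p, hp, hpj, hpj', hpk, -⟩ := exists_divisible_apply_eq_form h hσ' hI (hI j hj.1) hjjj
        (v := (b.repr z (inv j))⁻¹ • z)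
        (by rw [map_smul, Finsupp.smul_apply, smul_eq_mul, inv_mul_cancel₀ hzj])
        (by
          intro k hk
          have hk' : b.repr z k ≠ 0 := fun h0 => hk (by simp [h0])
          refine ⟨hzI k hk', ?_⟩
          have := hσ' _ _ (hjmin _ (hinvD k (Finset.mem_sdiff.2 ⟨hzI k hk', fun hkD =>
            hk' (hzD k hkD)⟩)))
          rwa [h.involutive] at this)
        (by
          have : ω z z = 0 := by rw [← hg₁ω, hg₁z, h.form_basis_self hiii]
          simp [this])
      rw [h.involutive] at hpj'
      have hnew : ∀ e ∈ insert j (insert (inv j) D),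
          ∃ k, ∃ c : K, (g₁ * p) (b e) = c • b k := by
        intro e he
        rw [Finset.mem_insert, Finset.mem_insert] at he
        rcases he with rfl | rfl | heD
        · exact ⟨i, a, by rw [LinearEquiv.mul_apply, hpj', hg₁j]⟩
        · exact ⟨inv i, _, by rw [LinearEquiv.mul_apply, hpj, map_smul, hg₁z]⟩
        · refine ⟨π e, c e, ?_⟩
          rw [LinearEquiv.mul_apply, hpk e, hg₁D e heD]
          · exact fun h' => (Finset.mem_sdiff.1 (hinvD j (Finset.mem_sdiff.2 hj))).2 (h' ▸ heD)
          · rw [map_smul, Finsupp.smul_apply, hzD _ (hD e heD), smul_zero]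
      obtain ⟨u₁, hu₁, u₁', hu₁', hm⟩ := ih (g₁ * p) (insert j (insert (inv j) D))
        (mul_mem hg₁I hp.1.2) (mul_mem hg₁ω hp.1.1.1.2)
        (Finset.insert_subset hj.1 (Finset.insert_subset (hI j hj.1) hDI))
        (by
          intro e he
          simp only [Finset.mem_insert] at he ⊢
          rcases he with rfl | rfl | heD
          · exact Or.inr (Or.inl rfl)
          · exact Or.inl (h.involutive _)
          · exact Or.inr (Or.inr (hD e heD))) hnew
        (by
          have hlt : (I \ insert j (insert (inv j) D)).card < (I \ D).card := by
            refine Finset.card_lt_card ⟨fun k hk => ?_, fun hsub => ?_⟩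
            · simp only [Finset.mem_sdiff, Finset.mem_insert, not_or] at hk ⊢
              exact ⟨hk.1, hk.2.2.2⟩
            · have := hsub (Finset.mem_sdiff.2 hj)
              simp at this
          omega)
      refine ⟨u₁ * u⁻¹, mul_mem hu₁ (inv_mem (Subgroup.subset_closure hu)), p * u₁',
        mul_mem (Subgroup.subset_closure hp) hu₁', ?_⟩
      have : u₁ * u⁻¹ * g * (p * u₁') = u₁ * (g₁ * p) * u₁' := by
        rw [hg₁]
        group
      rwa [this]

theorem IsFlagMap.antitone_inv {ω : LinearMap.BilinForm K V} {inv : ι → ι}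
    {h : IsIsotropicBasis b ω inv} {A : Type*} [LinearOrder A] {σ : ι → A}
    (hσ : IsFlagMap (Datum.form ω inv h) σ) (k l : ι) (hkl : σ k ≤ σ l) :
    σ (inv l) ≤ σ (inv k) := by
  obtain ⟨-, iA, -, hanti, hinv⟩ := hσ
  rw [hinv, hinv]
  exact hanti.antitone hkl

/-- The Bruhat decomposition of a level of `𝐆` with respect to two full flags. -/
theorem exists_bruhat [CharZero K] (d : Datum b) {A A' : Type*} [LinearOrder A] [LinearOrder A']
    {σ : ι → A} {σ' : ι → A'} (hσi : Function.Injective σ) (hσi' : Function.Injective σ')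
    (hσ : IsFlagMap d σ) (hσ' : IsFlagMap d σ') {I : Finset ι} (hI : Admissible d I)
    {g : V ≃ₗ[K] V} (hg : g ∈ indGroup d) (hgI : g ∈ levelGroup b I) :
    ∃ u ∈ unipotentGroup d I σ, ∃ u' ∈ unipotentGroup d I σ', IsMonomial b (u * g * u') := by
  classical
  cases d with
  | gl =>
    exact exists_bruhat_gl hσi' _ g ∅ hgI (Finset.empty_subset _) (by simp) (by simp) le_rfl
  | form ω inv h =>
    exact exists_bruhat_form h hσi hσi' hσ.antitone_inv hσ'.antitone_inv hI.1 _ g ∅ hgI hg.2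
      (Finset.empty_subset _) (by simp) (by simp) le_rfl

end Bruhat

/-! ### Solvability of triangular groups -/

section Solvable

variable {K : Type u} {V : Type v} {ι : Type w} [Field K] [AddCommGroup V] [Module K V]
  {b : Basis ι K V} {I : Finset ι} {r : ι → ℕ}

/-- `f` kills the basis vectors outside `I` and lowers the degree `r` by at least `a` on `⟨I⟩`. -/
def Lowers (b : Basis ι K V) (I : Finset ι) (r : ι → ℕ) (a : ℕ) (f : V →ₗ[K] V) : Prop :=
  (∀ k, k ∉ I → f (b k) = 0) ∧
    ∀ k ∈ I, f (b k) ∈ Submodule.span K (b '' {l | l ∈ I ∧ r l + a ≤ r k})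

namespace Lowers

variable {a c : ℕ} {f g : V →ₗ[K] V}

theorem add (hf : Lowers b I r a f) (hg : Lowers b I r a g) : Lowers b I r a (f + g) :=
  ⟨fun k hk => by rw [LinearMap.add_apply, hf.1 k hk, hg.1 k hk, add_zero],
    fun k hk => add_mem (hf.2 k hk) (hg.2 k hk)⟩

theorem sub (hf : Lowers b I r a f) (hg : Lowers b I r a g) : Lowers b I r a (f - g) :=
  ⟨fun k hk => by rw [LinearMap.sub_apply, hf.1 k hk, hg.1 k hk, sub_zero],
    fun k hk => sub_mem (hf.2 k hk) (hg.2 k hk)⟩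

theorem mono (hf : Lowers b I r a f) (hc : c ≤ a) : Lowers b I r c f :=
  ⟨hf.1, fun k hk => by
    refine coordSpan_le_iff.2 ?_ (hf.2 k hk)
    exact fun l hl => ⟨hl.1, (Nat.add_le_add_left hc _).trans hl.2⟩⟩

theorem comp (hf : Lowers b I r a f) (hg : Lowers b I r c g) : Lowers b I r (a + c) (f * g) := by
  refine ⟨fun k hk => by rw [End.mul_apply, hg.1 k hk, map_zero], fun k hk => ?_⟩
  have : (Submodule.span K (b '' {l | l ∈ I ∧ r l + c ≤ r k})).map f ≤
      Submodule.span K (b '' {l | l ∈ I ∧ r l + (a + c) ≤ r k}) := by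
    rw [Submodule.map_span_le]
    rintro _ ⟨l, hl, rfl⟩
    refine coordSpan_le_iff.2 ?_ (hf.2 l hl.1)
    rintro m ⟨hm, hml⟩
    have h2 := hl.2
    exact ⟨hm, by omega⟩
  exact this ⟨_, hg.2 k hk, rfl⟩

/-- The commutator of two maps preserving a full flag strictly lowers it. -/
theorem commutator (hr : Set.InjOn r I) (hf : Lowers b I r 0 f) (hg : Lowers b I r 0 g) :
    Lowers b I r 1 (f * g - g * f) := by
  have key : ∀ f g : V →ₗ[K] V, Lowers b I r 0 f → Lowers b I r 0 g → ∀ k ∈ I,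
      f (g (b k)) - (b.repr (f (b k)) k * b.repr (g (b k)) k) • b k ∈
        Submodule.span K (b '' {l | l ∈ I ∧ r l + 1 ≤ r k}) := by
    intro f g hf hg k hk
    have hlow : ∀ f : V →ₗ[K] V, Lowers b I r 0 f → f (b k) - b.repr (f (b k)) k • b k ∈
        Submodule.span K (b '' {l | l ∈ I ∧ r l + 1 ≤ r k}) := by
      intro f hf
      refine mem_coordSpan.2 fun l hl => ?_
      have hlk : l ≠ k := by
        rintro rfl
        simp at hl
      have h1 : b.repr (f (b k)) l ≠ 0 := by simpa [hlk.symm] using hl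
      have h2 := mem_coordSpan.1 (hf.2 k hk) l h1
      refine ⟨h2.1, ?_⟩
      have h3 : r l ≠ r k := fun h => hlk (hr h2.1 hk h)
      have := h2.2
      omega
    have h1 : (Submodule.span K (b '' {l | l ∈ I ∧ r l + 1 ≤ r k})).map f ≤
        Submodule.span K (b '' {l | l ∈ I ∧ r l + 1 ≤ r k}) := by
      rw [Submodule.map_span_le]
      rintro _ ⟨l, hl, rfl⟩
      refine coordSpan_le_iff.2 ?_ (hf.2 l hl.1)
      rintro m ⟨hm, hml⟩
      have h2 := hl.2
      exact ⟨hm, by omega⟩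
    have h2 := add_mem (h1 ⟨_, hlow g hg, rfl⟩)
      (Submodule.smul_mem _ (b.repr (g (b k)) k) (hlow f hf))
    convert h2 using 1
    rw [map_sub, map_smul]
    module
  refine ⟨(sub (hf.comp hg) (hg.comp hf)).1, fun k hk => ?_⟩
  have h1 := sub_mem (key f g hf hg k hk) (key g f hg hf k hk)
  rw [mul_comm (b.repr (g (b k)) k), sub_sub_sub_cancel_right] at h1
  exact h1

end Lowers

theorem lowers_zero (a : ℕ) : Lowers b I r a (0 : V →ₗ[K] V) :=
  ⟨fun _ _ => rfl, fun _ _ => zero_mem _⟩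

theorem lowers_mul_sub_one {a : ℕ} {g h : V ≃ₗ[K] V} (hg : Lowers b I r a ((g : V →ₗ[K] V) - 1))
    (hh : Lowers b I r a ((h : V →ₗ[K] V) - 1)) :
    Lowers b I r a (((g * h : V ≃ₗ[K] V) : V →ₗ[K] V) - 1) := by
  have : ((g * h : V ≃ₗ[K] V) : V →ₗ[K] V) - 1 =
      ((g : V →ₗ[K] V) - 1) * ((h : V →ₗ[K] V) - 1) +
      (((g : V →ₗ[K] V) - 1) + ((h : V →ₗ[K] V) - 1)) := by
    ext x
    simp
  rw [this]
  exact ((hg.comp hh).mono (Nat.le_add_right _ _)).add (hg.add hh)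

theorem lowers_inv_sub_one {a : ℕ} {g : V ≃ₗ[K] V} (hg : Lowers b I r a ((g : V →ₗ[K] V) - 1))
    (hg' : Lowers b I r 0 (((g⁻¹ : V ≃ₗ[K] V) : V →ₗ[K] V) - 1)) :
    Lowers b I r a (((g⁻¹ : V ≃ₗ[K] V) : V →ₗ[K] V) - 1) := by
  have : ((g⁻¹ : V ≃ₗ[K] V) : V →ₗ[K] V) - 1 =
      0 - (((g : V →ₗ[K] V) - 1) * (((g⁻¹ : V ≃ₗ[K] V) : V →ₗ[K] V) - 1) +
        ((g : V →ₗ[K] V) - 1)) := by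
    ext x
    simp
  rw [this]
  exact (lowers_zero a).sub ((hg.comp hg').add hg)

/-- From `g h g⁻¹ h⁻¹ - 1 = [g - 1, h - 1] g⁻¹ h⁻¹`, the group commutator inherits the degree of the
linear one. -/
theorem lowers_commutator_sub_one {a : ℕ} {g h : V ≃ₗ[K] V}
    (hcomm : Lowers b I r a (((g : V →ₗ[K] V) - 1) * ((h : V →ₗ[K] V) - 1) -
      ((h : V →ₗ[K] V) - 1) * ((g : V →ₗ[K] V) - 1)))
    (hgh : Lowers b I r 0 (((g⁻¹ * h⁻¹ : V ≃ₗ[K] V) : V →ₗ[K] V) - 1)) :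
    Lowers b I r a (((g * h * (g⁻¹ * h⁻¹) : V ≃ₗ[K] V) : V →ₗ[K] V) - 1) := by
  have : ((g * h * (g⁻¹ * h⁻¹) : V ≃ₗ[K] V) : V →ₗ[K] V) - 1 =
      (((g : V →ₗ[K] V) - 1) * ((h : V →ₗ[K] V) - 1) -
        ((h : V →ₗ[K] V) - 1) * ((g : V →ₗ[K] V) - 1)) *
          (((g⁻¹ * h⁻¹ : V ≃ₗ[K] V) : V →ₗ[K] V) - 1) +
      (((g : V →ₗ[K] V) - 1) * ((h : V →ₗ[K] V) - 1) -
        ((h : V →ₗ[K] V) - 1) * ((g : V →ₗ[K] V) - 1)) := by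
    ext x
    simp only [LinearMap.sub_apply, LinearMap.add_apply, End.mul_apply, LinearEquiv.coe_coe,
      LinearEquiv.mul_apply, End.one_apply, map_sub, apply_inv_apply]
    abel
  rw [this]
  exact (hcomm.comp hgh).add hcomm

/-- The elements of `H` congruent to the identity up to maps lowering the degree by `a`. -/
def congruenceSubgroup (H : Subgroup (V ≃ₗ[K] V))
    (hH : ∀ g ∈ H, Lowers b I r 0 ((g : V →ₗ[K] V) - 1)) (a : ℕ) : Subgroup H where
  carrier := {g | Lowers b I r a (((g : V ≃ₗ[K] V) : V →ₗ[K] V) - 1)}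
  one_mem' := by
    have : (((1 : H) : V ≃ₗ[K] V) : V →ₗ[K] V) - 1 = 0 := sub_self _
    rw [Set.mem_ofPred_eq, this]
    exact lowers_zero a
  mul_mem' := fun {_ _} hg hh => lowers_mul_sub_one hg hh
  inv_mem' := fun {g} hg => lowers_inv_sub_one hg (hH _ (g⁻¹).2)

/-- The `n`-th derived subgroup consists of elements congruent to `1` modulo maps of degree `n`, and
a degree above the maximum of `r` on `I` forces the identity. -/
theorem isSolvable_of_lowers (hr : Set.InjOn r I) (H : Subgroup (V ≃ₗ[K] V))
    (hH : ∀ g ∈ H, Lowers b I r 0 ((g : V →ₗ[K] V) - 1)) : Group.IsSolvable H := by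
  have hder : ∀ n, derivedSeries H n ≤ congruenceSubgroup H hH n := by
    intro n
    induction n with
    | zero => exact fun g _ => hH g g.2
    | succ n ih =>
      rw [derivedSeries_succ, Subgroup.commutator_le]
      intro g hg h hh
      have hg' : Lowers b I r n (((g : V ≃ₗ[K] V) : V →ₗ[K] V) - 1) := ih hg
      have hh' : Lowers b I r n (((h : V ≃ₗ[K] V) : V →ₗ[K] V) - 1) := ih hh
      have hcomm : Lowers b I r (n + 1)
          ((((g : V ≃ₗ[K] V) : V →ₗ[K] V) - 1) * (((h : V ≃ₗ[K] V) : V →ₗ[K] V) - 1) -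
          (((h : V ≃ₗ[K] V) : V →ₗ[K] V) - 1) * (((g : V ≃ₗ[K] V) : V →ₗ[K] V) - 1)) := by
        -- Degrees add under composition, which gains nothing at degree `0`; there the gain comes
        -- from the commuting diagonal parts.
        cases n with
        | zero => exact Lowers.commutator hr hg' hh'
        | succ n =>
          exact ((hg'.comp hh').mono (by omega)).sub ((hh'.comp hg').mono (by omega))
      change g * h * g⁻¹ * h⁻¹ ∈ _
      rw [mul_assoc (g * h)]
      exact lowers_commutator_sub_one hcomm (hH _ (g⁻¹ * h⁻¹).2)
  refine (Group.isSolvable_def H).2 ⟨I.sup r + 1, eq_bot_iff.2 fun g hg => ?_⟩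
  have h1 := hder _ hg
  rw [Subgroup.mem_bot]
  apply Subtype.ext
  apply LinearEquiv.toLinearMap_injective
  refine b.ext fun k => ?_
  suffices h : (((g : V ≃ₗ[K] V) : V →ₗ[K] V) - 1) (b k) = 0 from sub_eq_zero.1 h
  by_cases hk : k ∈ I
  · have h2 := h1.2 k hk
    have h3 : {l | l ∈ I ∧ r l + (I.sup r + 1) ≤ r k} = ∅ := by
      refine Set.eq_empty_iff_forall_notMem.2 fun l hl => ?_
      have h4 := hl.2
      have h5 : r k ≤ I.sup r := Finset.le_sup hk
      omega
    rw [h3, Set.image_empty, Submodule.span_empty] at h2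
    exact h2
  · exact h1.1 k hk

/-- The degree of `k` is its rank in `I` for the order given by `σ`, which translates triangularity
into natural numbers. -/
theorem isSolvable_flagGroup_level (d : Datum b) {A : Type*} [LinearOrder A] {σ : ι → A}
    (hσ : Function.Injective σ) (I : Finset ι) :
    Group.IsSolvable (flagGroup d σ ⊓ levelGroup b I : Subgroup (V ≃ₗ[K] V)) := by
  classical
  have hlt : ∀ k ∈ I, ∀ l, σ k < σ l → (I.filter fun m => σ m < σ k).card <
      (I.filter fun m => σ m < σ l).card := by
    intro k hk l hkl
    refine Finset.card_lt_card ⟨fun m hm => ?_, fun h => ?_⟩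
    · rw [Finset.mem_filter] at hm ⊢
      exact ⟨hm.1, hm.2.trans hkl⟩
    · have := h (Finset.mem_filter.2 ⟨hk, hkl⟩)
      simp at this
  refine isSolvable_of_lowers (b := b) (I := I) (r := fun k => (I.filter fun l => σ l < σ k).card)
    ?_ _ ?_
  · intro k hk l hl hkl
    by_contra hne
    rcases lt_or_gt_of_ne (hσ.ne hne) with h | h
    · exact (hlt k hk l h).ne hkl
    · exact (hlt l hl k h).ne' hkl
  · rintro g ⟨hg, hgI⟩
    refine ⟨fun k hk => ?_, fun k hk => ?_⟩
    · rw [LinearMap.sub_apply]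
      exact sub_eq_zero.2 (hgI.1 k hk)
    · refine sub_mem (mem_coordSpan.2 fun l hl => ⟨apply_mem_levelSpan hgI hk hl, ?_⟩)
        (basis_mem_coordSpan.2 ⟨hk, le_rfl⟩)
      have hlk : σ l ≤ σ k := mem_coordSpan.1 (hg.2 k) l hl
      exact Finset.card_le_card fun m hm => by
        rw [Finset.mem_filter] at hm ⊢
        exact ⟨hm.1, hm.2.trans_le hlk⟩

end Solvable

/-! ### Stabilizers of full flags satisfy the Borel conditions -/

section Borel

variable {K : Type u} {V : Type v} {ι : Type w} [Field K] [AddCommGroup V] [Module K V]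
  {b : Basis ι K V} {A : Type*} [LinearOrder A] {σ : ι → A}

theorem IsZariskiClosedAt.inter {I : Finset ι} {X Y : Set (V ≃ₗ[K] V)}
    (hX : IsZariskiClosedAt b I X) (hY : IsZariskiClosedAt b I Y) :
    IsZariskiClosedAt b I (X ∩ Y) := by
  obtain ⟨S, hS⟩ := hX
  obtain ⟨T, hT⟩ := hY
  refine ⟨S ∪ T, fun g hg => ?_⟩
  rw [Set.mem_inter_iff, hS g hg, hT g hg]
  constructor
  · rintro ⟨h1, h2⟩ p (hp | hp)
    exacts [h1 p hp, h2 p hp]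
  · exact fun h => ⟨fun p hp => h p (Or.inl hp), fun p hp => h p (Or.inr hp)⟩

theorem isZariskiClosedAt_level (I : Finset ι) :
    IsZariskiClosedAt b I (levelGroup b I : Set (V ≃ₗ[K] V)) :=
  ⟨∅, fun g hg => by simpa using hg⟩

/-- The vanishing of a set of matrix coefficients is a closed condition. -/
theorem isZariskiClosedAt_coeff (I : Finset ι) (Z : Set (I × I)) :
    IsZariskiClosedAt b I {g | ∀ z ∈ Z, b.repr (g (b z.2)) z.1 = 0} := by
  refine ⟨MvPolynomial.X '' Z, fun g _ => ?_⟩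
  rw [Set.forall_mem_image]
  simp only [MvPolynomial.eval_X, Set.mem_ofPred_eq]

/-- The equations say that the Gram matrix on `I` is preserved. This suffices because an admissible
`I` is stable under `inv`, so the remaining basis vectors are orthogonal to its span. -/
theorem isZariskiClosedAt_indGroup (d : Datum b) {I : Finset ι} (hI : Admissible d I) :
    IsZariskiClosedAt b I (indGroup d : Set (V ≃ₗ[K] V)) := by
  cases d with
  | gl => exact ⟨∅, fun g hg =>
      ⟨fun _ _ hp => hp.elim, fun _ => levelGroup_le_finitaryGroup b I hg⟩⟩
  | form ω inv h =>
    refine ⟨Set.range fun ij : I × I => (∑ k : I, ∑ l : I, MvPolynomial.X (k, ij.1) *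
      MvPolynomial.X (l, ij.2) * MvPolynomial.C (ω (b k) (b l))) -
        MvPolynomial.C (ω (b ij.1) (b ij.2)), fun g hg => ?_⟩
    have hexp : ∀ i : I, g (b i) = ∑ k : I, b.repr (g (b i)) k • b k := by
      intro i
      conv_lhs => rw [← b.linearCombination_repr (g (b i)), Finsupp.linearCombination_apply]
      rw [Finsupp.sum_of_support_subset (s := I) _ _ _ (by simp), ← Finset.sum_coe_sort]
      intro k hk
      exact apply_mem_levelSpan hg i.2 (Finsupp.mem_support_iff.1 hk)
    have hω : ∀ i j : I, ω (g (b i)) (g (b j)) = ∑ k : I, ∑ l : I,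
        b.repr (g (b i)) k * b.repr (g (b j)) l * ω (b k) (b l) := by
      intro i j
      conv_lhs => rw [hexp i, hexp j]
      simp only [map_sum, LinearMap.sum_apply, map_smul, LinearMap.smul_apply, smul_eq_mul]
      rw [Finset.sum_comm]
      refine Finset.sum_congr rfl fun k _ => ?_
      rw [Finset.mul_sum]
      exact Finset.sum_congr rfl fun l _ => by ring
    simp only [Set.forall_mem_range, map_sub, map_sum, map_mul, MvPolynomial.eval_X,
      MvPolynomial.eval_C, sub_eq_zero]
    constructor
    · rintro ⟨-, hg2⟩ ⟨i, j⟩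
      rw [← hω, hg2]
    · intro hg2
      refine ⟨levelGroup_le_finitaryGroup b I hg, IsIsotropicBasis.mem_isometryGroup (b := b) ?_⟩
      have hout : ∀ i j, i ∉ I → j ∈ I → ω (b i) (b j) = 0 := fun i j hi hj =>
        h.form_basis_eq_zero fun h' => hi (h' ▸ hI.1 j hj)
      have hout' : ∀ i j, i ∉ I → j ∈ I → ω (b i) (g (b j)) = 0 := by
        intro i j hi hj
        rw [hexp ⟨j, hj⟩, map_sum]
        refine Finset.sum_eq_zero fun k _ => ?_
        rw [map_smul, hout i k hi k.2, smul_zero]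
      intro i j
      by_cases hi : i ∈ I
      · by_cases hj : j ∈ I
        · rw [hω ⟨i, hi⟩ ⟨j, hj⟩]
          exact hg2 (⟨i, hi⟩, ⟨j, hj⟩)
        · rw [hg.1 j hj, h.form_eq_zero_comm.1 (hout' j i hj hi),
            h.form_eq_zero_comm.1 (hout j i hj hi)]
      · by_cases hj : j ∈ I
        · rw [hg.1 i hi, hout' i j hi hj, hout i j hi hj]
        · rw [hg.1 i hi, hg.1 j hj]

theorem isClosedIndSubgroup_flagGroup (d : Datum b) (σ : ι → A) :
    IsClosedIndSubgroup d (flagGroup d σ) := by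
  refine ⟨flagGroup_le_indGroup d σ, fun I hI => ?_⟩
  obtain ⟨S, hS⟩ := (isZariskiClosedAt_indGroup d hI).inter
    (isZariskiClosedAt_coeff (b := b) I {z | ¬ σ z.1 ≤ σ z.2})
  refine ⟨S, fun g hg => (hS g hg).symm.trans ?_ |>.symm⟩
  constructor
  · rintro ⟨h1, h2⟩
    refine ⟨h1, fun j => mem_coordSpan.2 fun i hij => ?_⟩
    by_cases hj : j ∈ I
    · by_contra hn
      exact hij (h2 (⟨i, apply_mem_levelSpan hg hj hij⟩, ⟨j, hj⟩) hn)
    · rw [hg.1 j hj] at hij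
      by_contra hn
      have : j ≠ i := by
        rintro rfl
        exact hn le_rfl
      simp [this] at hij
  · rintro ⟨h1, h2⟩
    refine ⟨h1, fun z hz => ?_⟩
    by_contra hn
    exact hz (mem_coordSpan.1 (h2 z.2) _ hn)

theorem cartan_le_flagGroup (d : Datum b) (σ : ι → A) : cartan d ≤ flagGroup d σ := by
  rintro g ⟨hg, hgd⟩
  refine ⟨hg, fun j => ?_⟩
  obtain ⟨c, hc⟩ := hgd j
  rw [hc]
  exact Submodule.smul_mem _ _ (basis_mem_coordSpan.2 le_rfl)

/-- Both `g` and `g⁻¹` are triangular, so each basis vector can go neither up nor down. -/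
theorem mem_cartan_of_isMonomial {d : Datum b} (hσ : Function.Injective σ) {g : V ≃ₗ[K] V}
    (hg : g ∈ flagGroup d σ) (hmon : IsMonomial b g) : g ∈ cartan d := by
  refine ⟨hg.1, fun e => ?_⟩
  obtain ⟨k, c, hkc⟩ := hmon e
  have hc := coeff_ne_zero hkc
  have h1 : σ k ≤ σ e := mem_coordSpan.1 (hg.2 e) k (by simp [hkc, hc])
  have h2 : σ e ≤ σ k :=
    mem_coordSpan.1 ((inv_mem hg).2 k) e (by simp [inv_apply_of_apply_eq hkc, hc])
  exact ⟨c, hσ (le_antisymm h1 h2) ▸ hkc⟩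

/-- A finite-index subgroup contains all divisible elements. By Bruhat elimination with the same
flag on both sides, these and the diagonal elements generate the level. -/
theorem isConnectedModCartan_flagGroup [CharZero K] (d : Datum b) (hσi : Function.Injective σ)
    (hσ : IsFlagMap d σ) : IsConnectedModCartan d (flagGroup d σ) := by
  intro I hI M hM _ hcart hidx
  have huni : unipotentGroup d I σ ≤ M := by
    refine (Subgroup.closure_le _).2 ?_
    rintro u ⟨-, hu⟩
    -- Some power of `x` with exponent at most the index lies in `M`; the factorial of the index is
    -- a multiple of that exponent.
    obtain ⟨x, hx, rfl⟩ := hu _ (Nat.factorial_pos (M.relIndex (flagGroup d σ ⊓ levelGroup b I)))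
    exact (Subgroup.pow_mem_of_relIndex_ne_zero_of_dvd hidx hx fun m hm hm' =>
      Nat.dvd_factorial hm hm').1
  refine le_antisymm hM fun g hg => ?_
  obtain ⟨u, hu, u', hu', hmon⟩ := exists_bruhat d hσi hσi hσ hσ hI hg.1.1 hg.2
  have hmem := mul_mem (mul_mem (unipotentGroup_le hu) hg) (unipotentGroup_le hu')
  have h1 : u * g * u' ∈ M := hcart ⟨mem_cartan_of_isMonomial hσi hmem.1 hmon, hmem.2⟩
  have h2 := mul_mem (mul_mem (inv_mem (huni hu)) h1) (inv_mem (huni hu'))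
  have h3 : u⁻¹ * (u * g * u') * u'⁻¹ = g := by group
  rwa [h3] at h2

theorem isLocallySolvable_flagGroup (d : Datum b) (hσi : Function.Injective σ) :
    IsLocallySolvable d (flagGroup d σ) := by
  intro I _ M hM _
  have := isSolvable_flagGroup_level d hσi I
  exact Group.isSolvable_of_isSolvable_injective (Subgroup.inclusion_injective hM)

end Borel

/-! ### A Lie-Kolchin theorem for abstract representations -/

section LieKolchin

variable {K : Type*} [Field K] {W : Type*} [AddCommGroup W] [Module K W] {G : Type*} [Group G]

theorem finiteIndex_of_finite_range {X : Type*} {f : G → X} (hf : (Set.range f).Finite)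
    {S : Subgroup G} (hS : ∀ x y, f x = f y → x⁻¹ * y ∈ S) : S.FiniteIndex := by
  have := hf.to_subtype
  let F : G ⧸ S → Set.range f := fun q => ⟨f q.out, Set.mem_range_self _⟩
  have hF : Function.Injective F := by
    intro p q hpq
    have h1 := hS _ _ (congrArg Subtype.val hpq)
    rw [← QuotientGroup.eq, QuotientGroup.out_eq', QuotientGroup.out_eq'] at h1
    exact h1
  have := Finite.of_injective F hF
  exact Subgroup.finiteIndex_of_finite_quotient

/-- Over an algebraically closed field `Kˣ` is divisible. This stands in for connectedness of a
one-dimensional torus. -/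
theorem eq_top_of_finiteIndex_units [IsAlgClosed K] (S : Subgroup Kˣ) [S.FiniteIndex] : S = ⊤ := by
  refine eq_top_iff.2 fun c _ => ?_
  obtain ⟨z, hz⟩ := IsAlgClosed.exists_pow_nat_eq (c : K)
    (Nat.pos_of_ne_zero (Subgroup.FiniteIndex.index_ne_zero (H := S)))
  have hz0 : z ≠ 0 := by
    rintro rfl
    rw [zero_pow Subgroup.FiniteIndex.index_ne_zero] at hz
    exact c.ne_zero hz.symm
  have h1 : Units.mk0 z hz0 ^ S.index = c := Units.ext (by simpa using hz)
  rw [← h1]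
  exact S.pow_index_mem _

/-- The subgroup of the elements stabilizing a subspace. -/
def stabilizerSubgroup (ρ : Representation K G W) (F : Submodule K W) : Subgroup G where
  carrier := {g | F.map (ρ g) = F}
  one_mem' := by
    rw [Set.mem_ofPred_eq, map_one]
    exact Submodule.map_id F
  mul_mem' := by
    intro g h hg hh
    rw [Set.mem_ofPred_eq, map_mul, End.mul_eq_comp, Submodule.map_comp, hh, hg]
  inv_mem' := by
    intro g hg
    rw [Set.mem_ofPred_eq] at hg ⊢
    conv_lhs => rw [← hg]
    rw [← Submodule.map_comp, ← End.mul_eq_comp, ← map_mul, inv_mul_cancel, map_one]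
    exact Submodule.map_id F

theorem mem_stabilizerSubgroup {ρ : Representation K G W} {F : Submodule K W} {g : G} :
    g ∈ stabilizerSubgroup ρ F ↔ F.map (ρ g) = F := Iff.rfl

theorem mem_stabilizerSubgroup_of_map_eq {ρ : Representation K G W} {F : Submodule K W} {g h : G}
    (hgh : F.map (ρ g) = F.map (ρ h)) : g⁻¹ * h ∈ stabilizerSubgroup ρ F := by
  rw [mem_stabilizerSubgroup, map_mul, End.mul_eq_comp, Submodule.map_comp, ← hgh,
    ← Submodule.map_comp, ← End.mul_eq_comp, ← map_mul, inv_mul_cancel, map_one]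
  exact Submodule.map_id F

/-- On a minimal nonzero subspace stable under all the maps, an eigenspace of any one of them is
again stable, hence everything. -/
theorem exists_common_eigenvector [IsAlgClosed K] [FiniteDimensional K W] [Nontrivial W]
    {X : Type*} (f : X → End K W) (hf : ∀ i j, Commute (f i) (f j)) :
    ∃ χ : X → K, (⨅ i, (f i).eigenspace (χ i)) ≠ ⊥ := by
  obtain ⟨F, ⟨hF0, hFs⟩, hmin⟩ := WellFounded.has_min
    (wellFounded_lt (α := Submodule K W)) {F | F ≠ ⊥ ∧ ∀ i, ∀ x ∈ F, f i x ∈ F}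
    ⟨⊤, top_ne_bot, fun _ _ _ => Submodule.mem_top⟩
  have hsc : ∀ i, ∃ c : K, F ≤ (f i).eigenspace c := by
    intro i
    have : Nontrivial F := Submodule.nontrivial_iff_ne_bot.2 hF0
    obtain ⟨c, hc⟩ := Module.End.exists_eigenvalue ((f i).restrict (hFs i))
    obtain ⟨x, hx⟩ := hc.exists_hasEigenvector
    refine ⟨c, ?_⟩
    have hmem : F ⊓ (f i).eigenspace c ∈ {F | F ≠ ⊥ ∧ ∀ i, ∀ x ∈ F, f i x ∈ F} := by
      refine ⟨fun h => ?_, fun j y hy => ⟨hFs j y hy.1, ?_⟩⟩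
      · have h1 : (x : W) ∈ F ⊓ (f i).eigenspace c := by
          refine ⟨x.2, End.mem_eigenspace_iff.2 ?_⟩
          exact congrArg Subtype.val hx.apply_eq_smul
        rw [h, Submodule.mem_bot] at h1
        exact hx.2 (Subtype.ext h1)
      · have h1 := End.mem_eigenspace_iff.1 hy.2
        rw [SetLike.mem_coe, End.mem_eigenspace_iff]
        have h2 := congrArg (fun g : End K W => g y) (hf i j).eq
        simp only [End.mul_apply] at h2
        rw [h2, h1, map_smul]
    have h1 := hmin _ hmem
    have h2 : F ⊓ (f i).eigenspace c = F := by
      by_contra hne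
      exact h1 (lt_of_le_of_ne inf_le_left hne)
    exact inf_eq_left.1 h2
  choose χ hχ using hsc
  refine ⟨χ, fun h => hF0 (eq_bot_iff.2 ?_)⟩
  rw [← h]
  exact le_iInf hχ

/-- Joint eigenspaces are independent, and finite dimension allows only finitely many nonzero ones.
-/
theorem finite_eigenspaces [FiniteDimensional K W] {X : Type*} (f : X → End K W)
    (hf : ∀ i j, Commute (f i) (f j)) :
    {χ : X → K | (⨅ i, (f i).eigenspace (χ i)) ≠ ⊥}.Finite := by
  refine WellFoundedGT.finite_ne_bot_of_iSupIndep (iSupIndep.mono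
    (Module.End.independent_iInf_maxGenEigenspace_of_forall_mapsTo f fun i j φ =>
      Module.End.mapsTo_maxGenEigenspace_of_comm (hf j i) φ) fun χ => ?_)
  exact iInf_mono fun i => ((f i).genEigenspace (χ i)).mono le_top

/-- Maps acting as multiplication by a scalar. -/
def IsScalar (f : End K W) : Prop := ∃ c : K, ∀ x, f x = c • x

variable {ρ : Representation K G W}

/-- No proper subspace stable under a given one-parameter group has a stabilizer of finite
index. -/
def StronglyIrreducible (ρ : Representation K G W) (l : Kˣ →* G) : Prop :=
  ∀ F : Submodule K W, (∀ c, F.map (ρ (l c)) = F) → (stabilizerSubgroup ρ F).FiniteIndex →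
    F = ⊥ ∨ F = ⊤

/-- The group permutes the finitely many joint eigenspaces of the normal subgroup `N`. So one such
space has a stabilizer of finite index and is stable under `l` by divisibility of `Kˣ`; strong
irreducibility makes it the whole space. -/
theorem isScalar_of_commute [IsAlgClosed K] [FiniteDimensional K W] [Nontrivial W] {l : Kˣ →* G}
    (hρ : StronglyIrreducible ρ l) (N : Subgroup G) [hN : N.Normal]
    (hcomm : ∀ m ∈ N, ∀ n ∈ N, Commute (ρ m) (ρ n)) {n : G} (hn : n ∈ N) : IsScalar (ρ n) := by
  let f : N → End K W := fun n => ρ n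
  have hf : ∀ i j, Commute (f i) (f j) := fun i j => hcomm i i.2 j j.2
  obtain ⟨χ, hχ⟩ := exists_common_eigenvector f hf
  set E : Submodule K W := ⨅ i, (f i).eigenspace (χ i) with hE
  have hmap : ∀ g, ∃ χ' ∈ {χ : N → K | (⨅ i, (f i).eigenspace (χ i)) ≠ ⊥},
      E.map (ρ g) = ⨅ i, (f i).eigenspace (χ' i) := by
    have hle : ∀ g (χ : N → K), (⨅ i, (f i).eigenspace (χ i)).map (ρ g) ≤
        ⨅ i, (f i).eigenspace (χ ⟨g⁻¹ * i * g, by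
          have := hN.conj_mem i i.2 g⁻¹
          rwa [inv_inv] at this⟩) := by
      intro g χ
      refine Submodule.map_le_iff_le_comap.2 fun x hx => ?_
      rw [Submodule.mem_comap, Submodule.mem_iInf]
      intro i
      rw [Submodule.mem_iInf] at hx
      have h1 := End.mem_eigenspace_iff.1 (hx ⟨g⁻¹ * i * g, by
          have := hN.conj_mem i i.2 g⁻¹
          rwa [inv_inv] at this⟩)
      rw [End.mem_eigenspace_iff, ← map_smul, ← h1]
      change ρ i (ρ g x) = ρ g (ρ (g⁻¹ * i * g) x)
      rw [← End.mul_apply, ← End.mul_apply, ← map_mul, ← map_mul]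
      congr 2
      group
    intro g
    have heq : E.map (ρ g) = ⨅ i, (f i).eigenspace (χ ⟨g⁻¹ * i * g, by
          have := hN.conj_mem i i.2 g⁻¹
          rwa [inv_inv] at this⟩) := by
      refine le_antisymm (hle g χ) fun x hx => ?_
      have h1 := hle g⁻¹ _ ⟨x, hx, rfl⟩
      refine ⟨ρ g⁻¹ x, ?_, ?_⟩
      · refine (iInf_mono fun i => le_of_eq ?_ : _ ≤ E) h1
        congr 2
        ext
        simp [mul_assoc]
      · rw [← End.mul_apply, ← map_mul, mul_inv_cancel, map_one, End.one_apply]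
    refine ⟨_, ?_, heq⟩
    rw [Set.mem_ofPred_eq, ← heq]
    intro h0
    refine hχ (eq_bot_iff.2 fun x hx => ?_)
    have h1 : ρ g x ∈ E.map (ρ g) := ⟨x, hx, rfl⟩
    rw [h0, Submodule.mem_bot] at h1
    have h2 : ρ g⁻¹ (ρ g x) = x := by
      rw [← End.mul_apply, ← map_mul, inv_mul_cancel, map_one, End.one_apply]
    rw [Submodule.mem_bot, ← h2, h1, map_zero]
  have hfin : (Set.range fun g => E.map (ρ g)).Finite := by
    refine ((finite_eigenspaces f hf).image fun χ => ⨅ i, (f i).eigenspace (χ i)).subset ?_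
    rintro _ ⟨g, rfl⟩
    obtain ⟨χ', h1, h2⟩ := hmap g
    exact ⟨χ', h1, h2.symm⟩
  have hidx : (stabilizerSubgroup ρ E).FiniteIndex :=
    finiteIndex_of_finite_range hfin fun x y hxy => mem_stabilizerSubgroup_of_map_eq hxy
  have hl : ∀ c, E.map (ρ (l c)) = E := by
    have : ((stabilizerSubgroup ρ E).comap l).FiniteIndex :=
      finiteIndex_of_finite_range (f := fun c => E.map (ρ (l c)))
        (hfin.subset (by rintro _ ⟨c, rfl⟩; exact ⟨l c, rfl⟩)) fun x y hxy => by
          rw [Subgroup.mem_comap, map_mul, map_inv]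
          exact mem_stabilizerSubgroup_of_map_eq hxy
    have htop := eq_top_of_finiteIndex_units ((stabilizerSubgroup ρ E).comap l)
    intro c
    have : c ∈ (stabilizerSubgroup ρ E).comap l := htop ▸ Subgroup.mem_top c
    exact this
  have hE_top : E = ⊤ := (hρ E hl hidx).resolve_left hχ
  refine ⟨χ ⟨n, hn⟩, fun x => ?_⟩
  have hx : x ∈ E := hE_top ▸ Submodule.mem_top
  exact End.mem_eigenspace_iff.1 ((Submodule.mem_iInf _).1 hx ⟨n, hn⟩)

/-- Compare determinants of the two sides. -/
theorem pow_finrank_eq_one [FiniteDimensional K W] {g h : G} {z : K}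
    (hz : ρ g * ρ h = z • (ρ h * ρ g)) : z ^ finrank K W = 1 := by
  have h1 := congrArg LinearMap.det hz
  rw [LinearMap.det_smul, map_mul, map_mul, mul_comm (LinearMap.det (ρ h))] at h1
  have hne : ∀ g, LinearMap.det (ρ g) ≠ 0 := by
    intro g h0
    have h2 : LinearMap.det (ρ g * ρ g⁻¹) = 1 := by
      rw [← map_mul, mul_inv_cancel, map_one, map_one]
    rw [map_mul, h0, zero_mul] at h2
    exact zero_ne_one h2
  exact (mul_right_cancel₀ (mul_ne_zero (hne g) (hne h)) ((one_mul _).trans h1)).symm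

/-- Let `Z` be the part of `N` commuting with `N` under `ρ`; it acts by scalars. Conjugation by an
element of `N` multiplies each `ρ m` by a root of unity of bounded order, so `n` has only finitely
many conjugates under `l` modulo `Z`. Divisibility of `Kˣ` leaves just one: `ρ n` commutes with
every `ρ (l c)` up to a root of unity, and then exactly. By `hdiag` the image of `N` is commutative,
and the previous case applies. -/
theorem isScalar_of_commutator [IsAlgClosed K] [FiniteDimensional K W] [Nontrivial W]
    {l : Kˣ →* G} (hρ : StronglyIrreducible ρ l)
    (hdiag : ∀ f g : End K W, (∀ c, Commute f (ρ (l c))) → (∀ c, Commute g (ρ (l c))) → Commute f g)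
    (N : Subgroup G) [hN : N.Normal]
    (hcomm : ∀ m ∈ N, ∀ n ∈ N, ∃ z : K, ρ m * ρ n = z • (ρ n * ρ m)) {n : G} (hn : n ∈ N) :
    IsScalar (ρ n) := by
  have hd : 0 < finrank K W := finrank_pos
  let Z : Subgroup G :=
    { carrier := {z | z ∈ N ∧ ∀ n ∈ N, Commute (ρ z) (ρ n)}
      one_mem' := ⟨one_mem _, fun n _ => by rw [map_one]; exact Commute.one_left _⟩
      mul_mem' := fun {x y} hx hy => ⟨mul_mem hx.1 hy.1, fun n hn => by
        rw [map_mul]; exact (hx.2 n hn).mul_left (hy.2 n hn)⟩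
      inv_mem' := fun {x} hx => ⟨inv_mem hx.1, fun n hn => by
        have h1 := (hx.2 n hn).eq
        rw [← map_mul, ← map_mul] at h1
        have h2 : ρ (x⁻¹ * (x * n) * x⁻¹) = ρ (x⁻¹ * (n * x) * x⁻¹) := by
          rw [map_mul, map_mul, h1, ← map_mul, ← map_mul]
        have h3 : x⁻¹ * (x * n) * x⁻¹ = n * x⁻¹ := by group
        have h4 : x⁻¹ * (n * x) * x⁻¹ = x⁻¹ * n := by group
        rw [h3, h4, map_mul, map_mul] at h2
        exact h2.symm⟩ }
  have hZ : Z.Normal := by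
    refine ⟨fun z hz g => ⟨hN.conj_mem z hz.1 g, fun n hn => ?_⟩⟩
    have h1 := hN.conj_mem n hn g⁻¹
    rw [inv_inv] at h1
    have h2 := (hz.2 _ h1).eq
    rw [← map_mul, ← map_mul] at h2
    have h3 : ρ (g * (z * (g⁻¹ * n * g)) * g⁻¹) = ρ (g * (g⁻¹ * n * g * z) * g⁻¹) := by
      rw [map_mul, map_mul, h2, ← map_mul, ← map_mul]
    have h4 : g * (z * (g⁻¹ * n * g)) * g⁻¹ = g * z * g⁻¹ * n := by group
    have h5 : g * (g⁻¹ * n * g * z) * g⁻¹ = n * (g * z * g⁻¹) := by group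
    rw [h4, h5, map_mul, map_mul ρ n] at h3
    exact h3
  have hZs : ∀ z ∈ Z, IsScalar (ρ z) := fun z hz =>
    isScalar_of_commute hρ Z (fun m hm n hn => hm.2 n hn.1) hz
  have hmain : ∀ n ∈ N, ∀ c, Commute (ρ n) (ρ (l c)) := by
    intro n hn
    let S : Subgroup Kˣ := (Subgroup.centralizer {QuotientGroup.mk' Z n}).comap
      ((QuotientGroup.mk' Z).comp l)
    -- Finitely many elements of `ρ(N)` span all of it, so a conjugation action on `ρ(N)` is
    -- recorded by finitely many roots of unity.
    obtain ⟨t, ht, hspan⟩ := (Submodule.fg_span_iff_fg_span_finset_subset _).1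
      (IsNoetherian.noetherian (Submodule.span K (ρ '' (N : Set G))))
    let nc : Kˣ → G := fun c => l c * n * (l c)⁻¹
    have hnc : ∀ c, nc c ∈ N := fun c => hN.conj_mem n hn (l c)
    let f : Kˣ → t → End K W := fun c m => ρ (nc c) * m * ρ (nc c)⁻¹
    have hroots : {z : K | z ^ finrank K W = 1}.Finite := by
      refine (Polynomial.nthRootsFinset (finrank K W) (1 : K)).finite_toSet.subset fun z hz => ?_
      exact (Polynomial.mem_nthRootsFinset hd _).2 hz
    have hfin : (Set.range f).Finite := by
      refine (Set.Finite.pi' (t := fun m : t => (fun z : K => z • (m : End K W)) ''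
        {z : K | z ^ finrank K W = 1}) fun m => hroots.image _).subset ?_
      rintro _ ⟨c, rfl⟩ m
      obtain ⟨m', hm', hmm⟩ := ht m.2
      obtain ⟨z, hz⟩ := hcomm (nc c) (hnc c) m' hm'
      refine ⟨z, pow_finrank_eq_one hz, ?_⟩
      simp only [f]
      rw [← hmm, hz, smul_mul_assoc, mul_assoc, ← map_mul, mul_inv_cancel, map_one, mul_one]
    have hS : S.FiniteIndex := by
      refine finiteIndex_of_finite_range hfin fun c c' hcc => ?_
      have hagree : ∀ m ∈ N, ρ (nc c) * ρ m * ρ (nc c)⁻¹ = ρ (nc c') * ρ m * ρ (nc c')⁻¹ := by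
        intro m hm
        let φ : End K W →ₗ[K] End K W :=
          LinearMap.mulRight K (ρ (nc c)⁻¹) ∘ₗ LinearMap.mulLeft K (ρ (nc c)) -
            LinearMap.mulRight K (ρ (nc c')⁻¹) ∘ₗ LinearMap.mulLeft K (ρ (nc c'))
        have h1 : Submodule.span K (t : Set (End K W)) ≤ LinearMap.ker φ := by
          rw [Submodule.span_le]
          intro x hx
          exact sub_eq_zero.2 (congrFun hcc ⟨x, hx⟩)
        have h2 : ρ m ∈ LinearMap.ker φ :=
          h1 (hspan ▸ Submodule.subset_span ⟨m, hm, rfl⟩)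
        exact sub_eq_zero.1 h2
      have hmem : (nc c)⁻¹ * nc c' ∈ Z := by
        refine ⟨mul_mem (inv_mem (hnc c)) (hnc c'), fun m hm => ?_⟩
        have h1 := hagree m hm
        rw [← map_mul, ← map_mul, ← map_mul, ← map_mul] at h1
        have h2 : ρ ((nc c)⁻¹ * (nc c * m * (nc c)⁻¹) * nc c') =
            ρ ((nc c)⁻¹ * (nc c' * m * (nc c')⁻¹) * nc c') := by
          rw [map_mul, map_mul, h1, ← map_mul, ← map_mul]
        have h3 : (nc c)⁻¹ * (nc c * m * (nc c)⁻¹) * nc c' = m * ((nc c)⁻¹ * nc c') := by group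
        have h4 : (nc c)⁻¹ * (nc c' * m * (nc c')⁻¹) * nc c' = (nc c)⁻¹ * nc c' * m := by group
        rw [h3, h4, map_mul, map_mul ρ _ m] at h2
        exact h2.symm
      have hq := (QuotientGroup.eq (s := Z)).2 hmem
      rw [Subgroup.mem_comap, Subgroup.mem_centralizer_singleton_iff]
      have hq' : QuotientGroup.mk' Z (l c) * QuotientGroup.mk' Z n * (QuotientGroup.mk' Z (l c))⁻¹ =
          QuotientGroup.mk' Z (l c') * QuotientGroup.mk' Z n * (QuotientGroup.mk' Z (l c'))⁻¹ := hq
      simp only [MonoidHom.comp_apply, map_mul, map_inv]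
      generalize QuotientGroup.mk' Z (l c) = x at *
      generalize QuotientGroup.mk' Z (l c') = y at *
      generalize QuotientGroup.mk' Z n = a at *
      have h5 : x⁻¹ * (x * a * x⁻¹) * y = x⁻¹ * (y * a * y⁻¹) * y := by rw [hq']
      have h6 : x⁻¹ * (x * a * x⁻¹) * y = a * (x⁻¹ * y) := by group
      have h7 : x⁻¹ * (y * a * y⁻¹) * y = x⁻¹ * y * a := by group
      rw [h6, h7] at h5
      first | exact h5 | exact h5.symm
    have htop := eq_top_of_finiteIndex_units S
    have hz : ∀ c, ∃ z : K, ρ (l c) * ρ n = z • (ρ n * ρ (l c)) := by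
      intro c
      have h1 : c ∈ S := htop ▸ Subgroup.mem_top c
      rw [Subgroup.mem_comap, Subgroup.mem_centralizer_singleton_iff] at h1
      have h2 : (n * l c)⁻¹ * (l c * n) ∈ Z := by
        rw [← QuotientGroup.eq]
        first | exact h1 | exact h1.symm
      obtain ⟨z, hz⟩ := hZs _ h2
      refine ⟨z, ?_⟩
      have h3 : l c * n = n * l c * ((n * l c)⁻¹ * (l c * n)) := by group
      have h4 : ρ ((n * l c)⁻¹ * (l c * n)) = z • (1 : End K W) := LinearMap.ext hz
      rw [← map_mul, h3, map_mul, h4, mul_smul_comm, mul_one, map_mul]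
    intro c
    -- With `c = y ^ dim W`, the scalar for `c` is the power with exponent `dim W` of the scalar for
    -- `y`, which is `1`.
    obtain ⟨y, hy⟩ := IsAlgClosed.exists_pow_nat_eq (c : K) hd
    have hy0 : y ≠ 0 := by
      rintro rfl
      rw [zero_pow hd.ne'] at hy
      exact c.ne_zero hy.symm
    have hc : c = Units.mk0 y hy0 ^ finrank K W := Units.ext (by simpa using hy.symm)
    obtain ⟨z, hzy⟩ := hz (Units.mk0 y hy0)
    have hpow : ∀ k : ℕ, ρ (l (Units.mk0 y hy0)) ^ k * ρ n =
        z ^ k • (ρ n * ρ (l (Units.mk0 y hy0)) ^ k) := by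
      intro k
      induction k with
      | zero => simp
      | succ k ih =>
        rw [pow_succ, mul_assoc, hzy, mul_smul_comm, ← mul_assoc, ih, smul_mul_assoc, smul_smul,
          mul_assoc, ← pow_succ, pow_succ' z]
    have h1 := hpow (finrank K W)
    rw [pow_finrank_eq_one hzy, one_smul, ← map_pow, ← map_pow, ← hc] at h1
    exact h1.symm
  exact isScalar_of_commute hρ N (fun m hm n hn => hdiag _ _ (hmain m hm) (hmain n hn)) hn

/-- A version of the Lie-Kolchin theorem. -/
theorem isScalar_of_isSolvable [IsAlgClosed K] [FiniteDimensional K W] [Nontrivial W]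
    [Group.IsSolvable G] {l : Kˣ →* G} (hρ : StronglyIrreducible ρ l)
    (hdiag : ∀ f g : End K W, (∀ c, Commute f (ρ (l c))) → (∀ c, Commute g (ρ (l c))) → Commute f g)
    (g : G) : IsScalar (ρ g) := by
  obtain ⟨k, hk⟩ := (Group.isSolvable_def G).1 inferInstance
  -- Descends the derived series: if the next term is scalar, the elements of this one commute up to
  -- scalars.
  have key : ∀ k, (∀ g ∈ derivedSeries G k, IsScalar (ρ g)) → ∀ g, IsScalar (ρ g) := by
    intro k
    induction k with
    | zero => exact fun h g => h g (Subgroup.mem_top g)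
    | succ k ih =>
      refine fun h => ih fun g hg => ?_
      refine isScalar_of_commutator hρ hdiag (derivedSeries G k) (fun m hm n hn => ?_) hg
      obtain ⟨z, hz⟩ := h (m * n * m⁻¹ * n⁻¹) (Subgroup.commutator_mem_commutator hm hn)
      refine ⟨z, ?_⟩
      have h1 : m * n = m * n * m⁻¹ * n⁻¹ * (n * m) := by group
      have h2 : ρ (m * n * m⁻¹ * n⁻¹) = z • (1 : End K W) := LinearMap.ext hz
      rw [← map_mul, h1, map_mul, h2, smul_mul_assoc, one_mul, map_mul]
  refine key k (fun g hg => ?_) g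
  rw [hk, Subgroup.mem_bot] at hg
  rw [hg, map_one]
  exact ⟨1, fun x => (one_smul K x).symm⟩

end LieKolchin

/-! ### Regular one-parameter subgroups of the Cartan subgroup -/

section Cocharacter

variable {K : Type u} {V : Type v} {ι : Type w} [Field K] [AddCommGroup V] [Module K V]
  {b : Basis ι K V}

open Classical in
/-- The one-parameter group of diagonal automorphisms with weights `n` on `I`. -/
noncomputable def cocharacter (b : Basis ι K V) (n : ι → ℤ) (I : Finset ι) :
    Kˣ →* (V ≃ₗ[K] V) where
  toFun c := monomialEquiv b 1 fun k => if k ∈ I then c ^ n k else 1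
  map_one' := by
    refine b.ext' fun k => ?_
    rw [monomialEquiv_apply]
    simp
  map_mul' c c' := by
    refine b.ext' fun k => ?_
    rw [LinearEquiv.mul_apply, monomialEquiv_apply, monomialEquiv_apply, map_smul,
      Equiv.Perm.one_apply, monomialEquiv_apply, smul_smul, ← Units.val_mul, Equiv.Perm.one_apply]
    congr 2
    split_ifs
    · rw [mul_zpow, mul_comm]
    · rw [one_mul]

theorem cocharacter_apply {n : ι → ℤ} {I : Finset ι} (c : Kˣ) {k : ι} (hk : k ∈ I) :
    cocharacter b n I c (b k) = ((c ^ n k : Kˣ) : K) • b k := by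
  change monomialEquiv b 1 _ (b k) = _
  rw [monomialEquiv_apply, if_pos hk, Equiv.Perm.one_apply]

theorem cocharacter_apply_of_notMem {n : ι → ℤ} {I : Finset ι} (c : Kˣ) {k : ι} (hk : k ∉ I) :
    cocharacter b n I c (b k) = b k := by
  change monomialEquiv b 1 _ (b k) = _
  rw [monomialEquiv_apply, if_neg hk, Equiv.Perm.one_apply, Units.val_one, one_smul]

theorem cocharacter_mem_levelGroup (n : ι → ℤ) (I : Finset ι) (c : Kˣ) :
    cocharacter b n I c ∈ levelGroup b I := by
  refine mem_levelGroup_iff.2 ⟨fun k hk => cocharacter_apply_of_notMem c hk, fun k hk => ?_⟩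
  rw [cocharacter_apply c hk]
  exact Submodule.smul_mem _ _ (basis_mem_coordSpan.2 hk)

theorem cocharacter_mem_diagonalGroup (n : ι → ℤ) (I : Finset ι) (c : Kˣ) :
    cocharacter b n I c ∈ diagonalGroup b := by
  intro k
  by_cases hk : k ∈ I
  · exact ⟨_, cocharacter_apply c hk⟩
  · exact ⟨1, by rw [cocharacter_apply_of_notMem c hk, one_smul]⟩

/-- Countability of `E` supplies pairwise distinct integer weights; for a form, opposite weights on
dual pairs make the diagonal maps isometries. -/
theorem exists_regular_cocharacter [Countable ι] (d : Datum b) :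
    ∃ n : ι → ℤ, Function.Injective n ∧
      ∀ I, Admissible d I → ∀ c, cocharacter b n I c ∈ cartan d ⊓ levelGroup b I := by
  obtain ⟨e, he⟩ := Countable.exists_injective_nat ι
  cases d with
  | gl =>
    refine ⟨fun k => e k, fun i j h => he (Nat.cast_injective h), fun I _ c => ?_⟩
    exact ⟨⟨levelGroup_le_finitaryGroup b I (cocharacter_mem_levelGroup _ I c),
      cocharacter_mem_diagonalGroup _ I c⟩, cocharacter_mem_levelGroup _ I c⟩
  | form ω inv h =>
    -- In each dual pair the index with smaller code gets the positive weight. The shift by one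
    -- reserves weight `0` for the fixed point.
    let n : ι → ℤ := fun k => if e k < e (inv k) then (e k : ℤ) + 1 else
      if e (inv k) < e k then -((e (inv k) : ℤ) + 1) else 0
    have hn : ∀ k, n (inv k) = -n k := by
      intro k
      simp only [n, h.involutive k]
      split_ifs <;> omega
    refine ⟨n, fun i j hij => ?_, fun I hI c => ⟨⟨⟨levelGroup_le_finitaryGroup b I
      (cocharacter_mem_levelGroup _ I c), ?_⟩, cocharacter_mem_diagonalGroup _ I c⟩,
      cocharacter_mem_levelGroup _ I c⟩⟩
    · by_cases hi : e i = e (inv i)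
      · have hj : e j = e (inv j) := by
          simp only [n] at hij
          split_ifs at hij <;> omega
        exact h.fixed_unique i j (he hi).symm (he hj).symm
      · have hcase : e i = e j ∨ e (inv i) = e (inv j) := by
          simp only [n] at hij
          split_ifs at hij <;> omega
        rcases hcase with h1 | h1
        · exact he h1
        · exact h.inv_injective (he h1)
    · refine IsIsotropicBasis.mem_isometryGroup (b := b) fun i j => ?_
      by_cases hij : j = inv i
      · subst hij
        by_cases hi : i ∈ I
        · rw [cocharacter_apply c hi, cocharacter_apply c (hI.1 i hi), hn]
          simp only [map_smul, LinearMap.smul_apply, smul_eq_mul]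
          rw [← mul_assoc, ← Units.val_mul, ← zpow_add, neg_add_cancel, zpow_zero, Units.val_one,
            one_mul]
        · rw [cocharacter_apply_of_notMem c hi, cocharacter_apply_of_notMem c fun hi' => hi ?_]
          rw [← h.involutive i]
          exact hI.1 _ hi'
      · obtain ⟨x, hx⟩ := cocharacter_mem_diagonalGroup (b := b) n I c i
        obtain ⟨y, hy⟩ := cocharacter_mem_diagonalGroup (b := b) n I c j
        rw [hx, hy]
        simp only [map_smul, LinearMap.smul_apply, h.isotropic i j hij, smul_zero]

end Cocharacter

/-! ### Regular diagonal operators -/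

section Diagonal

variable {K : Type*} [Field K] {J : Type*}

/-- A subspace stable under a diagonal map with distinct eigenvalues is a coordinate subspace. -/
theorem single_mem_of_mul_mem [Fintype J] [DecidableEq J] {t : J → K} (ht : Function.Injective t)
    {F : Submodule K (J → K)} (hF : ∀ x ∈ F, t * x ∈ F) {x : J → K} (hx : x ∈ F) (j : J) :
    Pi.single j (x j) ∈ F := by
  have hpoly : ∀ p : Polynomial K, Polynomial.aeval t p * x ∈ F := by
    intro p
    induction p using Polynomial.induction_on' with
    | add p q hp hq =>
      rw [map_add, add_mul]
      exact add_mem hp hq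
    | monomial n a =>
      rw [Polynomial.aeval_monomial, mul_assoc, ← Algebra.smul_def]
      refine Submodule.smul_mem _ _ ?_
      induction n with
      | zero => simpa using hx
      | succ n ih =>
        rw [pow_succ', mul_assoc]
        exact hF _ ih
  -- Up to normalization the Lagrange polynomial, so that `p(t)` projects to coordinate `j`.
  set p : Polynomial K := ∏ k ∈ Finset.univ.erase j, (Polynomial.X - Polynomial.C (t k)) with hp
  have heval : ∀ k, k ≠ j → p.eval (t k) = 0 := by
    intro k hk
    rw [hp, Polynomial.eval_prod]
    exact Finset.prod_eq_zero (Finset.mem_erase.2 ⟨hk, Finset.mem_univ k⟩) (by simp)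
  have hevalj : p.eval (t j) ≠ 0 := by
    rw [hp, Polynomial.eval_prod, Finset.prod_ne_zero_iff]
    intro k hk
    simpa [sub_eq_zero] using fun h => Finset.ne_of_mem_erase hk (ht h).symm
  have h1 := F.smul_mem (p.eval (t j))⁻¹ (hpoly p)
  convert h1 using 1
  ext k
  rw [Pi.smul_apply, Pi.mul_apply]
  have h2 : Polynomial.aeval t p k = p.eval (t k) := by
    rw [← Polynomial.coe_aeval_eq_eval]
    exact (Polynomial.aeval_algHom_apply (Pi.evalAlgHom K (fun _ : J => K) k) t p).symm
  rw [h2]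
  by_cases hk : k = j
  · subst hk
    rw [Pi.single_eq_same, smul_eq_mul, ← mul_assoc, inv_mul_cancel₀ hevalj, one_mul]
  · rw [Pi.single_eq_of_ne hk, heval k hk, zero_mul, smul_zero]

theorem apply_single_of_commute [DecidableEq J] {t : J → K} (ht : Function.Injective t)
    {f : End K (J → K)} (hf : ∀ x, f (t * x) = t * f x) (j : J) :
    f (Pi.single j 1) = Pi.single j (f (Pi.single j 1) j) := by
  ext k
  by_cases hk : k = j
  · subst hk
    simp
  · rw [Pi.single_eq_of_ne hk]
    have h1 : t * Pi.single j 1 = t j • (Pi.single j 1 : J → K) := by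
      ext l
      by_cases hl : l = j
      · subst hl
        simp
      · simp [hl]
    have h2 := congrFun (hf (Pi.single j 1)) k
    rw [h1, map_smul, Pi.smul_apply, Pi.mul_apply, smul_eq_mul, ← sub_eq_zero, ← sub_mul] at h2
    exact (mul_eq_zero.1 h2).resolve_left (sub_ne_zero.2 fun h => hk (ht h).symm)

/-- Both maps are diagonal, because `t` has distinct entries. -/
theorem commute_of_commute_diagonal [Fintype J] [DecidableEq J] {t : J → K}
    (ht : Function.Injective t) {f g : End K (J → K)} (hf : ∀ x, f (t * x) = t * f x)
    (hg : ∀ x, g (t * x) = t * g x) : Commute f g := by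
  refine (Pi.basisFun K J).ext fun j => ?_
  rw [Pi.basisFun_apply, End.mul_apply, End.mul_apply]
  have hs : ∀ a : K, (Pi.single j a : J → K) = a • Pi.single j 1 := fun a => by
    rw [← Pi.single_smul', smul_eq_mul, mul_one]
  rw [apply_single_of_commute ht hg, apply_single_of_commute ht hf, hs, map_smul,
    hs (f (Pi.single j 1) j), map_smul, apply_single_of_commute ht hf j,
    apply_single_of_commute ht hg j, hs (f _ _), hs (g _ _), smul_smul, smul_smul, mul_comm]
  simp

end Diagonal

/-! ### Self-dual linear extensions -/

section Extension

/-- A partial order reversed by an involution with at most one fixed point has a linear extension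
reversed by the involution. -/
theorem exists_selfdual_extension {L : Type w} [LinearOrder L] {inv : L → L}
    (hinv : Function.Involutive inv) (hfix : ∀ i j, inv i = i → inv j = j → i = j)
    {r : L → L → Prop} (hr : ∀ i j, r i j → i ≤ j) (hanti : ∀ i j, r i j → r (inv j) (inv i)) :
    ∃ (X : Type w) (_ : LinearOrder X) (f : L → X), Function.Injective f ∧
      (∀ i j, f i ≤ f j → f (inv j) ≤ f (inv i)) ∧ ∀ i j, r i j → f i ≤ f j := by
  -- Three layers: below its dual (layer `0`), fixed (layer `1`), above its dual (layer `2`). The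
  -- upper layer is ordered as the reverse of the lower one through `inv`, which makes the new order
  -- self-dual.
  let f : L → Lex (ℤ × (L ⊕ₗ Lᵒᵈ)) := fun i =>
    if i < inv i then toLex (0, toLex (Sum.inl i)) else
      if inv i < i then toLex (2, toLex (Sum.inr (OrderDual.toDual (inv i)))) else
        toLex (1, toLex (Sum.inl i))
  have f1 : ∀ {i}, i < inv i → f i = toLex (0, toLex (Sum.inl i)) := fun h => if_pos h
  have f2 : ∀ {i}, inv i < i → f i = toLex (2, toLex (Sum.inr (OrderDual.toDual (inv i)))) :=
    fun h => (if_neg (not_lt_of_gt h)).trans (if_pos h)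
  have f3 : ∀ {i}, inv i = i → f i = toLex (1, toLex (Sum.inl i)) :=
    fun h => (if_neg (not_lt_of_ge h.le)).trans (if_neg (not_lt_of_ge h.ge))
  have hcase : ∀ i, i < inv i ∨ inv i < i ∨ inv i = i := fun i => by
    rcases lt_trichotomy i (inv i) with h | h | h
    exacts [Or.inl h, Or.inr (Or.inr h.symm), Or.inr (Or.inl h)]
  have g1 : ∀ {i}, i < inv i → f (inv i) = toLex (2, toLex (Sum.inr (OrderDual.toDual i))) := by
    intro i h
    rw [f2 (by rwa [hinv i]), hinv i]
  have g2 : ∀ {i}, inv i < i → f (inv i) = toLex (0, toLex (Sum.inl (inv i))) := by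
    intro i h
    rw [f1 (by rwa [hinv i])]
  refine ⟨_, inferInstance, f, fun i j hij => ?_, fun i j => ?_, fun i j hij => ?_⟩
  · rcases hcase i with hi | hi | hi <;> rcases hcase j with hj | hj | hj <;>
      simp only [f1, f2, f3, hi, hj] at hij <;>
      simp [Prod.ext_iff] at hij
    · exact hij
    · exact hinv.injective hij
    · exact hij
  · rcases hcase i with hi | hi | hi <;> rcases hcase j with hj | hj | hj <;>
      simp only [f1, f2, f3, g1, g2, hi, hj] <;>
      simp [Prod.Lex.toLex_le_toLex]
    exact fun _ => (hfix i j hi hj).ge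
  -- The given relation yields `i ≤ j` and, by duality, `inv j ≤ inv i`. Together these exclude any
  -- descent between layers, and the second is the comparison needed inside the upper layer.
  · have h1 := hr i j hij
    have h2 := hr _ _ (hanti i j hij)
    rcases hcase i with hi | hi | hi <;> rcases hcase j with hj | hj | hj <;>
      simp only [f1, f2, f3, hi, hj] <;>
      simp [Prod.Lex.toLex_le_toLex]
    · exact h1
    · exact absurd (hj.trans_le (h2.trans_lt hi |>.le.trans h1)) (lt_irrefl _)
    · exact h2
    · exact absurd (hi.trans_le (h1.trans (hj.ge.trans h2))) (lt_irrefl _)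
    · exact absurd (hj.trans_le (h2.trans (hi.le.trans h1))) (lt_irrefl _)
    · exact h1

end Extension

/-! ### Representations on diagonal blocks -/

section Block

variable {K : Type u} {V : Type v} {ι : Type w} [Field K] [AddCommGroup V] [Module K V]
  {b : Basis ι K V}

theorem repr_mul_apply (g h : V ≃ₗ[K] V) (J : Finset ι) (i j : ι)
    (hJ : ∀ k, b.repr (g (b k)) i ≠ 0 → b.repr (h (b j)) k ≠ 0 → k ∈ J) :
    b.repr ((g * h) (b j)) i = ∑ k ∈ J, b.repr (g (b k)) i * b.repr (h (b j)) k := by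
  classical
  have h1 : b.repr ((g * h) (b j)) i =
      ∑ k ∈ (b.repr (h (b j))).support, b.repr (g (b k)) i * b.repr (h (b j)) k := by
    rw [LinearEquiv.mul_apply]
    conv_lhs => rw [← b.linearCombination_repr (h (b j)), Finsupp.linearCombination_apply,
      Finsupp.sum]
    simp only [map_sum, map_smul, Finsupp.coe_finsetSum, Finset.sum_apply, Finsupp.smul_apply,
      smul_eq_mul]
    exact Finset.sum_congr rfl fun k _ => mul_comm _ _
  rw [h1, Finset.sum_subset (Finset.subset_union_left (s₂ := J)),
    ← Finset.sum_subset (Finset.subset_union_right (s₁ := (b.repr (h (b j))).support))]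
  · intro k _ hk
    by_contra hn
    exact hk (hJ k (left_ne_zero_of_mul hn) (right_ne_zero_of_mul hn))
  · intro k _ hk
    rw [Finsupp.notMem_support_iff.1 hk, mul_zero]

/-- The matrix coefficients of a subgroup with indices in `J` form a representation, provided that
no product of coefficients leaves and reenters `J`. -/
noncomputable def blockRepresentation (b : Basis ι K V) (G : Subgroup (V ≃ₗ[K] V)) (J : Finset ι)
    (hJ : ∀ g ∈ G, ∀ h ∈ G, ∀ i ∈ J, ∀ j ∈ J, ∀ k, b.repr (g (b k)) i ≠ 0 →
      b.repr (h (b j)) k ≠ 0 → k ∈ J) : Representation K G (J → K) where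
  toFun g := Matrix.mulVecLin (Matrix.of fun i j : J => b.repr ((g : V ≃ₗ[K] V) (b j)) i)
  map_one' := by
    classical
    have : (Matrix.of fun i j : J => b.repr (((1 : G) : V ≃ₗ[K] V) (b j)) i) =
        (1 : Matrix J J K) := by
      ext i j
      by_cases hij : i = j
      · subst hij
        simp
      · have hne : (j : ι) ≠ i := fun h => hij (Subtype.ext h.symm)
        simp [Matrix.one_apply_ne hij, hne]
    rw [this, Matrix.mulVecLin_one]
    rfl
  map_mul' g h := by
    rw [End.mul_eq_comp, ← Matrix.mulVecLin_mul]
    congr 1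
    ext i j
    rw [Matrix.mul_apply]
    simp only [Matrix.of_apply]
    rw [Subgroup.coe_mul, repr_mul_apply _ _ J i j fun k => hJ g g.2 h h.2 i i.2 j j.2 k,
      ← Finset.sum_coe_sort]

variable {G : Subgroup (V ≃ₗ[K] V)} {J : Finset ι}
  {hJ : ∀ g ∈ G, ∀ h ∈ G, ∀ i ∈ J, ∀ j ∈ J, ∀ k, b.repr (g (b k)) i ≠ 0 →
      b.repr (h (b j)) k ≠ 0 → k ∈ J}

theorem blockRepresentation_apply (g : G) (x : J → K) (i : J) :
    blockRepresentation b G J hJ g x i =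
      ∑ j : J, b.repr ((g : V ≃ₗ[K] V) (b j)) i * x j := rfl

theorem blockRepresentation_single [DecidableEq J] (g : G) (i j : J) :
    blockRepresentation b G J hJ g (Pi.single j 1) i = b.repr ((g : V ≃ₗ[K] V) (b j)) i := by
  rw [blockRepresentation_apply]
  simp [Pi.single_apply]

theorem blockRepresentation_of_diagonal (g : G) {t : J → K}
    (ht : ∀ j : J, (g : V ≃ₗ[K] V) (b j) = t j • b j) (x : J → K) :
    blockRepresentation b G J hJ g x = t * x := by
  classical
  ext i
  rw [blockRepresentation_apply, Finset.sum_eq_single i]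
  · rw [ht]
    simp
  · intro j _ hj
    rw [ht]
    simp [Subtype.coe_injective.ne hj]
  · simp

end Block

/-! ### Borel subgroups are stabilizers of full flags -/

section Order

variable {K : Type u} {V : Type v} {ι : Type w} [Field K] [AddCommGroup V] [Module K V]
  {b : Basis ι K V}

/-- The relation on indices given by the nonzero matrix coefficients of a subgroup. -/
def Linked (b : Basis ι K V) (G : Subgroup (V ≃ₗ[K] V)) (i j : ι) : Prop :=
  ∃ g ∈ G, b.repr (g (b j)) i ≠ 0

theorem coord_mem_of_mem {J : Type*} [Fintype J] [DecidableEq J] {F : Submodule K (J → K)}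
    (hF : ∀ x ∈ F, ∀ j, Pi.single j (x j) ∈ F) {x : J → K} :
    x ∈ F ↔ ∀ j, x j ≠ 0 → (Pi.single j 1 : J → K) ∈ F := by
  constructor
  · intro hx j hj
    have := F.smul_mem (x j)⁻¹ (hF x hx j)
    rwa [← Pi.single_smul', smul_eq_mul, inv_mul_cancel₀ hj] at this
  · intro h
    rw [← Finset.univ_sum_single x]
    refine sum_mem fun j _ => ?_
    by_cases hj : x j = 0
    · rw [hj, Pi.single_zero]
      exact zero_mem _
    · have := F.smul_mem (x j) (h j hj)
      rwa [← Pi.single_smul', smul_eq_mul, mul_one] at this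

/-- The class of `i₀` under mutual reachability gives a block representation of the level. It is
strongly irreducible: a torus-stable subspace is a coordinate subspace, its stabilizer is closed and
contains the Cartan part, so finite index makes it everything, and then the subspace is closed under
links. Solvability makes the block scalar, whereas a regular cocharacter separates its coordinates.
-/
theorem linked_level_antisymm [IsAlgClosed K] [CharZero K] [Countable ι] {d : Datum b}
    {Q : Subgroup (V ≃ₗ[K] V)} (hQ : IsClosedIndSubgroup d Q) (hcart : cartan d ≤ Q)
    (hconn : IsConnectedModCartan d Q) (hsolv : IsLocallySolvable d Q) {I : Finset ι}
    (hI : Admissible d I) {i₀ j₀ : ι}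
    (h₁ : Relation.ReflTransGen (Linked b (Q ⊓ levelGroup b I)) i₀ j₀)
    (h₂ : Relation.ReflTransGen (Linked b (Q ⊓ levelGroup b I)) j₀ i₀) : i₀ = j₀ := by
  classical
  set G : Subgroup (V ≃ₗ[K] V) := Q ⊓ levelGroup b I with hG
  set R := Relation.ReflTransGen (Linked b G) with hR
  have hGclosed : IsZariskiClosedAt b I (G : Set (V ≃ₗ[K] V)) :=
    (hQ.2 I hI).inter (isZariskiClosedAt_level I)
  have houter : ∀ i j, Linked b G i j → i ∈ I ∨ i = j := by
    rintro i j ⟨g, hg, hij⟩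
    by_cases hj : j ∈ I
    · exact Or.inl (apply_mem_levelSpan hg.2 hj hij)
    · right
      rw [hg.2.1 j hj] at hij
      by_contra hne
      simp [Ne.symm hne] at hij
  have houter' : ∀ i j, R i j → i ∈ I ∨ i = j := by
    intro i j hij
    rcases Relation.ReflTransGen.cases_head hij with h | ⟨k, hik, -⟩
    · exact Or.inr h
    · by_cases hi : i ∈ I
      · exact Or.inl hi
      · obtain rfl := (houter i k hik).resolve_left hi
        clear hik
        induction hij with
        | refl => exact Or.inr rfl
        | tail _ hbc ih =>
          rcases ih with h | rfl
          · exact Or.inl h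
          · exact houter _ _ hbc
  rcases houter' _ _ h₁ with hi₀ | h
  swap
  · exact h
  -- The strongly connected component of `i₀`. An index on a path between two of its members belongs
  -- to it, which makes the block multiplicative.
  set J : Finset ι := I.filter fun k => R i₀ k ∧ R k i₀ with hJ_def
  have hmemJ : ∀ k, k ∈ J ↔ R i₀ k ∧ R k i₀ := by
    intro k
    rw [hJ_def, Finset.mem_filter]
    refine ⟨fun h => h.2, fun h => ⟨?_, h⟩⟩
    rcases houter' _ _ h.2 with hk | rfl
    exacts [hk, hi₀]
  have hJ : ∀ g ∈ G, ∀ h ∈ G, ∀ i ∈ J, ∀ j ∈ J, ∀ k, b.repr (g (b k)) i ≠ 0 →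
      b.repr (h (b j)) k ≠ 0 → k ∈ J := by
    intro g hg h hh i hi j hj k hik hkj
    rw [hmemJ] at hi hj ⊢
    exact ⟨hi.1.tail ⟨g, hg, hik⟩, hj.2.head ⟨h, hh, hkj⟩⟩
  set ρ := blockRepresentation b G J hJ with hρ
  obtain ⟨n, hn, hnmem⟩ := exists_regular_cocharacter d
  let l : Kˣ →* G := (cocharacter b n I).codRestrict G fun c =>
    ⟨hcart (hnmem I hI c).1, (hnmem I hI c).2⟩
  have hJI : ∀ k ∈ J, k ∈ I := fun k hk => (Finset.mem_filter.1 hk).1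
  have hl : ∀ c (x : J → K), ρ (l c) x = (fun j : J => ((c ^ n j : Kˣ) : K)) * x := fun c x =>
    blockRepresentation_of_diagonal (l c) (fun j => cocharacter_apply c (hJI j j.2)) x
  -- In characteristic zero `2` is not a root of unity, so distinct weights give distinct
  -- eigenvalues.
  let c₂ : Kˣ := Units.mk0 2 two_ne_zero
  have ht : Function.Injective fun j : J => ((c₂ ^ n j : Kˣ) : K) := by
    intro i j hij
    have h1 : ((2 : ℚ) : K) ^ n i = ((2 : ℚ) : K) ^ n j := by simpa [c₂] using hij
    rw [← Rat.cast_zpow, ← Rat.cast_zpow, Rat.cast_inj] at h1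
    exact Subtype.ext (hn (zpow_right_injective₀ (by norm_num) (by norm_num) h1))
  have hirr : StronglyIrreducible ρ l := by
    intro F hF hidx
    have hsingle : ∀ x ∈ F, ∀ j, Pi.single j (x j) ∈ F := fun x hx j =>
      single_mem_of_mul_mem ht (fun y hy => by
        rw [← hl]
        exact (hF c₂).le ⟨y, hy, rfl⟩) hx j
    -- The coefficients leading from the coordinates in `F` to those outside; their vanishing cuts
    -- out the stabilizer of `F`.
    set Z : Set (I × I) := {z | ∃ (h1 : (z.1 : ι) ∈ J) (h2 : (z.2 : ι) ∈ J),
      (Pi.single ⟨z.1, h1⟩ 1 : J → K) ∉ F ∧ (Pi.single ⟨z.2, h2⟩ 1 : J → K) ∈ F} with hZ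
    have hstab : ∀ g : G, g ∈ stabilizerSubgroup ρ F ↔
        ∀ z ∈ Z, b.repr ((g : V ≃ₗ[K] V) (b z.2)) z.1 = 0 := by
      intro g
      constructor
      · rintro hg ⟨i, j⟩ ⟨hi, hj, hiF, hjF⟩
        by_contra hne
        have h1 : ρ g (Pi.single ⟨j, hj⟩ 1) ∈ F := (mem_stabilizerSubgroup.1 hg).le ⟨_, hjF, rfl⟩
        refine hiF ((coord_mem_of_mem hsingle).1 h1 ⟨i, hi⟩ ?_)
        rwa [hρ, blockRepresentation_single]
      · intro hg
        have hle : F.map (ρ g) ≤ F := by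
          rintro _ ⟨x, hx, rfl⟩
          rw [SetLike.mem_coe, coord_mem_of_mem hsingle] at hx
          refine (coord_mem_of_mem hsingle).2 fun i hi => ?_
          by_contra hiF
          refine hi ?_
          rw [hρ, blockRepresentation_apply]
          refine Finset.sum_eq_zero fun j _ => ?_
          by_cases hj : x j = 0
          · rw [hj, mul_zero]
          · rw [hg (⟨i, hJI i i.2⟩, ⟨j, hJI j j.2⟩) ⟨i.2, j.2, hiF, hx j hj⟩, zero_mul]
        refine Submodule.eq_of_le_of_finrank_eq hle ?_
        have hinj : Function.Injective (ρ g) := by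
          refine Function.LeftInverse.injective (g := ρ g⁻¹) fun x => ?_
          rw [← End.mul_apply, ← map_mul, inv_mul_cancel, map_one, End.one_apply]
        exact (Submodule.equivMapOfInjective (ρ g) hinj F).finrank_eq.symm
    set M : Subgroup (V ≃ₗ[K] V) := (stabilizerSubgroup ρ F).map G.subtype with hM
    have hmemM : ∀ g, g ∈ M ↔ g ∈ G ∧ ∀ z ∈ Z, b.repr (g (b z.2)) z.1 = 0 := by
      intro g
      constructor
      · rintro ⟨g, hg, rfl⟩
        exact ⟨g.2, (hstab g).1 hg⟩
      · rintro ⟨hg, hz⟩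
        exact ⟨⟨g, hg⟩, (hstab ⟨g, hg⟩).2 hz, rfl⟩
    have hMG : M = G := by
      refine hconn I hI M (Subgroup.map_subtype_le _) ?_ ?_ ?_
      · have h1 := hGclosed.inter (isZariskiClosedAt_coeff (b := b) I Z)
        have h2 : (M : Set (V ≃ₗ[K] V)) =
            (G : Set (V ≃ₗ[K] V)) ∩ {g | ∀ z ∈ Z, b.repr (g (b z.2)) z.1 = 0} :=
          Set.ext hmemM
        rwa [h2]
      · intro g hg
        refine (hmemM g).2 ⟨⟨hcart hg.1, hg.2⟩, ?_⟩
        rintro ⟨i, j⟩ ⟨hi, hj, hiF, hjF⟩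
        obtain ⟨c, hc⟩ := hg.1.2 j
        have hne : (j : ι) ≠ i := by
          intro h
          simp only [h] at hjF
          exact hiF hjF
        simp [hc, hne]
      · have h1 : M.relIndex G = (stabilizerSubgroup ρ F).index := by
          rw [Subgroup.relIndex, hM, Subgroup.subgroupOf, Subgroup.comap_map_eq_self_of_injective
            G.subtype_injective]
        rw [h1]
        exact hidx.index_ne_zero
    by_contra! hn
    obtain ⟨hn0, hn1⟩ := hn
    obtain ⟨x, hx, hx0⟩ := F.ne_bot_iff.1 hn0
    obtain ⟨j, hj⟩ := Function.ne_iff.1 hx0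
    have hjF : (Pi.single j 1 : J → K) ∈ F := (coord_mem_of_mem hsingle).1 hx j hj
    refine hn1 (eq_top_iff.2 fun y _ => (coord_mem_of_mem hsingle).2 fun i _ => ?_)
    -- Walking backwards along links from `j` never leaves `F`, since the whole level stabilizes
    -- `F`.
    have hreach : ∀ k, R k j → R i₀ k → ∃ hk : k ∈ J, (Pi.single ⟨k, hk⟩ 1 : J → K) ∈ F := by
      intro k hkj
      induction hkj using Relation.ReflTransGen.head_induction_on with
      | refl => exact fun _ => ⟨j.2, hjF⟩
      | head hac hcj ih =>
        rename_i a c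
        intro ha
        obtain ⟨hc, hcF⟩ := ih (ha.tail hac)
        have haJ : a ∈ J := (hmemJ a).2 ⟨ha, Relation.ReflTransGen.head hac ((hmemJ c).1 hc).2⟩
        refine ⟨haJ, ?_⟩
        by_contra haF
        obtain ⟨g, hg, hgac⟩ := hac
        exact hgac (((hmemM g).1 (hMG ▸ hg)).2 (⟨a, hJI a haJ⟩, ⟨c, hJI c hc⟩) ⟨haJ, hc, haF, hcF⟩)
    obtain ⟨_, h⟩ := hreach i (((hmemJ i).1 i.2).2.trans ((hmemJ j).1 j.2).1) ((hmemJ i).1 i.2).1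
    exact h
  have hdiag : ∀ f g : End K (J → K), (∀ c, Commute f (ρ (l c))) → (∀ c, Commute g (ρ (l c))) →
      Commute f g := by
    intro f g hf hg
    refine commute_of_commute_diagonal ht (fun x => ?_) (fun x => ?_)
    · rw [← hl, ← hl]
      exact congrArg (fun h : End K (J → K) => h x) (hf c₂).eq
    · rw [← hl, ← hl]
      exact congrArg (fun h : End K (J → K) => h x) (hg c₂).eq
  have hi₀J : i₀ ∈ J := (hmemJ _).2 ⟨.refl, .refl⟩
  have hj₀J : j₀ ∈ J := (hmemJ _).2 ⟨h₁, h₂⟩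
  have : Nonempty J := ⟨⟨i₀, hi₀J⟩⟩
  have : Group.IsSolvable G := hsolv I hI G le_rfl hGclosed
  obtain ⟨c, hc⟩ := isScalar_of_isSolvable hirr hdiag (l c₂)
  have h1 := hc 1
  rw [hl, mul_one] at h1
  have h2 := congrFun h1 ⟨i₀, hi₀J⟩
  have h3 := congrFun h1 ⟨j₀, hj₀J⟩
  exact congrArg Subtype.val (ht (h2.trans h3.symm))

/-- Two chains of links involve finitely many group elements, hence take place in one level. -/
theorem linked_antisymm [IsAlgClosed K] [CharZero K] [Countable ι] {d : Datum b}
    {Q : Subgroup (V ≃ₗ[K] V)} (hQ : IsClosedIndSubgroup d Q) (hcart : cartan d ≤ Q)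
    (hconn : IsConnectedModCartan d Q) (hsolv : IsLocallySolvable d Q) {i j : ι}
    (h₁ : Relation.ReflTransGen (Linked b Q) i j)
    (h₂ : Relation.ReflTransGen (Linked b Q) j i) : i = j := by
  classical
  have hlev : ∀ {i j}, Relation.ReflTransGen (Linked b Q) i j → ∃ F : Finset ι, ∀ I : Finset ι,
      F ⊆ I → Relation.ReflTransGen (Linked b (Q ⊓ levelGroup b I)) i j := by
    intro i j hij
    induction hij with
    | refl => exact ⟨∅, fun _ _ => .refl⟩
    | tail _ hbc ih =>
      obtain ⟨F, hF⟩ := ih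
      obtain ⟨g, hg, hgbc⟩ := hbc
      obtain ⟨F', hF'⟩ := exists_levelGroup (indGroup_le_finitaryGroup d (hQ.1 hg))
      exact ⟨F ∪ F', fun I hI => (hF I (Finset.union_subset_left hI)).tail
        ⟨g, ⟨hg, hF' I (Finset.union_subset_right hI)⟩, hgbc⟩⟩
  obtain ⟨F₁, hF₁⟩ := hlev h₁
  obtain ⟨F₂, hF₂⟩ := hlev h₂
  obtain ⟨I, hI, hFI⟩ := exists_admissible_superset d (F₁ ∪ F₂)
  exact linked_level_antisymm hQ hcart hconn hsolv hI (hF₁ I (Finset.union_subset_left hFI))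
    (hF₂ I (Finset.union_subset_right hFI))

/-- Reachability is a partial order, and any linear extension makes `Q` triangular. For a form,
`g⁻¹` is the adjoint of `g`, so links are reversed by `inv` and the extension can be chosen
self-dual. -/
theorem exists_flagMap_of_antisymm {d : Datum b} {Q : Subgroup (V ≃ₗ[K] V)} (hQ : Q ≤ indGroup d)
    (hanti : ∀ i j, Relation.ReflTransGen (Linked b Q) i j →
      Relation.ReflTransGen (Linked b Q) j i → i = j) :
    ∃ (A : Type w) (_ : LinearOrder A) (σ : ι → A), Function.Injective σ ∧ IsFlagMap d σ ∧
      Q ≤ flagGroup d σ := by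
  classical
  have hpo : IsPartialOrder ι (Relation.ReflTransGen (Linked b Q)) :=
    { refl := fun _ => .refl
      trans := fun _ _ _ => .trans
      antisymm := hanti }
  obtain ⟨s, hs, hrs⟩ := extend_partialOrder (Relation.ReflTransGen (Linked b Q))
  let L : LinearOrder ι :=
    { le := s
      le_refl := hs.refl
      le_trans := hs.trans
      le_antisymm := hs.antisymm
      le_total := hs.total
      toDecidableLE := Classical.decRel _ }
  have hle : ∀ {A : Type w} [LinearOrder A] (σ : ι → A),
      (∀ i j, Relation.ReflTransGen (Linked b Q) i j → σ i ≤ σ j) → Q ≤ flagGroup d σ :=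
    fun σ h g hg => ⟨hQ hg, fun j => mem_coordSpan.2 fun i hi => h i j (.single ⟨g, hg, hi⟩)⟩
  cases d with
  | gl => exact ⟨ι, L, id, Function.injective_id, Function.surjective_id, hle id hrs⟩
  | form ω inv h =>
    have hdual : ∀ i j, Linked b Q i j → Linked b Q (inv j) (inv i) := by
      rintro i j ⟨g, hg, hij⟩
      refine ⟨g⁻¹, inv_mem hg, fun h0 => hij ?_⟩
      rw [h.repr_eq_zero_iff, ← (hQ hg).2, apply_inv_apply] at h0
      rw [← h.involutive i, h.repr_eq_zero_iff]
      exact h.form_eq_zero_comm.1 h0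
    have hdual' : ∀ i j, Relation.ReflTransGen (Linked b Q) i j →
        Relation.ReflTransGen (Linked b Q) (inv j) (inv i) := by
      intro i j hij
      induction hij with
      | refl => exact .refl
      | tail _ hbc ih => exact ih.head (hdual _ _ hbc)
    obtain ⟨X, hX, f, hf, hfanti, hfr⟩ :=
      exists_selfdual_extension h.involutive h.fixed_unique hrs hdual'
    -- Restricting to the range makes the map surjective and lets `inv` descend to it.
    let σ : ι ≃ Set.range f := Equiv.ofInjective f hf
    refine ⟨Set.range f, inferInstance, σ, σ.injective, ⟨σ.surjective,
      fun a => σ (inv (σ.symm a)), fun a => ?_, ?_, fun e => ?_⟩, hle _ hfr⟩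
    · simp only [Equiv.symm_apply_apply, h.involutive _, Equiv.apply_symm_apply]
    · intro x y hxy
      obtain ⟨i, rfl⟩ := σ.surjective x
      obtain ⟨j, rfl⟩ := σ.surjective y
      simp only [Equiv.symm_apply_apply]
      refine lt_of_le_of_ne (hfanti i j hxy.le) fun hne => hxy.ne ?_
      rw [h.inv_injective (σ.injective hne)]
    · simp only [Equiv.symm_apply_apply]

/-- Splitting Borel subgroups are stabilizers of full flags. -/
theorem IsSplittingBorel.exists_flagMap [IsAlgClosed K] [CharZero K] [Countable ι] {d : Datum b}
    {B : Subgroup (V ≃ₗ[K] V)} (hB : IsSplittingBorel d B) :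
    ∃ (A : Type w) (_ : LinearOrder A) (σ : ι → A), Function.Injective σ ∧ IsFlagMap d σ ∧
      B = flagGroup d σ := by
  obtain ⟨⟨h1, h2, h3, h4⟩, hmax⟩ := hB
  obtain ⟨A, _, σ, hσi, hσ, hBσ⟩ :=
    exists_flagMap_of_antisymm h1.1 fun i j => linked_antisymm h1 h2 h3 h4
  exact ⟨A, _, σ, hσi, hσ, le_antisymm hBσ (hmax ⟨isClosedIndSubgroup_flagGroup d σ,
    cartan_le_flagGroup d σ, isConnectedModCartan_flagGroup d hσi hσ,
    isLocallySolvable_flagGroup d hσi⟩ hBσ)⟩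

end Order

/-! ### Lifts of reflections from opposite root elements -/

section Reflection

variable {K : Type u} {V : Type v} {ι : Type w} [Field K] [AddCommGroup V] [Module K V]
  {b : Basis ι K V}

open Classical in
/-- The reflection in the hyperoctahedral group exchanging the classes of `i` and `j`. -/
noncomputable def involutiveReflection (inv : ι → ι) (i j : ι) : Equiv.Perm ι :=
  if inv i = j then Equiv.swap i j else
    if inv i = i then Equiv.swap j (inv j) else
      if inv j = j then Equiv.swap i (inv i) else Equiv.swap i j * Equiv.swap (inv i) (inv j)

open Classical in
/-- The reflection of the Weyl group attached to two indices. -/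
noncomputable def reflection {b : Basis ι K V} : Datum b → ι → ι → Equiv.Perm ι
  | .gl, i, j => Equiv.swap i j
  | .form _ inv _, i, j => involutiveReflection inv i j

theorem isLift_of_forall {d : Datum b} {w : Equiv.Perm ι} {g : V ≃ₗ[K] V} (hg : g ∈ indGroup d)
    (h : ∀ e, ∃ c : K, g (b e) = c • b (w e)) : IsLift d w g :=
  ⟨hg, fun e => by
    obtain ⟨c, hc⟩ := h e
    exact ⟨c, coeff_ne_zero hc, hc⟩⟩

theorem apply_mul_mul {x y : V ≃ₗ[K] V} (k : V) : (x * y * x) k = x (y (x k)) := rfl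

open Classical in
-- The `SL₂` identity: with `x : e_j ↦ e_j + e_i` from one flag and `y : e_i ↦ e_i - e_j` from the
-- opposite one, `x y x` swaps the two lines.
theorem exists_lift_reflection_gl [CharZero K] {A A' : Type*} [LinearOrder A] [LinearOrder A']
    {σ : ι → A} {τ : ι → A'} {P : Subgroup (V ≃ₗ[K] V)}
    (hPσ : flagGroup (Datum.gl : Datum b) σ ≤ P) (hPτ : flagGroup (Datum.gl : Datum b) τ ≤ P)
    (hP : P ≤ indGroup (Datum.gl : Datum b)) {i j : ι} (hσ : σ i < σ j) (hτ : τ j < τ i) :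
    ∃ n ∈ P, IsLift (Datum.gl : Datum b) (Equiv.swap i j) n := by
  have hij : i ≠ j := fun h => hσ.ne (h ▸ rfl)
  obtain ⟨x, hx, hxj, hxk⟩ := exists_divisible_apply_eq_gl (b := b) (σ := σ) (I := {i, j}) (i := j)
    (v := b j + b i) (by simp) (by simp [hij]) (by
      intro k hk
      by_cases hkj : k = j
      · rw [hkj]; exact ⟨by simp, le_rfl⟩
      · by_cases hki : k = i
        · rw [hki]; exact ⟨by simp, hσ.le⟩
        · simp [Ne.symm hkj, Ne.symm hki] at hk)
  obtain ⟨y, hy, hyi, hyk⟩ := exists_divisible_apply_eq_gl (b := b) (σ := τ) (I := {i, j}) (i := i)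
    (v := b i - b j) (by simp) (by simp [hij.symm]) (by
      intro k hk
      by_cases hkj : k = j
      · rw [hkj]; exact ⟨by simp, hτ.le⟩
      · by_cases hki : k = i
        · rw [hki]; exact ⟨by simp, le_rfl⟩
        · simp [Ne.symm hkj, Ne.symm hki] at hk)
  have hxP := hPσ hx.1.1
  have hyP := hPτ hy.1.1
  have hn := mul_mem (mul_mem hxP hyP) hxP
  refine ⟨x * y * x, hn, isLift_of_forall (hP hn) fun e => ?_⟩
  rw [apply_mul_mul]
  by_cases hej : e = j
  · refine ⟨1, ?_⟩
    rw [hej, hxj, map_add, hyi, hyk j hij.symm, add_sub_cancel, hxk i hij, Equiv.swap_apply_right,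
      one_smul]
  · by_cases hei : e = i
    · refine ⟨-1, ?_⟩
      rw [hei, hxk i hij, hyi, map_sub, hxj, hxk i hij, Equiv.swap_apply_left]
      module
    · refine ⟨1, ?_⟩
      rw [hxk e hej, hyk e hei, hxk e hej, Equiv.swap_apply_of_ne_of_ne hei hej, one_smul]

variable {ω : LinearMap.BilinForm K V} {inv : ι → ι}

theorem IsIsotropicBasis.stable_quadruple [DecidableEq ι] (h : IsIsotropicBasis b ω inv) (i j : ι) :
    ∀ k ∈ ({i, j, inv i, inv j} : Finset ι), inv k ∈ ({i, j, inv i, inv j} : Finset ι) := by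
  intro k hk
  simp only [Finset.mem_insert, Finset.mem_singleton] at hk ⊢
  rcases hk with rfl | rfl | rfl | rfl <;> simp [h.involutive _]

/-- The root elements `e_j ↦ e_j + t e_i` of the isometry group. -/
theorem exists_root_element [CharZero K] (h : IsIsotropicBasis b ω inv)
    {A : Type*} [LinearOrder A] {σ : ι → A} (hanti : ∀ k l, σ k ≤ σ l → σ (inv l) ≤ σ (inv k))
    {i j : ι} (hij : σ i < σ j) (hi : inv i ≠ i) (hj : inv j ≠ j)
    (hiso : inv i = j → ω (b i) (b j) + ω (b j) (b i) = 0) (t : K) :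
    ∃ x ∈ flagGroup (Datum.form ω inv h) σ, x (b j) = b j + t • b i ∧ x (b i) = b i ∧
      x (b (inv j)) = b (inv j) ∧ (∀ k, k ≠ j → k ≠ inv i → x (b k) = b k) ∧
      (inv i ≠ j → ∃ s : K, x (b (inv i)) = b (inv i) + s • b (inv j) ∧
        s * ω (b (inv j)) (b j) = - (t * ω (b (inv i)) (b i))) := by
  classical
  have hne : i ≠ j := fun h => hij.ne (h ▸ rfl)
  have hvj : b.repr (b j + t • b i) j = 1 := by simp [hne]
  have hvv : ω (b j + t • b i) (b j + t • b i) = 0 := by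
    simp only [map_add, map_smul, LinearMap.add_apply, LinearMap.smul_apply, smul_eq_mul,
      h.form_basis_self hi, h.form_basis_self hj]
    by_cases hc : inv i = j
    · linear_combination t * hiso hc
    · rw [h.isotropic i j (Ne.symm hc), h.isotropic j i fun h' => hc (by rw [h', h.involutive])]
      ring
  obtain ⟨x, hx, hxj, hxj', hxk, hxs⟩ := exists_divisible_apply_eq_form h hanti
    (h.stable_quadruple i j) (i := j) (by simp) hj hvj (by
      intro k hk
      by_cases hkj : k = j
      · rw [hkj]; exact ⟨by simp, le_rfl⟩
      · by_cases hki : k = i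
        · rw [hki]; exact ⟨by simp, hij.le⟩
        · simp [Ne.symm hkj, Ne.symm hki] at hk) hvv
  have hfix : ∀ k, k ≠ j → k ≠ inv i → x (b k) = b k := by
    intro k hkj hki
    by_cases hkj' : k = inv j
    · rw [hkj', hxj']
    · refine hxk k hkj ?_
      have h1 : inv k ≠ j := fun h' => hkj' (by rw [← h', h.involutive])
      have h2 : inv k ≠ i := fun h' => hki (by rw [← h', h.involutive])
      simp [h1.symm, h2.symm]
  refine ⟨x, hx.1.1, hxj, hfix i hne hi.symm, hxj', hfix, fun hc => ?_⟩
  obtain ⟨s, hs⟩ := hxs (inv i) hc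
  refine ⟨s, hs, ?_⟩
  have h1 := hx.1.1.1.2 (b (inv i)) (b j)
  rw [hs, hxj] at h1
  simp only [map_add, map_smul, LinearMap.add_apply, LinearMap.smul_apply, smul_eq_mul] at h1
  rw [h.isotropic (inv j) i (by rw [h.involutive]; exact hne)] at h1
  linear_combination h1

/-- Again `x y x` with opposite root elements. The condition `hiso` is only needed when `j = inv i`,
where `e_j + t e_i` must remain isotropic. -/
theorem exists_lift_reflection_of_ne [CharZero K] (h : IsIsotropicBasis b ω inv)
    {A A' : Type*} [LinearOrder A] [LinearOrder A'] {σ : ι → A} {τ : ι → A'}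
    (hσ : ∀ k l, σ k ≤ σ l → σ (inv l) ≤ σ (inv k)) (hτ : ∀ k l, τ k ≤ τ l → τ (inv l) ≤ τ (inv k))
    {P : Subgroup (V ≃ₗ[K] V)} (hPσ : flagGroup (Datum.form ω inv h) σ ≤ P)
    (hPτ : flagGroup (Datum.form ω inv h) τ ≤ P) (hP : P ≤ indGroup (Datum.form ω inv h)) {i j : ι}
    (hσij : σ i < σ j) (hτij : τ j < τ i) (hi : inv i ≠ i) (hj : inv j ≠ j)
    (hiso : inv i = j → ω (b i) (b j) + ω (b j) (b i) = 0) :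
    ∃ n ∈ P, IsLift (Datum.form ω inv h) (reflection (Datum.form ω inv h) i j) n := by
  classical
  have hij : i ≠ j := fun h => hσij.ne (h ▸ rfl)
  obtain ⟨x, hx, hxj, hxi, hxj', hxk, hxs⟩ := exists_root_element h hσ hσij hi hj hiso 1
  obtain ⟨y, hy, hyi, hyj, hyi', hyk, hys⟩ := exists_root_element h hτ hτij hj hi
    (fun hc => by rw [add_comm]; exact hiso (by rw [← hc, h.involutive])) (-1)
  have hxP := hPσ hx
  have hyP := hPτ hy
  have hn := mul_mem (mul_mem hxP hyP) hxP
  refine ⟨x * y * x, hn, isLift_of_forall (hP hn) fun e => ?_⟩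
  rw [apply_mul_mul]
  have hni : x (y (x (b i))) = (-1 : K) • b j := by
    rw [hxi, hyi, map_add, map_smul, hxi, hxj]
    module
  have hnj : x (y (x (b j))) = (1 : K) • b i := by
    rw [hxj, map_add, map_smul, hyi, hyj, map_add, map_smul, map_add, map_smul, hxj, hxi]
    module
  by_cases hc : inv i = j
  · have hr : reflection (Datum.form ω inv h) i j = Equiv.swap i j := if_pos hc
    rw [hr]
    by_cases hei : e = i
    · exact ⟨-1, by rw [hei, Equiv.swap_apply_left, hni]⟩
    · by_cases hej : e = j
      · exact ⟨1, by rw [hej, Equiv.swap_apply_right, hnj]⟩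
      · refine ⟨1, ?_⟩
        have hji : inv j = i := by rw [← hc, h.involutive]
        rw [Equiv.swap_apply_of_ne_of_ne hei hej, hxk e hej (hc ▸ hej), hyk e hei (hji ▸ hei),
          hxk e hej (hc ▸ hej), one_smul]
  · have hr : reflection (Datum.form ω inv h) i j =
        Equiv.swap i j * Equiv.swap (inv i) (inv j) :=
      (if_neg hc).trans ((if_neg hi).trans (if_neg hj))
    have hc' : inv j ≠ i := fun h' => hc (by rw [← h', h.involutive])
    have hij' : inv i ≠ inv j := fun h' => hij (h.inv_injective h')
    obtain ⟨s, hs, hsω⟩ := hxs hc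
    obtain ⟨r, hr', hrω⟩ := hys hc'
    -- Forced by invariance of the form; it makes the same `x y x` monomial on the dual pair.
    have hsr : s * r = -1 := by
      have h1 := h.form_inv_ne_zero i
      have h2 := h.form_inv_ne_zero j
      have h3 : s * r * (ω (b (inv i)) (b i) * ω (b (inv j)) (b j)) =
          -1 * (ω (b (inv i)) (b i) * ω (b (inv j)) (b j)) := by
        linear_combination r * ω (b (inv i)) (b i) * hsω - ω (b (inv i)) (b i) * hrω
      exact mul_right_cancel₀ (mul_ne_zero h1 h2) h3
    rw [hr, Equiv.Perm.mul_apply]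
    by_cases hei' : e = inv i
    · refine ⟨s, ?_⟩
      rw [hei', Equiv.swap_apply_left, Equiv.swap_apply_of_ne_of_ne hc' hj, hs, map_add, map_smul,
        hr', hyi', map_add, map_smul, map_add, map_smul, hs, hxj']
      have : (1 + s * r) • (b (inv i) + s • b (inv j)) = 0 := by rw [hsr]; simp
      rw [← sub_eq_zero, ← this]
      module
    · by_cases hej' : e = inv j
      · refine ⟨r, ?_⟩
        rw [hej', Equiv.swap_apply_right, Equiv.swap_apply_of_ne_of_ne hi hc, hxj', hr', map_add,
          map_smul, hs, hxj']
        have : (1 + s * r) • b (inv j) = 0 := by rw [hsr]; simp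
        rw [← sub_eq_zero, ← this]
        module
      · rw [Equiv.swap_apply_of_ne_of_ne hei' hej']
        by_cases hei : e = i
        · exact ⟨-1, by rw [hei, Equiv.swap_apply_left, hni]⟩
        · by_cases hej : e = j
          · exact ⟨1, by rw [hej, Equiv.swap_apply_right, hnj]⟩
          · refine ⟨1, ?_⟩
            rw [Equiv.swap_apply_of_ne_of_ne hei hej, hxk e hej hei', hyk e hei hej',
              hxk e hej hei', one_smul]

open Classical in
-- The short root case: an `SO₃` computation on the span of `e_i`, `e_o` and `e_{inv i}`. The
-- product `x y x` exchanges the two isotropic lines and negates `e_o`.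
theorem exists_lift_reflection_fixed [CharZero K] (h : IsIsotropicBasis b ω inv)
    {A A' : Type*} [LinearOrder A] [LinearOrder A'] {σ : ι → A} {τ : ι → A'}
    (hσ : ∀ k l, σ k ≤ σ l → σ (inv l) ≤ σ (inv k)) (hτ : ∀ k l, τ k ≤ τ l → τ (inv l) ≤ τ (inv k))
    {P : Subgroup (V ≃ₗ[K] V)} (hPσ : flagGroup (Datum.form ω inv h) σ ≤ P)
    (hPτ : flagGroup (Datum.form ω inv h) τ ≤ P) (hP : P ≤ indGroup (Datum.form ω inv h)) {i o : ι}
    (hσio : σ i < σ o) (hτio : τ o < τ i) (ho : inv o = o) :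
    ∃ n ∈ P, IsLift (Datum.form ω inv h) (Equiv.swap i (inv i)) n := by
  have hio : i ≠ o := fun h => hσio.ne (h ▸ rfl)
  have hi : inv i ≠ i := fun h' => hio (h.fixed_unique i o h' ho)
  have hi'o : inv i ≠ o := fun h' => hio (h.inv_injective (h'.trans ho.symm))
  have hi' : inv (inv i) ≠ inv i := fun h' => hi (h.inv_injective h')
  have hω₀ : ω (b o) (b o) ≠ 0 := by
    have := h.form_ne_zero o
    rwa [ho] at this
  -- A fixed index has `ω(e_o, e_o) ≠ 0`, so the form is symmetric.
  obtain ⟨ε, hε, hsym⟩ := h.exists_sign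
  have hε1 : ε = 1 := by
    have h1 : (1 - ε) * ω (b o) (b o) = 0 := by linear_combination hsym (b o) (b o)
    have h2 := (mul_eq_zero.1 h1).resolve_right hω₀
    linear_combination -h2
  subst hε1
  simp only [one_mul] at hsym
  have hω₁ : ω (b i) (b (inv i)) ≠ 0 := h.form_ne_zero i
  set κ₀ := ω (b o) (b o) with hκ₀
  set κ₁ := ω (b i) (b (inv i)) with hκ₁
  have hκ₁' : ω (b (inv i)) (b i) = κ₁ := hsym _ _
  -- Chosen so that `e_{inv i} + e_o + q e_i` is isotropic.
  set q : K := -(κ₀ / (2 * κ₁)) with hq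
  have hq0 : q ≠ 0 := neg_ne_zero.2 (div_ne_zero hω₀ (mul_ne_zero two_ne_zero hω₁))
  have hqκ : 2 * q * κ₁ = -κ₀ := by
    rw [hq]
    field_simp
  have hoi : ω (b o) (b i) = 0 := h.isotropic o i (by rw [ho]; exact hio)
  have hio' : ω (b i) (b o) = 0 := by rw [hsym, hoi]
  have hoi' : ω (b o) (b (inv i)) = 0 := h.isotropic o (inv i) (by rw [ho]; exact hi'o)
  have hi'o' : ω (b (inv i)) (b o) = 0 := by rw [hsym, hoi']
  have hii : ω (b i) (b i) = 0 := h.form_basis_self hi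
  have hi'i' : ω (b (inv i)) (b (inv i)) = 0 := h.form_basis_self hi'
  have hσo : σ o ≤ σ (inv i) := by
    have := hσ _ _ hσio.le
    rwa [ho] at this
  have hτo : τ (inv i) ≤ τ o := by
    have := hτ _ _ hτio.le
    rwa [ho] at this
  obtain ⟨x, hx, hxj, hxj', hxk, hxs⟩ := exists_divisible_apply_eq_form h hσ
    (h.stable_quadruple i o) (i := inv i) (v := b (inv i) + b o + q • b i) (by simp) hi'
    (by simp [hi'o.symm, hi.symm]) (by
      intro k hk
      by_cases hki' : k = inv i
      · rw [hki']; exact ⟨by simp, le_rfl⟩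
      · by_cases hki : k = i
        · rw [hki]; exact ⟨by simp, hσio.le.trans hσo⟩
        · by_cases hko : k = o
          · rw [hko]; exact ⟨by simp, hσo⟩
          · simp [Ne.symm hki', Ne.symm hki, Ne.symm hko] at hk) (by
      simp only [map_add, map_smul, LinearMap.add_apply, LinearMap.smul_apply, smul_eq_mul, hoi,
        hio', hoi', hi'o', hii, hi'i', hκ₁']
      linear_combination hqκ)
  rw [h.involutive] at hxj'
  -- The image of `e_i` is `q⁻¹ (q e_i - e_o + e_{inv i})`; the opposite sign of `e_o` is what makes
  -- `x y x` monomial.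
  obtain ⟨y, hy, hyj, hyj', hyk, hys⟩ := exists_divisible_apply_eq_form h hτ
    (h.stable_quadruple i o) (i := i) (v := b i + (-q⁻¹) • b o + q⁻¹ • b (inv i)) (by simp) hi
    (by simp [hio.symm, hi]) (by
      intro k hk
      by_cases hki' : k = inv i
      · rw [hki']; exact ⟨by simp, hτo.trans hτio.le⟩
      · by_cases hki : k = i
        · rw [hki]; exact ⟨by simp, le_rfl⟩
        · by_cases hko : k = o
          · rw [hko]; exact ⟨by simp, hτio.le⟩
          · simp [Ne.symm hki', Ne.symm hki, Ne.symm hko] at hk) (by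
      simp only [map_add, map_smul, LinearMap.add_apply, LinearMap.smul_apply, smul_eq_mul, hoi,
        hio', hoi', hi'o', hii, hi'i', hκ₁']
      have : q⁻¹ * q = 1 := inv_mul_cancel₀ hq0
      linear_combination q⁻¹ * q⁻¹ * hqκ - 2 * q⁻¹ * κ₁ * this)
  have hxo : x (b o) = b o + (2 * q) • b i := by
    obtain ⟨s, hs⟩ := hxs o hi'o.symm
    rw [h.involutive] at hs
    have h1 := hx.1.1.1.2 (b o) (b (inv i))
    rw [hs, hxj] at h1
    simp only [map_add, map_smul, LinearMap.add_apply, LinearMap.smul_apply, smul_eq_mul, hoi,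
        hio', hoi', hii] at h1
    have h2 : s = 2 * q := mul_right_cancel₀ hω₁ (by linear_combination h1 - hqκ)
    rw [hs, h2]
  have hyo : y (b o) = b o + (-2 : K) • b (inv i) := by
    obtain ⟨s, hs⟩ := hys o hio.symm
    have h1 := hy.1.1.1.2 (b o) (b i)
    rw [hs, hyj] at h1
    simp only [map_add, map_smul, LinearMap.add_apply, LinearMap.smul_apply, smul_eq_mul, hoi,
        hi'o', hoi', hi'i', hκ₁'] at h1
    have : q⁻¹ * q = 1 := inv_mul_cancel₀ hq0
    have h2 : s = -2 := mul_right_cancel₀ hω₁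
      (by linear_combination h1 + q⁻¹ * hqκ - 2 * κ₁ * this)
    rw [hs, h2]
  have hxP := hPσ hx.1.1
  have hyP := hPτ hy.1.1
  have hn := mul_mem (mul_mem hxP hyP) hxP
  have hqq : q * q⁻¹ = 1 := mul_inv_cancel₀ hq0
  refine ⟨x * y * x, hn, isLift_of_forall (hP hn) fun e => ?_⟩
  rw [apply_mul_mul]
  by_cases hei : e = i
  · refine ⟨q⁻¹, ?_⟩
    rw [hei, Equiv.swap_apply_left, hxj', hyj, map_add, map_add, map_smul, map_smul, hxj', hxo, hxj]
    match_scalars <;> field_simp <;> ring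
  · by_cases hei' : e = inv i
    · refine ⟨q, ?_⟩
      rw [hei', Equiv.swap_apply_right, hxj, map_add y, map_add y, map_smul y, hyj', hyo, hyj]
      have : b (inv i) + (b o + (-2 : K) • b (inv i)) +
          q • (b i + (-q⁻¹) • b o + q⁻¹ • b (inv i)) = q • b i := by
        simp only [smul_add, smul_smul, mul_neg, hqq]
        module
      rw [this, map_smul, hxj']
    · rw [Equiv.swap_apply_of_ne_of_ne hei hei']
      by_cases heo : e = o
      · refine ⟨-1, ?_⟩
        rw [heo, hxo, map_add, map_smul, hyo, hyj]
        have : b o + (-2 : K) • b (inv i) + (2 * q) • (b i + (-q⁻¹) • b o + q⁻¹ • b (inv i)) =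
            (-1 : K) • b o + (2 * q) • b i := by
          simp only [smul_add, smul_smul, mul_neg, mul_assoc, hqq]
          module
        rw [this, map_add, map_smul, map_smul, hxo, hxj']
        module
      · refine ⟨1, ?_⟩
        have h1 : inv e ≠ i := fun h' => hei' (by rw [← h', h.involutive])
        have h2 : inv e ≠ inv i := fun h' => hei (h.inv_injective h')
        have h3 : inv e ≠ o := fun h' => heo (h.inv_injective (h'.trans ho.symm))
        have h4 : x (b e) = b e := hxk e hei' (by simp [h1.symm, h2.symm, h3.symm])
        rw [h4, hyk e hei (by simp [h1.symm, h2.symm, h3.symm]), h4, one_smul]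

end Reflection

/-! ### Weyl group elements with a lift in a given subgroup -/

section LiftGroup

variable {K : Type u} {V : Type v} {ι : Type w} [Field K] [AddCommGroup V] [Module K V]
  {b : Basis ι K V} {d : Datum b}

theorem IsLift.one (d : Datum b) : IsLift d 1 1 :=
  ⟨one_mem _, fun _ => ⟨1, one_ne_zero, (one_smul _ _).symm⟩⟩

theorem IsLift.mul {w w' : Equiv.Perm ι} {g g' : V ≃ₗ[K] V} (h : IsLift d w g)
    (h' : IsLift d w' g') : IsLift d (w * w') (g * g') := by
  refine isLift_of_forall (mul_mem h.1 h'.1) fun e => ?_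
  obtain ⟨c', -, hc'⟩ := h'.2 e
  obtain ⟨c, -, hc⟩ := h.2 (w' e)
  exact ⟨c' * c, by rw [LinearEquiv.mul_apply, hc', map_smul, hc, smul_smul, Equiv.Perm.mul_apply]⟩

theorem IsLift.inv {w : Equiv.Perm ι} {g : V ≃ₗ[K] V} (h : IsLift d w g) :
    IsLift d w⁻¹ g⁻¹ := by
  refine isLift_of_forall (inv_mem h.1) fun e => ?_
  obtain ⟨c, -, hc⟩ := h.2 (w⁻¹ e)
  rw [show w (w⁻¹ e) = e from w.apply_symm_apply e] at hc
  exact ⟨c⁻¹, inv_apply_of_apply_eq hc⟩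

theorem IsLift.unique {w w' : Equiv.Perm ι} {g : V ≃ₗ[K] V} (h : IsLift d w g)
    (h' : IsLift d w' g) : w = w' := by
  ext e
  obtain ⟨c, hc0, hc⟩ := h.2 e
  obtain ⟨c', -, hc'⟩ := h'.2 e
  by_contra hne
  have := congrArg (fun x => b.repr x (w e)) (hc.symm.trans hc')
  simp [Ne.symm hne, hc0] at this

theorem IsLift.mem_weylGroup {w : Equiv.Perm ι} {g : V ≃ₗ[K] V} (h : IsLift d w g) :
    w ∈ weylGroup d := by
  obtain ⟨w', hw'⟩ := exists_weyl_of_monomial h.1 fun e => by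
    obtain ⟨c, -, hc⟩ := h.2 e
    exact ⟨_, c, hc⟩
  rw [h.unique hw']
  exact w'.2

/-- The Weyl group elements with a lift in `P`. -/
def liftableGroup (d : Datum b) (P : Subgroup (V ≃ₗ[K] V)) : Subgroup (Equiv.Perm ι) where
  carrier := {w | ∃ n ∈ P, IsLift d w n}
  one_mem' := ⟨1, one_mem _, .one d⟩
  mul_mem' := by
    rintro w w' ⟨n, hn, h⟩ ⟨n', hn', h'⟩
    exact ⟨n * n', mul_mem hn hn', h.mul h'⟩
  inv_mem' := by
    rintro w ⟨n, hn, h⟩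
    exact ⟨n⁻¹, inv_mem hn, h.inv⟩

theorem liftableGroup_le_weylGroup {P : Subgroup (V ≃ₗ[K] V)} :
    liftableGroup d P ≤ weylGroup d := by
  rintro w ⟨n, -, h⟩
  exact h.mem_weylGroup

/-- Two lifts of the same `w` differ by an element of the Cartan subgroup, so one lift in `P` puts
all of them there. -/
theorem mem_of_isLift {P : Subgroup (V ≃ₗ[K] V)} (hP : cartan d ≤ P) {w : Equiv.Perm ι}
    (hw : w ∈ liftableGroup d P) {g : V ≃ₗ[K] V} (hg : IsLift d w g) : g ∈ P := by
  obtain ⟨n, hn, h⟩ := hw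
  have h1 := hg.mul h.inv
  rw [mul_inv_cancel] at h1
  have h2 : g * n⁻¹ ∈ cartan d := ⟨h1.1, fun i => by
    obtain ⟨c, -, hc⟩ := h1.2 i
    exact ⟨c, hc⟩⟩
  have h3 := mul_mem (hP h2) hn
  rwa [inv_mul_cancel_right] at h3

theorem weylGroup_le_finitaryPerm (d : Datum b) : weylGroup d ≤ finitaryPerm ι := by
  cases d with
  | gl => exact le_rfl
  | form ω inv h => exact inf_le_left

/-- Conjugating by a lift of `w` carries the stabilizer of `σ` to that of `σ ∘ w⁻¹`. This gives `P`
the second order needed for opposite root elements. -/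
theorem flagGroup_comp_inv_le {P : Subgroup (V ≃ₗ[K] V)} {A : Type*} [LinearOrder A] {σ : ι → A}
    (hP : flagGroup d σ ≤ P) {w : Equiv.Perm ι} (hw : w ∈ liftableGroup d P) :
    flagGroup d (fun i => σ (w⁻¹ i)) ≤ P := by
  obtain ⟨n, hn, hl⟩ := hw
  intro g hg
  have h1 : n⁻¹ * g * n ∈ flagGroup d σ := by
    refine ⟨mul_mem (mul_mem (inv_mem hl.1) hg.1) hl.1, fun j => ?_⟩
    obtain ⟨c, -, hc⟩ := hl.2 j
    rw [LinearEquiv.mul_apply, hc, map_smul]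
    refine Submodule.smul_mem _ _ ?_
    have h2 : (Submodule.span K (b '' {i | σ (w⁻¹ i) ≤ σ j})).map
        ((n⁻¹ : V ≃ₗ[K] V) : V →ₗ[K] V) ≤ Submodule.span K (b '' {i | σ i ≤ σ j}) := by
      refine map_coordSpan_le_iff.2 fun i hi => ?_
      obtain ⟨c', -, hc'⟩ := hl.inv.2 i
      rw [hc']
      exact Submodule.smul_mem _ _ (basis_mem_coordSpan.2 hi)
    refine h2 ⟨g (b (w j)), ?_, rfl⟩
    have h3 := hg.2 (w j)
    beta_reduce at h3
    rwa [show w⁻¹ (w j) = j from w.symm_apply_apply j] at h3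
  have h4 := mul_mem (mul_mem hn (hP h1)) (inv_mem hn)
  rwa [mul_assoc n⁻¹ g n, mul_inv_cancel_left, mul_inv_cancel_right] at h4

end LiftGroup

/-! ### Action and conjugation of reflections commuting with the involution -/

section ReflectionAction

variable {ι : Type w} {inv : ι → ι}

open Classical in
theorem involutiveReflection_of_inv {i j : ι} (hij : inv i = j) :
    involutiveReflection inv i j = Equiv.swap i j := if_pos hij

open Classical in
theorem involutiveReflection_of_fixed_right
    (huniq : ∀ i j, inv i = i → inv j = j → i = j) {i j : ι} (hj : inv j = j) :
    involutiveReflection inv i j = Equiv.swap i (inv i) := by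
  by_cases hij : inv i = j
  · rw [involutiveReflection_of_inv hij, hij]
  · by_cases hi : inv i = i
    · exact absurd (hi.trans (huniq i j hi hj)) hij
    · exact (if_neg hij).trans ((if_neg hi).trans (if_pos hj))

open Classical in
theorem involutiveReflection_of_fixed_left {i j : ι} (hi : inv i = i) :
    involutiveReflection inv i j = Equiv.swap j (inv j) := by
  by_cases hij : inv i = j
  · have : i = j := hi.symm.trans hij
    subst this
    rw [involutiveReflection_of_inv hij, hij]
  · exact (if_neg hij).trans (if_pos hi)

open Classical in
theorem involutiveReflection_of_ne {i j : ι} (hij : inv i ≠ j) (hi : inv i ≠ i) (hj : inv j ≠ j) :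
    involutiveReflection inv i j = Equiv.swap i j * Equiv.swap (inv i) (inv j) :=
  (if_neg hij).trans ((if_neg hi).trans (if_neg hj))

theorem involutiveReflection_apply_left (hinv : Function.Involutive inv) {i j : ι} (hi : inv i ≠ i)
    (hj : inv j ≠ j) : involutiveReflection inv i j i = j := by
  classical
  by_cases hij : inv i = j
  · rw [involutiveReflection_of_inv hij, Equiv.swap_apply_left]
  · have hji : inv j ≠ i := fun h => hij (by rw [← h, hinv])
    rw [involutiveReflection_of_ne hij hi hj, Equiv.Perm.mul_apply,
      Equiv.swap_apply_of_ne_of_ne hi.symm hji.symm, Equiv.swap_apply_left]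

theorem involutiveReflection_apply_of_ne {i j k : ι} (h1 : k ≠ i) (h2 : k ≠ j)
    (h3 : k ≠ inv i) (h4 : k ≠ inv j) : involutiveReflection inv i j k = k := by
  classical
  unfold involutiveReflection
  split_ifs
  · exact Equiv.swap_apply_of_ne_of_ne h1 h2
  · exact Equiv.swap_apply_of_ne_of_ne h2 h4
  · exact Equiv.swap_apply_of_ne_of_ne h1 h3
  · rw [Equiv.Perm.mul_apply, Equiv.swap_apply_of_ne_of_ne h3 h4,
      Equiv.swap_apply_of_ne_of_ne h1 h2]

theorem involutiveReflection_comm (hinv : Function.Involutive inv)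
    (huniq : ∀ i j, inv i = i → inv j = j → i = j) (i j : ι) :
    involutiveReflection inv i j = involutiveReflection inv j i := by
  classical
  by_cases hi : inv i = i
  · rw [involutiveReflection_of_fixed_left hi, involutiveReflection_of_fixed_right huniq hi]
  · by_cases hj : inv j = j
    · rw [involutiveReflection_of_fixed_left hj, involutiveReflection_of_fixed_right huniq hj]
    · by_cases hij : inv i = j
      · rw [involutiveReflection_of_inv hij,
          involutiveReflection_of_inv (show inv j = i by rw [← hij, hinv]), Equiv.swap_comm]
      · have hji : inv j ≠ i := fun h => hij (by rw [← h, hinv])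
        rw [involutiveReflection_of_ne hij hi hj, involutiveReflection_of_ne hji hj hi,
          Equiv.swap_comm, Equiv.swap_comm (inv i)]

theorem involutiveReflection_self (inv : ι → ι) (i : ι) : involutiveReflection inv i i = 1 := by
  classical
  by_cases hi : inv i = i
  · rw [involutiveReflection_of_inv hi, Equiv.swap_self]; rfl
  · rw [involutiveReflection_of_ne hi hi hi, Equiv.swap_self, Equiv.swap_self]; rfl

theorem involutiveReflection_inv_inv (hinv : Function.Involutive inv)
    (huniq : ∀ i j, inv i = i → inv j = j → i = j) (i j : ι) :
    involutiveReflection inv (inv i) (inv j) = involutiveReflection inv i j := by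
  classical
  by_cases hi : inv i = i
  · rw [involutiveReflection_of_fixed_left hi, hi, involutiveReflection_of_fixed_left hi, hinv,
      Equiv.swap_comm]
  · by_cases hj : inv j = j
    · rw [involutiveReflection_of_fixed_right huniq hj, hj,
        involutiveReflection_of_fixed_right huniq hj, hinv, Equiv.swap_comm]
    · have hi' : inv (inv i) ≠ inv i := fun h => hi (hinv.injective h)
      have hj' : inv (inv j) ≠ inv j := fun h => hj (hinv.injective h)
      by_cases hij : inv i = j
      · rw [involutiveReflection_of_inv hij, involutiveReflection_of_inv (by rw [hij]),
          ← hij, hinv, Equiv.swap_comm]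
      · rw [involutiveReflection_of_ne hij hi hj,
          involutiveReflection_of_ne (fun h => hij (hinv.injective h)) hi' hj', hinv, hinv]
        have hji : inv j ≠ i := fun h => hij (by rw [← h, hinv])
        have := Equiv.swap_apply_apply (Equiv.swap (inv i) (inv j)) i j
        rw [Equiv.swap_apply_of_ne_of_ne (Ne.symm hi) hji.symm,
          Equiv.swap_apply_of_ne_of_ne (Ne.symm hij) (Ne.symm hj)] at this
        conv_rhs => rw [this]
        rw [inv_mul_cancel_right]

theorem involutiveReflection_conj {w : Equiv.Perm ι} (hw : ∀ i, w (inv i) = inv (w i)) (i j : ι) :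
    involutiveReflection inv (w i) (w j) = w * involutiveReflection inv i j * w⁻¹ := by
  classical
  have hs : ∀ x y, Equiv.swap (w x) (w y) = w * Equiv.swap x y * w⁻¹ :=
    fun x y => Equiv.swap_apply_apply w x y
  unfold involutiveReflection
  simp only [← hw, w.injective.eq_iff, hs]
  split_ifs <;> group

end ReflectionAction

/-! ### Reflections liftable to a group containing a full flag stabilizer -/

section ReflectionRelation

variable {K : Type u} {V : Type v} {ι : Type w} [Field K] [AddCommGroup V] [Module K V]
  {b : Basis ι K V} {d : Datum b} {P : Subgroup (V ≃ₗ[K] V)}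
  {A : Type*} [LinearOrder A] {σ : ι → A}

theorem reflection_form {ω : LinearMap.BilinForm K V} {inv : ι → ι}
    (h : IsIsotropicBasis b ω inv) (i j : ι) :
    reflection (Datum.form ω inv h) i j = involutiveReflection inv i j := rfl

/-- A pair of indices whose order is reversed by an element of the Weyl group with a lift in `P`
gives a reflection with a lift in `P`. -/
theorem reflection_mem_liftableGroup [CharZero K] (hσi : Function.Injective σ)
    (hσ : IsFlagMap d σ) (hσP : flagGroup d σ ≤ P) (hP : P ≤ indGroup d) {w : Equiv.Perm ι}
    (hw : w ∈ liftableGroup d P) {i j : ι} (hij : σ i < σ j) (hji : σ (w⁻¹ j) < σ (w⁻¹ i)) :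
    reflection d i j ∈ liftableGroup d P := by
  classical
  have hτP := flagGroup_comp_inv_le hσP hw
  cases d with
  | gl => exact exists_lift_reflection_gl hσP hτP hP hij hji
  | form ω inv h =>
    have hwinv : ∀ k, w⁻¹ (inv k) = inv (w⁻¹ k) :=
      (inv_mem (liftableGroup_le_weylGroup hw) : w⁻¹ ∈ weylGroup (Datum.form ω inv h)).2
    have hanti := hσ.antitone_inv
    have hanti' : ∀ k l, σ (w⁻¹ k) ≤ σ (w⁻¹ l) → σ (w⁻¹ (inv l)) ≤ σ (w⁻¹ (inv k)) := by
      intro k l hkl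
      rw [hwinv, hwinv]
      exact hanti _ _ hkl
    have hlt : ∀ {k l}, σ k < σ l → σ (inv l) < σ (inv k) := fun {k l} hkl =>
      lt_of_le_of_ne (hanti _ _ hkl.le) fun h' =>
        hkl.ne (congrArg σ (h.inv_injective (hσi h')).symm)
    have hlt' : ∀ {k l}, σ (w⁻¹ k) < σ (w⁻¹ l) → σ (w⁻¹ (inv l)) < σ (w⁻¹ (inv k)) :=
      fun {k l} hkl => by
        rw [hwinv, hwinv]
        exact hlt hkl
    have hfix : ∀ {k o}, σ k < σ o → σ (w⁻¹ o) < σ (w⁻¹ k) → inv o = o →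
        Equiv.swap k (inv k) ∈ liftableGroup (Datum.form ω inv h) P := fun {k o} h1 h2 ho =>
      exists_lift_reflection_fixed h hanti hanti' hσP hτP hP h1 h2 ho
    by_cases hi : inv i = i
    · have h1 := hlt hij
      have h2 := hlt' hji
      rw [hi] at h1 h2
      have := hfix h1 h2 hi
      rw [h.involutive, Equiv.swap_comm] at this
      rwa [reflection_form, involutiveReflection_of_fixed_left hi]
    · by_cases hj : inv j = j
      · rw [reflection_form, involutiveReflection_of_fixed_right h.fixed_unique hj]
        exact hfix hij hji hj
      -- The condition can fail only for a symmetric form with `j = inv i`, where the pair itself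
      -- gives no root. The fixed index `o` then lies strictly between `i` and `inv i` in both
      -- orders, and the short root pair `i`, `o` provides the same swap.
      · by_cases hiso : inv i = j → ω (b i) (b j) + ω (b j) (b i) = 0
        · exact exists_lift_reflection_of_ne h hanti hanti' hσP hτP hP hij hji hi hj hiso
        · obtain ⟨hc, hne⟩ := Classical.not_imp.1 hiso
          rcases h.form_type with ha | ⟨-, o, ho⟩
          · exact absurd (by rw [← ha.neg_eq]; simp) hne
          · subst hc
            have h1 : σ i < σ o := by
              by_contra hcon
              have h3 := hanti _ _ (not_lt.1 hcon)
              rw [ho] at h3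
              exact absurd (hij.trans_le (h3.trans (not_lt.1 hcon))) (lt_irrefl _)
            have h2 : σ (w⁻¹ o) < σ (w⁻¹ i) := by
              by_contra hcon
              have h3 := hanti' _ _ (not_lt.1 hcon)
              rw [ho] at h3
              exact absurd (hji.trans_le ((not_lt.1 hcon).trans h3)) (lt_irrefl _)
            rw [reflection_form, involutiveReflection_of_inv rfl]
            exact hfix h1 h2 ho

theorem reflection_self (d : Datum b) (i : ι) : reflection d i i = 1 := by
  classical
  cases d with
  | gl => exact Equiv.swap_self i
  | form ω inv h => exact involutiveReflection_self inv i

theorem reflection_comm (d : Datum b) (i j : ι) : reflection d i j = reflection d j i := by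
  classical
  cases d with
  | gl => exact Equiv.swap_comm i j
  | form ω inv h => exact involutiveReflection_comm h.involutive h.fixed_unique i j

theorem reflection_conj {w : Equiv.Perm ι} (hw : w ∈ weylGroup d) (i j : ι) :
    reflection d (w i) (w j) = w * reflection d i j * w⁻¹ := by
  classical
  cases d with
  | gl => exact Equiv.swap_apply_apply w i j
  | form ω inv h => exact involutiveReflection_conj hw.2 i j

theorem reflection_apply_mem {w : Equiv.Perm ι} (hw : w ∈ liftableGroup d P) {i j : ι}
    (h : reflection d i j ∈ liftableGroup d P) :
    reflection d (w i) (w j) ∈ liftableGroup d P := by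
  rw [reflection_conj (liftableGroup_le_weylGroup hw)]
  exact mul_mem (mul_mem hw h) (inv_mem hw)

/-- Conjugating one of the given reflections by the other normally produces `s_{ik}`. When duality
or the fixed index interferes, an element reversing the order of `i` and `k` is exhibited instead
(`star`). -/
theorem reflection_trans [CharZero K] (hσi : Function.Injective σ)
    (hσ : IsFlagMap d σ) (hσP : flagGroup d σ ≤ P) (hP : P ≤ indGroup d) {i j k : ι}
    (hij : reflection d i j ∈ liftableGroup d P) (hjk : reflection d j k ∈ liftableGroup d P) :
    reflection d i k ∈ liftableGroup d P := by
  classical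
  by_cases h1 : i = j
  · rwa [h1]
  by_cases h2 : j = k
  · rwa [← h2]
  by_cases h3 : i = k
  · rw [h3, reflection_self]
    exact one_mem _
  have conj : ∀ {w i j i' j'}, w ∈ liftableGroup d P → reflection d i j ∈ liftableGroup d P →
      w i = i' → w j = j' → reflection d i' j' ∈ liftableGroup d P := by
    rintro w i j _ _ hw h rfl rfl
    exact reflection_apply_mem hw h
  cases d with
  | gl =>
    exact conj hij hjk (Equiv.swap_apply_right i j)
      (Equiv.swap_apply_of_ne_of_ne (Ne.symm h3) (Ne.symm h2))
  | form ω inv h =>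
    have star : ∀ {w i j}, w ∈ liftableGroup (Datum.form ω inv h) P → σ i < σ j →
        σ (w j) < σ (w i) → reflection (Datum.form ω inv h) i j ∈
          liftableGroup (Datum.form ω inv h) P := fun {w i j} hw h4 h5 =>
      reflection_mem_liftableGroup hσi hσ hσP hP (inv_mem hw) h4 (by rwa [inv_inv])
    have hanti := hσ.antitone_inv
    have hfixw : ∀ {w i}, w ∈ liftableGroup (Datum.form ω inv h) P → inv i = i → w i = i := by
      intro w i hw hi
      refine h.fixed_unique _ _ ?_ hi
      rw [← (liftableGroup_le_weylGroup hw).2, hi]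
    have hout : ∀ {i j k}, inv i ≠ i → inv j ≠ j → k ≠ i → k ≠ j → k ≠ inv i → k ≠ inv j →
        reflection (Datum.form ω inv h) i j k = k := fun _ _ h1 h2 h3 h4 =>
      involutiveReflection_apply_of_ne h1 h2 h3 h4
    have hleft : ∀ {i j}, inv i ≠ i → inv j ≠ j → reflection (Datum.form ω inv h) i j i = j :=
      involutiveReflection_apply_left h.involutive
    have hright : ∀ {i j}, inv i ≠ i → inv j ≠ j → reflection (Datum.form ω inv h) i j j = i := by
      intro i j hi hj
      rw [reflection_comm, hleft hj hi]
    have hfixed : ∀ {o i}, inv o = o → reflection (Datum.form ω inv h) o i =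
        reflection (Datum.form ω inv h) i (inv i) := fun {o i} ho =>
      (involutiveReflection_of_fixed_left ho).trans (involutiveReflection_of_inv rfl).symm
    by_cases hi : inv i = i
    · have hj : inv j ≠ j := fun hj => h1 (h.fixed_unique _ _ hi hj)
      have hk : inv k ≠ k := fun hk => h3 (h.fixed_unique _ _ hi hk)
      exact conj hjk hij (hfixw hjk hi) (hleft hj hk)
    by_cases hk : inv k = k
    · have hj : inv j ≠ j := fun hj => h2 (h.fixed_unique _ _ hj hk)
      exact conj hij hjk (hright hi hj) (hfixw hij hk)
    -- The hypotheses only say that the sign changes at `i` and at `k` are liftable; one of them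
    -- moves its index past the other.
    by_cases hj : inv j = j
    · rw [reflection_comm, hfixed hj] at hij
      rw [hfixed hj] at hjk
      by_cases hik : k = inv i
      · rwa [hik]
      have hki : inv k ≠ i := fun h' => hik (by rw [← h', h.involutive])
      have hi' : inv (inv i) ≠ inv i := fun h' => hi (h.inv_injective h')
      have hk' : inv (inv k) ≠ inv k := fun h' => hk (h.inv_injective h')
      have key : ∀ {i k}, inv i ≠ i → inv k ≠ k → i ≠ k → k ≠ inv i →
          reflection (Datum.form ω inv h) i (inv i) ∈ liftableGroup (Datum.form ω inv h) P →
          reflection (Datum.form ω inv h) k (inv k) ∈ liftableGroup (Datum.form ω inv h) P →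
          σ i < σ k → reflection (Datum.form ω inv h) i k ∈
            liftableGroup (Datum.form ω inv h) P := by
        intro i k hi hk hne hki hri hrk hik
        have hi' : inv (inv i) ≠ inv i := fun h' => hi (h.inv_injective h')
        have hk' : inv (inv k) ≠ inv k := fun h' => hk (h.inv_injective h')
        have hki' : inv k ≠ i := fun h' => hki (by rw [← h', h.involutive])
        -- If `k` lies below `inv i`, the sign change at `i` lifts `i` over `k`. Otherwise `inv k`
        -- lies below `i` by duality, and the sign change at `k` brings `k` under `i`.
        rcases lt_or_ge (σ k) (σ (inv i)) with hlt | hle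
        · refine star hri hik ?_
          rw [hleft hi hi', hout hi hi' hne.symm hki hki (by rw [h.involutive]; exact hne.symm)]
          exact hlt
        · have h5 := hanti _ _ hle
          rw [h.involutive] at h5
          refine star hrk hik ?_
          rw [hleft hk hk', hout hk hk' hne hki'.symm hki'.symm (by rw [h.involutive]; exact hne)]
          exact lt_of_le_of_ne h5 fun h' => hki' (hσi h')
      rcases lt_or_gt_of_ne (fun h' => h3 (hσi h')) with hlt | hlt
      · exact key hi hk h3 hik hij hjk hlt
      · rw [reflection_comm]
        exact key hk hi (Ne.symm h3) hki.symm hjk hij hlt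
    by_cases hkj : k = inv j
    · subst hkj
      have hj' : inv (inv j) ≠ inv j := hk
      have hij' : i ≠ inv j := h3
      exact conj hjk hij (hout hj hj' h1 hij' hij' (by rwa [h.involutive])) (hleft hj hj')
    by_cases hki : k = inv i
    · subst hki
      have hji : inv i ≠ j := Ne.symm h2
      have hji' : inv j ≠ i := fun h' => hji (by rw [← h', h.involutive])
      have hinv : ∀ {w}, w ∈ liftableGroup (Datum.form ω inv h) P → ∀ l, w (inv l) = inv (w l) :=
        fun hw => (liftableGroup_le_weylGroup hw).2
      -- The product of the two reflections exchanges `i` and `inv i`, hence reverses this pair.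
      have hp := mul_mem hij hjk
      have e1 : (reflection (Datum.form ω inv h) i j * reflection (Datum.form ω inv h) j (inv i))
          (inv i) = i := by
        rw [Equiv.Perm.mul_apply, hright hj hk, hright hi hj]
      have e2 : (reflection (Datum.form ω inv h) i j * reflection (Datum.form ω inv h) j (inv i))
          i = inv i := by
        have := hinv hp (inv i)
        rwa [h.involutive, e1] at this
      rcases lt_or_gt_of_ne (fun h' => h3 (hσi h')) with hlt | hlt
      · exact star hp hlt (by rwa [e1, e2])
      · rw [reflection_comm]
        exact star hp hlt (by rwa [e1, e2])
    · by_cases hij' : j = inv i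
      · subst hij'
        exact conj hij hjk (hright hi hj)
          (hout hi hj (Ne.symm h3) hki hki (by rw [h.involutive]; exact Ne.symm h3))
      · exact conj hij hjk (hright hi hj) (hout hi hj (Ne.symm h3) (Ne.symm h2) hki hkj)

end ReflectionRelation

/-! ### Parabolic subgroups are flag stabilizers -/

theorem exists_linearOrder_of_preorder {ι : Type w} {r : ι → ι → Prop} (hrefl : ∀ i, r i i)
    (htrans : ∀ i j k, r i j → r j k → r i k) (htotal : ∀ i j, r i j ∨ r j i) :
    ∃ (A : Type w) (_ : LinearOrder A) (σ : ι → A), Function.Surjective σ ∧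
      ∀ i j, σ i ≤ σ j ↔ r i j := by
  classical
  let _ : Preorder ι := { le := r, le_refl := hrefl, le_trans := htrans }
  have : Std.Total (α := ι) (· ≤ ·) := ⟨htotal⟩
  exact ⟨Antisymmetrization ι (· ≤ ·), inferInstance, toAntisymmetrization (· ≤ ·),
    Quotient.mk_surjective, fun i j => toAntisymmetrization_le_toAntisymmetrization_iff⟩

section Parabolic

variable {K : Type u} {V : Type v} {ι : Type w} [Field K] [AddCommGroup V] [Module K V]
  {b : Basis ι K V} {d : Datum b} {P : Subgroup (V ≃ₗ[K] V)}

/-- Passing to one admissible level reduces this to the finite elimination. -/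
theorem exists_isLift_mul_mul [CharZero K] {A A' : Type*} [LinearOrder A] [LinearOrder A']
    {σ : ι → A} {τ : ι → A'} (hσi : Function.Injective σ) (hτi : Function.Injective τ)
    (hσ : IsFlagMap d σ) (hτ : IsFlagMap d τ) {g : V ≃ₗ[K] V} (hg : g ∈ indGroup d) :
    ∃ u ∈ flagGroup d σ, ∃ u' ∈ flagGroup d τ, ∃ w : weylGroup d,
      IsLift d (w : Equiv.Perm ι) (u * g * u') := by
  obtain ⟨I, hI, -, hgI⟩ := exists_admissible_levelGroup d ∅ hg
  obtain ⟨u, hu, u', hu', hmon⟩ := exists_bruhat d hσi hτi hσ hτ hI hg hgI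
  have h1 := (unipotentGroup_le hu).1
  have h2 := (unipotentGroup_le hu').1
  exact ⟨u, h1, u', h2, exists_weyl_of_monomial (mul_mem (mul_mem h1.1 hg) h2.1) hmon⟩

/-- Antitonicity makes `inv` compatible with the fibres of `σ`, so it descends to an order-reversing
involution. -/
theorem isFlagMap_form_of_antitone {ω : LinearMap.BilinForm K V} {inv : ι → ι}
    (h : IsIsotropicBasis b ω inv) {A : Type*} [LinearOrder A] {σ : ι → A}
    (hσ : Function.Surjective σ) (hanti : ∀ i j, σ i ≤ σ j → σ (inv j) ≤ σ (inv i)) :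
    IsFlagMap (Datum.form ω inv h) σ := by
  have heq : ∀ i j, σ i = σ j → σ (inv i) = σ (inv j) := fun i j hij =>
    le_antisymm (hanti _ _ hij.ge) (hanti _ _ hij.le)
  have hout : ∀ e, σ (inv (Function.surjInv hσ (σ e))) = σ (inv e) := fun e =>
    heq _ _ (Function.surjInv_eq hσ _)
  have hinvol : Function.Involutive fun α => σ (inv (Function.surjInv hσ α)) := by
    intro α
    obtain ⟨e, rfl⟩ := hσ α
    simp only [hout, h.involutive e]
  have hmono : Antitone fun α => σ (inv (Function.surjInv hσ α)) := by
    intro α β hαβ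
    obtain ⟨i, rfl⟩ := hσ α
    obtain ⟨j, rfl⟩ := hσ β
    simp only [hout]
    exact hanti _ _ hαβ
  exact ⟨hσ, _, hinvol, hmono.strictAnti_of_injective hinvol.injective, fun e => (hout e).symm⟩

variable {A : Type*} [LinearOrder A] {σ : ι → A}

theorem exists_order_reversed (hσi : Function.Injective σ) (hσ : IsFlagMap d σ) {i j : ι}
    (hij : σ i < σ j) (hX : reflection d i j ∈ liftableGroup d P) :
    ∃ w ∈ liftableGroup d P, σ (w j) < σ (w i) := by
  classical
  refine ⟨_, hX, ?_⟩
  cases d with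
  | gl =>
    change σ (Equiv.swap i j j) < σ (Equiv.swap i j i)
    rwa [Equiv.swap_apply_left, Equiv.swap_apply_right]
  | form ω inv h =>
    have hlt : ∀ {k l}, σ k < σ l → σ (inv l) < σ (inv k) := fun {k l} hkl =>
      lt_of_le_of_ne (hσ.antitone_inv _ _ hkl.le) fun h' =>
        hkl.ne (congrArg σ (h.inv_injective (hσi h')).symm)
    have hne : i ≠ j := fun h' => hij.ne (congrArg σ h')
    have hij' := hlt hij
    by_cases hi : inv i = i
    · rw [reflection_form, involutiveReflection_of_fixed_left hi, Equiv.swap_apply_left,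
        Equiv.swap_apply_of_ne_of_ne hne fun h' =>
          hne (h.inv_injective (hi.trans h'))]
      rwa [hi] at hij'
    · by_cases hj : inv j = j
      · rw [reflection_form, involutiveReflection_of_fixed_right h.fixed_unique hj,
          Equiv.swap_apply_left, Equiv.swap_apply_of_ne_of_ne hne.symm fun h' =>
            hne (h.inv_injective (by rw [hj, h']))]
        rwa [hj] at hij'
      · have h1 : reflection (Datum.form ω inv h) i j i = j :=
          involutiveReflection_apply_left h.involutive hi hj
        have h2 : reflection (Datum.form ω inv h) i j j = i := by
          rw [reflection_comm]
          exact involutiveReflection_apply_left h.involutive hj hi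
        rwa [h1, h2]

/-- After composition with this reflection, `w` fixes `i` as well as all its former fixed points:
the descent step of `mem_liftableGroup_of_flagLE`. -/
theorem reflection_apply_self {w : Equiv.Perm ι} (hw : w ∈ weylGroup d) {i : ι} (hi : w i ≠ i) :
    reflection d i (w i) (w i) = i ∧ ∀ k, w k = k → reflection d i (w i) k = k := by
  classical
  have hk : ∀ k, w k = k → k ≠ i ∧ k ≠ w i := fun k hk =>
    ⟨fun h => hi (h ▸ hk), fun h => hi (by rw [← h]; exact w.injective (hk.trans h))⟩
  cases d with
  | gl =>
    exact ⟨Equiv.swap_apply_right _ _, fun k h =>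
      Equiv.swap_apply_of_ne_of_ne (hk k h).1 (hk k h).2⟩
  | form ω inv h =>
    have hinv : ∀ k, w (inv k) = inv (w k) := hw.2
    have h1 : inv i ≠ i := fun h1 =>
      hi (h.fixed_unique _ _ (by rw [← hinv, h1]) h1)
    have h2 : inv (w i) ≠ w i := fun h2 => h1 (w.injective (by rw [hinv, h2]))
    refine ⟨?_, fun k hwk => ?_⟩
    · rw [reflection_comm]
      exact involutiveReflection_apply_left h.involutive h2 h1
    · have h3 := hk (inv k) (by rw [hinv, hwk])
      exact involutiveReflection_apply_of_ne (hk k hwk).1 (hk k hwk).2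
        (fun h' => h3.1 (by rw [h', h.involutive])) (fun h' => h3.2 (by rw [h', h.involutive]))

/-- The preorder of the flag stabilized by a group containing the stabilizer of `σ`. -/
def FlagLE (d : Datum b) (P : Subgroup (V ≃ₗ[K] V)) (σ : ι → A) (i j : ι) : Prop :=
  σ i ≤ σ j ∨ reflection d i j ∈ liftableGroup d P

section

variable [CharZero K] (hσi : Function.Injective σ) (hσ : IsFlagMap d σ) (hσP : flagGroup d σ ≤ P)
  (hP : P ≤ indGroup d)

include hσi hσ hσP hP

/-- An element reversing `i` and `k` must reverse `i`, `j` or `j`, `k`; in the second case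
transitivity finishes. -/
theorem reflection_mem_of_between {i j k : ι} (hij : σ i < σ j) (hjk : σ j < σ k)
    (hik : reflection d i k ∈ liftableGroup d P) : reflection d i j ∈ liftableGroup d P := by
  obtain ⟨w, hw, hlt⟩ := exists_order_reversed hσi hσ (hij.trans hjk) hik
  rcases lt_or_ge (σ (w j)) (σ (w i)) with h | h
  · exact reflection_mem_liftableGroup hσi hσ hσP hP (inv_mem hw) hij (by rwa [inv_inv])
  · have := reflection_mem_liftableGroup hσi hσ hσP hP (inv_mem hw) hjk
      (by rw [inv_inv]; exact hlt.trans_le h)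
    exact reflection_trans hσi hσ hσP hP hik (by rwa [reflection_comm])

theorem FlagLE.trans {i j k : ι} (hij : FlagLE d P σ i j) (hjk : FlagLE d P σ j k) :
    FlagLE d P σ i k := by
  rcases le_or_gt (σ i) (σ k) with h | h
  · exact Or.inl h
  rcases hij with hij | hij <;> rcases hjk with hjk | hjk
  · exact Or.inl (hij.trans hjk)
  · right
    rcases hij.lt_or_eq with hij | hij
    · rw [reflection_comm] at hjk ⊢
      exact reflection_mem_of_between hσi hσ hσP hP h hij hjk
    · rwa [hσi hij]
  · right
    rcases hjk.lt_or_eq with hjk | hjk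
    · refine reflection_trans hσi hσ hσP hP hij ?_
      rw [reflection_comm] at hij
      exact reflection_mem_of_between hσi hσ hσP hP hjk h hij
    · rwa [← hσi hjk]
  · exact Or.inr (reflection_trans hσi hσ hσP hP hij hjk)

/-- A liftable `w` keeps strict inequalities between classes. If `w i` were not below `i`, then `w`
would map the indices not below `i` into themselves, hence onto themselves by finitariness, yet `w
i` is the image of `i`, which is not among them. -/
theorem FlagLE.apply {w : Equiv.Perm ι} (hw : w ∈ liftableGroup d P) (i : ι) :
    FlagLE d P σ (w i) i := by
  have hmono : ∀ x y, FlagLE d P σ x i → ¬ FlagLE d P σ y i → σ (w x) < σ (w y) := by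
    intro x y hx hy
    have hyx : ¬ FlagLE d P σ y x := fun h => hy (h.trans hσi hσ hσP hP hx)
    have hlt : σ x < σ y := not_le.1 fun h => hyx (Or.inl h)
    refine lt_of_le_of_ne (not_lt.1 fun h => hyx (Or.inr ?_)) fun h =>
      hlt.ne (congrArg σ (w.injective (hσi h)))
    rw [reflection_comm]
    exact reflection_mem_liftableGroup hσi hσ hσP hP (inv_mem hw) hlt (by rwa [inv_inv])
  by_contra hcon
  have hmaps : ∀ y, ¬ FlagLE d P σ y i → ¬ FlagLE d P σ (w y) i := fun y hy hwy =>
    hcon (FlagLE.trans hσi hσ hσP hP (Or.inl (hmono i y (Or.inl le_rfl) hy).le) hwy)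
  let f : {y // ¬ FlagLE d P σ y i} → {y // ¬ FlagLE d P σ y i} := fun y => ⟨w y, hmaps y y.2⟩
  have hf : Function.Injective f := fun x y h =>
    Subtype.ext (w.injective (congrArg Subtype.val h))
  have hfin : {y | f y ≠ y}.Finite := by
    have h1 : {i | w i ≠ i}.Finite :=
      weylGroup_le_finitaryPerm d (liftableGroup_le_weylGroup hw)
    refine (h1.preimage (Subtype.val_injective.injOn)).subset fun y hy h => hy (Subtype.ext h)
  obtain ⟨y, hy⟩ := (bijective_of_injective_of_finite hf hfin).2 ⟨w i, hcon⟩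
  have hyi : (y : ι) = i := w.injective (congrArg Subtype.val hy)
  exact y.2 (by rw [hyi]; exact Or.inl le_rfl)

/-- Induction on the number of moved points: if `w` moves `i`, the reflection in `i` and `w i` is
liftable, and composing with it leaves fewer moved points. -/
theorem mem_liftableGroup_of_flagLE {w : Equiv.Perm ι} (hw : w ∈ weylGroup d)
    (h : ∀ i, FlagLE d P σ (w i) i ∧ FlagLE d P σ i (w i)) : w ∈ liftableGroup d P := by
  have hfin : {i | w i ≠ i}.Finite := weylGroup_le_finitaryPerm d hw
  induction hn : {i | w i ≠ i}.ncard using Nat.strong_induction_on generalizing w with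
  | _ n ih =>
    by_cases h1 : ∀ i, w i = i
    · rw [show w = 1 from Equiv.ext h1]
      exact one_mem _
    · obtain ⟨i, hi⟩ := not_forall.1 h1
      have hs : reflection d i (w i) ∈ liftableGroup d P := by
        rcases h i with ⟨h2 | h2, h3 | h3⟩
        · exact absurd (hσi (le_antisymm h2 h3)) hi
        · exact h3
        · rwa [reflection_comm]
        · exact h3
      obtain ⟨h4, h5⟩ := reflection_apply_self hw hi
      set s := reflection d i (w i) with hs_def
      have hsw : s * w ∈ weylGroup d := mul_mem (liftableGroup_le_weylGroup hs) hw
      have hss : {k | (s * w) k ≠ k} ⊂ {k | w k ≠ k} := by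
        refine Set.ssubset_iff_subset_ne.2 ⟨fun k hk hwk => hk ?_, fun heq => ?_⟩
        · rw [Equiv.Perm.mul_apply, hwk, h5 k hwk]
        · have : i ∈ {k | (s * w) k ≠ k} := heq ▸ hi
          exact this h4
      have hlt := Set.ncard_lt_ncard hss hfin
      have hmem := ih _ (hn ▸ hlt) hsw (fun k => ⟨?_, ?_⟩) (hfin.subset hss.1) rfl
      · have := mul_mem (inv_mem hs) hmem
        rwa [inv_mul_cancel_left] at this
      · exact (FlagLE.apply hσi hσ hσP hP hs (w k)).trans hσi hσ hσP hP (h k).1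
      · refine (h k).2.trans hσi hσ hσP hP ?_
        have := FlagLE.apply hσi hσ hσP hP (inv_mem hs) (s (w k))
        rwa [show s⁻¹ (s (w k)) = w k from s.symm_apply_apply _] at this

/-- A subgroup of `𝐆` containing the stabilizer of a maximal flag is the stabilizer of a flag. -/
theorem exists_eq_flagGroup : ∃ (A₀ : Type w) (_ : LinearOrder A₀) (σ₀ : ι → A₀),
    IsFlagMap d σ₀ ∧ P = flagGroup d σ₀ := by
  obtain ⟨A₀, hA₀, σ₀, hsurj, hle⟩ := exists_linearOrder_of_preorder (r := FlagLE d P σ)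
    (fun i => Or.inl le_rfl) (fun i j k h1 h2 => h1.trans hσi hσ hσP hP h2)
    (fun i j => (le_total (σ i) (σ j)).imp Or.inl Or.inl)
  have hσ₀ : IsFlagMap d σ₀ := by
    cases d with
    | gl => exact hsurj
    | form ω inv h =>
      refine isFlagMap_form_of_antitone h hsurj fun i j hij => ?_
      rw [hle] at hij ⊢
      refine hij.imp (hσ.antitone_inv i j) fun hr => ?_
      rw [reflection_comm]
      rwa [reflection_form, involutiveReflection_inv_inv h.involutive h.fixed_unique]
  have hcartan : cartan d ≤ P := (cartan_le_flagGroup d σ).trans hσP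
  have hσσ₀ : flagGroup d σ ≤ flagGroup d σ₀ := fun g hg =>
    ⟨hg.1, fun j => coordSpan_le_iff.2 (fun i hi => (hle i j).2 (Or.inl hi)) (hg.2 j)⟩
  have hlift : ∀ {w : Equiv.Perm ι} {n : V ≃ₗ[K] V}, IsLift d w n →
      (n ∈ flagGroup d σ₀ ↔ ∀ j, FlagLE d P σ (w j) j) := by
    intro w n hn
    rw [mem_flagGroup, and_iff_right hn.1]
    refine forall_congr' fun j => ?_
    obtain ⟨c, hc0, hc⟩ := hn.2 j
    rw [hc, Submodule.smul_mem_iff _ hc0, basis_mem_coordSpan]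
    exact hle _ _
  -- Both groups contain the stabilizer of `σ`, so by Bruhat elimination they may be compared on
  -- lifts of Weyl elements, where membership means preserving the classes of the preorder.
  refine ⟨A₀, hA₀, σ₀, hσ₀, le_antisymm (fun g hg => ?_) fun g hg => ?_⟩
  · obtain ⟨u, hu, u', hu', w, hw⟩ := exists_isLift_mul_mul hσi hσi hσ hσ (hP hg)
    have hX : (w : Equiv.Perm ι) ∈ liftableGroup d P :=
      ⟨_, mul_mem (mul_mem (hσP hu) hg) (hσP hu'), hw⟩
    have h1 := (hlift hw).2 fun j => FlagLE.apply hσi hσ hσP hP hX j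
    rwa [Subgroup.mul_mem_cancel_right _ (hσσ₀ hu'), Subgroup.mul_mem_cancel_left _ (hσσ₀ hu)] at h1
  · obtain ⟨u, hu, u', hu', w, hw⟩ := exists_isLift_mul_mul hσi hσi hσ hσ hg.1
    have h1 : u * g * u' ∈ flagGroup d σ₀ := mul_mem (mul_mem (hσσ₀ hu) hg) (hσσ₀ hu')
    have hX : (w : Equiv.Perm ι) ∈ liftableGroup d P := by
      refine mem_liftableGroup_of_flagLE hσi hσ hσP hP w.2 fun i => ⟨(hlift hw).1 h1 i, ?_⟩
      have := (hlift hw.inv).1 (inv_mem h1) ((w : Equiv.Perm ι) i)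
      rwa [show (w : Equiv.Perm ι)⁻¹ ((w : Equiv.Perm ι) i) = i from
        Equiv.symm_apply_apply _ _] at this
    have h2 := mem_of_isLift hcartan hX hw
    rwa [Subgroup.mul_mem_cancel_right _ (hσP hu'), Subgroup.mul_mem_cancel_left _ (hσP hu)] at h2

end

end Parabolic

/-! ### Separation of double cosets -/

section DoubleCosets

variable {K : Type u} {V : Type v} {ι : Type w} [Field K] [AddCommGroup V] [Module K V]
  {b : Basis ι K V} {d : Datum b} {A : Type*} [LinearOrder A] {σ : ι → A}

theorem map_mul_eq (g h : V ≃ₗ[K] V) (F : Submodule K V) :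
    F.map ((g * h : V ≃ₗ[K] V) : V →ₗ[K] V) =
      (F.map (h : V →ₗ[K] V)).map (g : V →ₗ[K] V) :=
  Submodule.map_comp (h : V →ₗ[K] V) (g : V →ₗ[K] V) F

theorem IsLift.map_coordSpan {w : Equiv.Perm ι} {g : V ≃ₗ[K] V} (h : IsLift d w g) (S : Set ι) :
    (Submodule.span K (b '' S)).map (g : V →ₗ[K] V) =
      Submodule.span K (b '' (w '' S)) := by
  refine le_antisymm (map_coordSpan_le_iff.2 fun j hj => ?_) (Submodule.span_le.2 ?_)
  · obtain ⟨c, -, hc⟩ := h.2 j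
    rw [hc]
    exact Submodule.smul_mem _ _ (basis_mem_coordSpan.2 ⟨j, hj, rfl⟩)
  · rintro _ ⟨_, ⟨j, hj, rfl⟩, rfl⟩
    obtain ⟨c, hc0, hc⟩ := h.2 j
    refine ⟨c⁻¹ • b j, Submodule.smul_mem _ _ (basis_mem_coordSpan.2 hj), ?_⟩
    change g (c⁻¹ • b j) = b (w j)
    rw [map_smul, hc, inv_smul_smul₀ hc0]

/-- An element of `𝐆` stabilizing a maximal flag has nonzero diagonal coefficients. -/
theorem repr_apply_self_ne_zero (hσi : Function.Injective σ) {u : V ≃ₗ[K] V}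
    (hu : u ∈ flagGroup d σ) (i : ι) : b.repr (u (b i)) i ≠ 0 := by
  intro h0
  have h1 : u (b i) ∈ Submodule.span K (b '' {k | σ k < σ i}) := by
    refine mem_coordSpan.2 fun k hk => ?_
    have h2 : σ k ≤ σ i := mem_coordSpan.1 (hu.2 i) k hk
    refine lt_of_le_of_ne h2 fun h3 => hk ?_
    rw [hσi h3, h0]
  have hmap := map_eq_of_mem_flagGroup hu (S := {k | σ k < σ i})
    fun j (hj : σ j < σ i) k hk => lt_of_le_of_lt hk hj
  rw [← hmap] at h1
  obtain ⟨x, hx, hxi⟩ := h1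
  have hx' : x = b i := u.injective hxi
  rw [hx'] at hx
  have h2 : i ∈ {k | σ k < σ i} := basis_mem_coordSpan.1 hx
  exact lt_irrefl (σ i) h2

/-- Nonzero diagonal coefficients keep every index of `X` in the support of the image; the same
holds for `u⁻¹`. -/
theorem coordSpan_eq_of_map_eq (hσi : Function.Injective σ) {u : V ≃ₗ[K] V}
    (hu : u ∈ flagGroup d σ) {X Y : Set ι}
    (h : (Submodule.span K (b '' X)).map (u : V →ₗ[K] V) = Submodule.span K (b '' Y)) :
    X = Y := by
  have key : ∀ {u : V ≃ₗ[K] V} {X Y : Set ι}, u ∈ flagGroup d σ →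
      (Submodule.span K (b '' X)).map (u : V →ₗ[K] V) = Submodule.span K (b '' Y) → X ⊆ Y := by
    intro u X Y hu h i hi
    have h1 : u (b i) ∈ Submodule.span K (b '' Y) := h ▸ ⟨b i, basis_mem_coordSpan.2 hi, rfl⟩
    exact mem_coordSpan.1 h1 i (repr_apply_self_ne_zero hσi hu i)
  refine (key hu h).antisymm (key (inv_mem hu) ?_)
  rw [← h, ← map_mul_eq, inv_mul_cancel]
  exact Submodule.map_id _

/-- The factor `p` preserves the span of the lower set `S`, the lift `n` carries it to that of `w
S`, and `u` must then carry this to the span of `w' S`. -/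
theorem image_eq_of_mul_eq (hσi : Function.Injective σ) {A₀ : Type*} [LinearOrder A₀]
    {σ₀ : ι → A₀} {w w' : Equiv.Perm ι} {n n' u p : V ≃ₗ[K] V} (hn : IsLift d w n)
    (hn' : IsLift d w' n') (hu : u ∈ flagGroup d σ) (hp : p ∈ flagGroup d σ₀)
    (h : u * n * p = n') {S : Set ι} (hS : ∀ j ∈ S, ∀ i, σ₀ i ≤ σ₀ j → i ∈ S) :
    w '' S = w' '' S := by
  refine coordSpan_eq_of_map_eq hσi hu ?_
  rw [← hn.map_coordSpan, ← hn'.map_coordSpan, ← h, map_mul_eq, map_eq_of_mem_flagGroup hp hS,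
    map_mul_eq]

/-- Applied to all sublevel sets of `σ₀`, the equality of images determines `σ₀ ∘ w⁻¹`. -/
theorem apply_inv_eq_of_mul_eq (hσi : Function.Injective σ) {A₀ : Type*} [LinearOrder A₀]
    {σ₀ : ι → A₀} {w w' : Equiv.Perm ι} {n n' u p : V ≃ₗ[K] V} (hn : IsLift d w n)
    (hn' : IsLift d w' n') (hu : u ∈ flagGroup d σ) (hp : p ∈ flagGroup d σ₀)
    (h : u * n * p = n') (e : ι) : σ₀ (w⁻¹ e) = σ₀ (w'⁻¹ e) := by
  have key : ∀ α, σ₀ (w⁻¹ e) ≤ α ↔ σ₀ (w'⁻¹ e) ≤ α := by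
    intro α
    have h1 := image_eq_of_mul_eq hσi hn hn' hu hp h (S := {i | σ₀ i ≤ α})
      fun j hj i hi => hi.trans hj
    have h2 := Set.ext_iff.1 h1 e
    rwa [Equiv.image_eq_preimage_symm, Equiv.image_eq_preimage_symm] at h2
  exact le_antisymm ((key _).2 le_rfl) ((key _).1 le_rfl)

theorem IsLift.mem_flagGroup {w : Equiv.Perm ι} {n : V ≃ₗ[K] V} (hn : IsLift d w n)
    (hw : ∀ e, σ (w⁻¹ e) = σ e) : n ∈ flagGroup d σ := by
  refine ⟨hn.1, fun j => ?_⟩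
  obtain ⟨c, -, hc⟩ := hn.2 j
  rw [hc]
  refine Submodule.smul_mem _ _ (basis_mem_coordSpan.2 ?_)
  have := hw (w j)
  rw [show w⁻¹ (w j) = j from w.symm_apply_apply j] at this
  exact this.ge

end DoubleCosets

end ClassicalIndGroup

/-! ### The Bruhat decomposition -/

theorem mainTheorem4 {K : Type u} {V : Type v} {ι : Type w} [Field K] [IsAlgClosed K] [CharZero K]
    [AddCommGroup V] [Module K V] [Countable ι] [Infinite ι]
    (b : Module.Basis ι K V) (d : Datum b) (P B : Subgroup (V ≃ₗ[K] V))
    (hP : IsSplittingParabolic d P) (hB : IsSplittingBorel d B) :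
    -- `P` is the stabilizer of a generalized flag given by some `σ₀ : E → A`
    (∃ (A : Type w) (_ : LinearOrder A) (σ₀ : ι → A), IsFlagMap d σ₀ ∧ IsFlagStabilizer d P σ₀) ∧
    -- every element of the Weyl group has a lift
    (∀ w : weylGroup d, ∃ g, IsLift d w g) ∧
    -- for every such `σ₀`, with `W_P` the stabilizer of `σ₀` in `W`:
    (∀ (A : Type w) [LinearOrder A] (σ₀ : ι → A), IsFlagMap d σ₀ → IsFlagStabilizer d P σ₀ →
      -- `B ŵ P` depends only on the class of `w` in `W / W_P`
      (∀ (w w' : weylGroup d) (g g' : V ≃ₗ[K] V), IsLift d w g → IsLift d w' g' →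
        (QuotientGroup.mk w : weylGroup d ⧸ weylStabilizer d σ₀) = QuotientGroup.mk w' →
        DoubleCoset.doubleCoset g (B : Set (V ≃ₗ[K] V)) (P : Set (V ≃ₗ[K] V)) =
          DoubleCoset.doubleCoset g' (B : Set (V ≃ₗ[K] V)) (P : Set (V ≃ₗ[K] V))) ∧
      -- for any choice of lifts, `G` is the disjoint union of the double cosets `B ŵ P`
      (∀ n : weylGroup d ⧸ weylStabilizer d σ₀ → (V ≃ₗ[K] V),
        (∀ c, ∃ w : weylGroup d, QuotientGroup.mk w = c ∧ IsLift d w (n c)) →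
        Pairwise (fun c c' =>
          Disjoint (DoubleCoset.doubleCoset (n c) (B : Set (V ≃ₗ[K] V)) (P : Set (V ≃ₗ[K] V)))
            (DoubleCoset.doubleCoset (n c') (B : Set (V ≃ₗ[K] V)) (P : Set (V ≃ₗ[K] V)))) ∧
        (⋃ c, DoubleCoset.doubleCoset (n c) (B : Set (V ≃ₗ[K] V)) (P : Set (V ≃ₗ[K] V))) =
          (indGroup d : Set (V ≃ₗ[K] V)))) := by
  obtain ⟨⟨hPd, -⟩, B', hB', hB'P⟩ := hP
  obtain ⟨C, _, σ, hσi, hσ, rfl⟩ := hB.exists_flagMap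
  obtain ⟨C', _, σ', hσi', hσ', rfl⟩ := hB'.exists_flagMap
  refine ⟨?_, exists_isLift d, ?_⟩
  · obtain ⟨A₀, hA₀, σ₀, hσ₀, h⟩ := exists_eq_flagGroup hσi' hσ' hB'P hPd
    exact ⟨A₀, hA₀, σ₀, hσ₀, isFlagStabilizer_iff.2 h⟩
  · intro A _ σ₀ hσ₀ hstab
    obtain rfl := isFlagStabilizer_iff.1 hstab
    refine ⟨fun w w' g g' hg hg' hww' => ?_, fun n hn => ⟨fun c c' hcc' => ?_, ?_⟩⟩
    · have h1 := QuotientGroup.eq.1 hww'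
      have h2 : g⁻¹ * g' ∈ flagGroup d σ₀ := (hg.inv.mul hg').mem_flagGroup h1
      refine (DoubleCoset.doubleCoset_eq_of_mem (DoubleCoset.mem_doubleCoset.2
        ⟨1, one_mem _, g⁻¹ * g', h2, ?_⟩)).symm
      rw [one_mul, mul_inv_cancel_left]
    · refine Set.disjoint_left.2 ?_
      intro x hx hx'
      obtain ⟨w, hwc, hw⟩ := hn c
      obtain ⟨w', hwc', hw'⟩ := hn c'
      obtain ⟨u, hu, p, hp, rfl⟩ := DoubleCoset.mem_doubleCoset.1 hx
      obtain ⟨u', hu', p', hp', h⟩ := DoubleCoset.mem_doubleCoset.1 hx'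
      have h1 : (u'⁻¹ * u) * n c * (p * p'⁻¹) = n c' := by
        rw [show (u'⁻¹ * u) * n c * (p * p'⁻¹) = u'⁻¹ * (u * n c * p) * p'⁻¹ by group, h]
        group
      have h2 := apply_inv_eq_of_mul_eq hσi hw hw' (mul_mem (inv_mem hu') hu)
        (mul_mem hp (inv_mem hp')) h1
      refine hcc' ?_
      rw [← hwc, ← hwc', QuotientGroup.eq]
      intro e
      have h3 := h2 ((w : Equiv.Perm ι) e)
      rw [show (w : Equiv.Perm ι)⁻¹ ((w : Equiv.Perm ι) e) = e from
        Equiv.symm_apply_apply _ _] at h3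
      rw [h3]
      rfl
    · ext g
      rw [Set.mem_iUnion]
      constructor
      · rintro ⟨c, hg⟩
        obtain ⟨w, -, hw⟩ := hn c
        obtain ⟨u, hu, p, hp, rfl⟩ := DoubleCoset.mem_doubleCoset.1 hg
        exact mul_mem (mul_mem hu.1 hw.1) hp.1
      · intro hg
        -- Elimination runs between the flag of `B` and the flag of the Borel subgroup inside `P`.
        -- The resulting lift differs from the chosen representative by a lift of an element of
        -- `𝐖_𝐏`, which lies in `P`.
        obtain ⟨u, hu, u', hu', w, hw⟩ := exists_isLift_mul_mul hσi hσi' hσ hσ' hg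
        refine ⟨QuotientGroup.mk w, DoubleCoset.mem_doubleCoset.2 ?_⟩
        obtain ⟨w', hww', hw'⟩ := hn (QuotientGroup.mk w)
        have h1 := (hw'.inv.mul hw).mem_flagGroup (QuotientGroup.eq.1 hww')
        refine ⟨u⁻¹, inv_mem hu, (n (QuotientGroup.mk w))⁻¹ * (u * g * u') * u'⁻¹,
          mul_mem h1 (inv_mem (hB'P hu')), ?_⟩
        group
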